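/- Let $V$ be the $15$-dimensional complex vector space of $1$-forms $\omega=a\,dX+b\,dY+c\,dZ$ on $\mathbb{C}^3$ with $a,b,c\in\mathbb{C}[X,Y,Z]$ homogeneous of degree $3$ (or zero) and $aX+bY+cZ=0$. Let $\mathscr{F}(2;2)\subset\mathbb{P}(V)=\mathbb{P}^{14}(\mathbb{C})$ be the set of quadratic foliations of $\mathbb{P}^2(\mathbb{C})$, i.e. the set of classes $[\omega]$ such that $a,b,c$ have no non-constant common factor. The group $\mathrm{PGL}_3(\mathbb{C})=\mathrm{Aut}(\mathbb{P}^2(\mathbb{C}))$ acts on $\mathbb{P}(V)$ by linear changes of coordinates; $\mathcal{O}(\mathcal{F})$ denotes the orbit of $\mathcal{F}$, and closures of orbits are taken in $\mathscr{F}(2;2)$ for the usual topology. The dimension of an orbit is its dimension as a homogeneous space, i.e. the rank at the identity of the orbit map $\mathrm{PGL}_3(\mathbb{C})\to\mathbb{P}(V)$. Let $\mathcal{F}_1$ be the foliation given in the affine chart $Z=1$ by $x^2\,dx+y^2(x\,dy-y\,dx)$. Then there is a Zariski closed subset $\Sigma\subset\mathbb{P}(V)$ not containing $\mathscr{F}(2;2)$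 such that, for every $\mathcal{F}\in\mathscr{F}(2;2)\setminus\Sigma$, the closure $\overline{\mathcal{O}(\mathcal{F})}$ in $\mathscr{F}(2;2)$ contains at least seven distinct orbits of dimension $7$, and contains exactly one orbit of dimension $6$, namely $\mathcal{O}(\mathcal{F}_1)$. -/

import Mathlib

open MvPolynomial
open scoped LinearAlgebra.Projectivization MatrixGroups

noncomputable section

namespace QuadFol

/-- A polynomial `1`-form `ω 0 dX + ω 1 dY + ω 2 dZ` on `ℂ³`, given by its three coefficients;
the variables `X 0, X 1, X 2` are the homogeneous coordinates `X, Y, Z`. -/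
abbrev PolyForm : Type := Fin 3 → MvPolynomial (Fin 3) ℂ

/-- The linear form `∑ k, A i k * X k`, the `i`-th component of the linear map `A`. -/
def linForm (A : Matrix (Fin 3) (Fin 3) ℂ) (i : Fin 3) : MvPolynomial (Fin 3) ℂ :=
  ∑ k, C (A i k) * X k

/-- The pullback of the `1`-form `ω` by the linear map `A : ℂ³ → ℂ³`:
the coefficient of `dX j` in `A^* ω` is `∑ i, (ω i ∘ A) * A i j`. -/
def pullback (A : Matrix (Fin 3) (Fin 3) ℂ) (ω : PolyForm) : PolyForm :=
  fun j => ∑ i, aeval (linForm A) (ω i) * C (A i j)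

/-- The space of homogeneous `1`-forms `a dX + b dY + c dZ` with `a, b, c` homogeneous of degree
`3` (or zero) and `a X + b Y + c Z = 0`. It has dimension `15`. -/
def formSpace : Submodule ℂ PolyForm where
  carrier := {ω | (∀ i, (ω i).IsHomogeneous 3) ∧ ∑ i, ω i * X i = 0}
  zero_mem' := ⟨fun _ => isHomogeneous_zero _ _ _, by simp⟩
  add_mem' := by
    rintro ω η ⟨h1, h2⟩ ⟨h3, h4⟩
    exact ⟨fun i => (h1 i).add (h3 i), by simp [add_mul, Finset.sum_add_distrib, h2, h4]⟩
  smul_mem' := by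
    rintro c ω ⟨h1, h2⟩
    refine ⟨fun i => ?_, ?_⟩
    · simpa [MvPolynomial.smul_eq_C_mul] using (h1 i).C_mul c
    · simp [← Finset.smul_sum, h2]

theorem linForm_add (A B : Matrix (Fin 3) (Fin 3) ℂ) (i : Fin 3) :
    linForm (A + B) i = linForm A i + linForm B i := by
  simp [linForm, add_mul, Finset.sum_add_distrib]

theorem linForm_smul (c : ℂ) (A : Matrix (Fin 3) (Fin 3) ℂ) (i : Fin 3) :
    linForm (c • A) i = C c * linForm A i := by
  simp [linForm, Finset.mul_sum, mul_assoc]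

theorem linForm_isHomogeneous (A : Matrix (Fin 3) (Fin 3) ℂ) (i : Fin 3) :
    (linForm A i).IsHomogeneous 1 :=
  IsHomogeneous.sum _ _ _ fun k _ => (isHomogeneous_X ℂ k).C_mul (A i k)

theorem pullback_mem (A : Matrix (Fin 3) (Fin 3) ℂ) {ω : PolyForm} (h : ω ∈ formSpace) :
    pullback A ω ∈ formSpace := by
  obtain ⟨h1, h2⟩ := h
  refine ⟨fun j => IsHomogeneous.sum _ _ _ fun i _ => ?_, ?_⟩
  · have := ((h1 i).aeval _ (linForm_isHomogeneous A)).mul (isHomogeneous_C (Fin 3) (A i j))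
    simpa using this
  · have h3 := congrArg (aeval (linForm A)) h2
    simp only [map_sum, map_mul, aeval_X, map_zero] at h3
    rw [← h3]
    simp only [pullback, Finset.sum_mul]
    rw [Finset.sum_comm]
    refine Finset.sum_congr rfl fun i _ => ?_
    rw [linForm, Finset.mul_sum]
    exact Finset.sum_congr rfl fun k _ => by ring

theorem pullback_one (ω : PolyForm) : pullback 1 ω = ω := by
  have h : linForm 1 = X := by
    funext i
    simp [linForm, Matrix.one_apply, apply_ite C, ite_mul]
  funext j
  simp [pullback, h, Matrix.one_apply]

theorem pullback_mul (A B : Matrix (Fin 3) (Fin 3) ℂ) (ω : PolyForm) :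
    pullback (A * B) ω = pullback B (pullback A ω) := by
  have h : ∀ i, aeval (linForm B) (linForm A i) = linForm (A * B) i := by
    intro i
    simp only [linForm, map_sum, map_mul, aeval_X, algHom_C, algebraMap_eq, Matrix.mul_apply,
      Finset.mul_sum, Finset.sum_mul]
    rw [Finset.sum_comm]
    exact Finset.sum_congr rfl fun i _ => Finset.sum_congr rfl fun k _ => by ring
  have h' : ∀ p : MvPolynomial (Fin 3) ℂ, aeval (linForm B) (aeval (linForm A) p) = aeval (linForm (A * B)) p := by
    have e : (aeval (linForm B)).comp (aeval (linForm A)) = aeval (linForm (A * B)) :=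
      algHom_ext fun i => by rw [AlgHom.comp_apply, aeval_X, aeval_X, h]
    exact DFunLike.congr_fun e
  funext j
  simp only [pullback, map_sum, map_mul, algHom_C, algebraMap_eq, h', Matrix.mul_apply,
    Finset.mul_sum, Finset.sum_mul]
  rw [Finset.sum_comm]
  exact Finset.sum_congr rfl fun i _ => Finset.sum_congr rfl fun k _ => by ring

theorem pullback_add (A : Matrix (Fin 3) (Fin 3) ℂ) (ω η : PolyForm) :
    pullback A (ω + η) = pullback A ω + pullback A η := by
  funext j
  simp [pullback, add_mul, Finset.sum_add_distrib]

theorem pullback_smul (A : Matrix (Fin 3) (Fin 3) ℂ) (c : ℂ) (ω : PolyForm) :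
    pullback A (c • ω) = c • pullback A ω := by
  funext j
  simp [pullback, Finset.smul_sum]

/-- `GL₃(ℂ)` acts linearly on the space of forms by `g • ω = (g⁻¹)^* ω`. -/
instance : DistribMulAction (GL (Fin 3) ℂ) formSpace where
  smul g ω := ⟨pullback ((g⁻¹ : GL (Fin 3) ℂ) : Matrix (Fin 3) (Fin 3) ℂ) ω, pullback_mem _ ω.2⟩
  one_smul ω := Subtype.ext <| by
    change pullback ((1⁻¹ : GL (Fin 3) ℂ) : Matrix (Fin 3) (Fin 3) ℂ) ω = ω
    rw [inv_one]
    exact pullback_one _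
  mul_smul g h ω := Subtype.ext <| by
    change pullback (((g * h)⁻¹ : GL (Fin 3) ℂ) : Matrix (Fin 3) (Fin 3) ℂ) ω = _
    rw [mul_inv_rev, Units.val_mul]
    exact pullback_mul _ _ _
  smul_zero _ := Subtype.ext <| by
    change pullback _ 0 = 0
    simpa using pullback_smul _ 0 0
  smul_add _ ω η := Subtype.ext <| pullback_add _ _ _

theorem coe_smul (g : GL (Fin 3) ℂ) (ω : formSpace) :
    ((g • ω : formSpace) : PolyForm)
      = pullback ((g⁻¹ : GL (Fin 3) ℂ) : Matrix (Fin 3) (Fin 3) ℂ) ω := rfl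

instance : SMulCommClass (GL (Fin 3) ℂ) ℂ formSpace where
  smul_comm g c ω := Subtype.ext <| pullback_smul _ c ω

/-- The projective space `ℙ¹⁴(ℂ)` of forms up to a non-zero constant. -/
abbrev FormProj : Type := ℙ ℂ formSpace

theorem pullback_scalar (c : ℂ) {ω : PolyForm} (h : ω ∈ formSpace) :
    pullback (Matrix.scalar (Fin 3) c) ω = (c ^ 4) • ω := by
  have hl : linForm (Matrix.scalar (Fin 3) c) = fun i => C c * X i := by
    funext i
    simp [linForm, Matrix.diagonal_apply, apply_ite C, ite_mul]
  have hp : ∀ p : MvPolynomial (Fin 3) ℂ, p.IsHomogeneous 3 →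
      aeval (fun i => C c * X i : Fin 3 → MvPolynomial (Fin 3) ℂ) p = C (c ^ 3) * p := by
    intro p hp
    conv_lhs => rw [p.as_sum]
    conv_rhs => rw [p.as_sum]
    rw [map_sum, Finset.mul_sum]
    refine Finset.sum_congr rfl fun d hd => ?_
    have hd3 : d.degree = 3 := by
      have := hp (mem_support_iff.mp hd)
      rwa [Finsupp.degree_eq_weight_one]
    rw [aeval_monomial, monomial_eq, Finsupp.prod, Finsupp.prod]
    simp only [mul_pow, Finset.prod_mul_distrib, Finset.prod_pow_eq_pow_sum, algebraMap_eq]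
    rw [← Finsupp.degree_apply, hd3, map_pow]
    ring
  funext j
  simp only [pullback, hl, hp _ (h.1 _)]
  simp only [Matrix.scalar_apply, Matrix.diagonal_apply, apply_ite C, map_zero, mul_ite, mul_zero,
    Finset.sum_ite_eq', Finset.mem_univ, if_true, Pi.smul_apply, smul_eq_C_mul, map_pow]
  ring

/-- The induced action of `PGL₃(ℂ) = Aut(ℙ²(ℂ))` on `ℙ¹⁴(ℂ)`. -/
instance : MulAction PGL(3, ℂ) FormProj :=
  Matrix.ProjGenLinGroup.mulActionOfGL fun u => Projectivization.ind fun v hv => by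
    rw [Projectivization.smul_mk, Projectivization.mk_eq_mk_iff']
    refine ⟨((u⁻¹ : ℂˣ) : ℂ) ^ 4, Subtype.ext ?_⟩
    rw [coe_smul, ← map_inv]
    exact (pullback_scalar _ v.2).symm

/-- The usual topology of `formSpace ≅ ℂ¹⁵`: that of the coefficients. -/
instance : TopologicalSpace formSpace :=
  TopologicalSpace.induced
    (fun (ω : formSpace) (i : Fin 3) (d : Fin 3 →₀ ℕ) => coeff d (ω.1 i)) inferInstance

/-- The usual topology of `ℙ¹⁴(ℂ)`: the quotient topology. -/
instance : TopologicalSpace FormProj :=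
  TopologicalSpace.coinduced
    (fun v : {v : formSpace // v ≠ 0} => Projectivization.mk ℂ v.1 v.2) inferInstance

/-- `Z ⊆ ℙ¹⁴(ℂ)` is Zariski closed (algebraic): it is the zero locus of a set of homogeneous
polynomials in the coefficients of the form. -/
def IsZariskiClosed (Z : Set FormProj) : Prop :=
  ∃ S : Set (MvPolynomial (Fin 3 × (Fin 3 →₀ ℕ)) ℂ),
    (∀ P ∈ S, ∃ n : ℕ, P.IsHomogeneous n) ∧
    Z = {F | ∀ P ∈ S, eval (fun x => coeff x.2 (F.rep.1 x.1)) P = 0}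

/-- The set `𝓕(2;2)` of quadratic foliations of `ℙ²(ℂ)`: the classes of forms whose three
coefficients have no common factor. -/
def foliations : Set FormProj :=
  {F | ∀ p : MvPolynomial (Fin 3) ℂ, (∀ i, p ∣ F.rep.1 i) → IsUnit p}

/-- The closure of a set of foliations inside `𝓕(2;2)`, for the usual topology. -/
def closureIn (O : Set FormProj) : Set FormProj :=
  closure O ∩ foliations

/-- The Lie derivative of `ω` along the linear vector field `∑ i, (A X) i ∂/∂X i`; this is the
derivative of `(1 + t A)^* ω` at `t = 0`. -/
def lieDerivative (ω : PolyForm) : Matrix (Fin 3) (Fin 3) ℂ →ₗ[ℂ] PolyForm where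
  toFun A := fun j => ∑ i, (linForm A i * pderiv i (ω j) + ω i * C (A i j))
  map_add' A B := by
    funext j
    rw [Pi.add_apply, ← Finset.sum_add_distrib]
    refine Finset.sum_congr rfl fun i _ => ?_
    rw [linForm_add, Matrix.add_apply, C_add]
    ring
  map_smul' c A := by
    funext j
    rw [RingHom.id_apply, Pi.smul_apply, smul_eq_C_mul, Finset.mul_sum]
    refine Finset.sum_congr rfl fun i _ => ?_
    rw [linForm_smul, Matrix.smul_apply, smul_eq_mul, C_mul]
    ring

/-- The dimension of the orbit of `F = [ω]` under `PGL₃(ℂ)`, as a homogeneous space: the dimension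
of its tangent space at `F`, the image of the Lie algebra `𝔤𝔩₃` under the differential
`A ↦ L_A ω mod ℂ ω` at the identity of the orbit map with values in `ℙ¹⁴(ℂ)`. -/
def orbitDim (F : FormProj) : ℕ :=
  Module.finrank ℂ
    ((LinearMap.range (lieDerivative F.rep.1)).map
      (Submodule.span ℂ {(F.rep.1 : PolyForm)}).mkQ)

/-- `O` is the orbit of some quadratic foliation, and it has dimension `d`. -/
def IsOrbitOfDim (d : ℕ) (O : Set FormProj) : Prop :=
  ∃ G ∈ foliations, O = MulAction.orbit PGL(3, ℂ) G ∧ orbitDim G = d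

/-- The form `(X² Z - Y³) dX + X Y² dY - X³ dZ`, which in the affine chart `Z = 1` reads
`x² dx + y² (x dy - y dx)`. -/
def omega1 : formSpace :=
  ⟨![X 0 ^ 2 * X 2 - X 1 ^ 3, X 0 * X 1 ^ 2, -X 0 ^ 3], by
    refine ⟨fun i => ?_, ?_⟩
    · fin_cases i
      · exact (((isHomogeneous_X ℂ 0).pow 2).mul (isHomogeneous_X ℂ 2)).sub
          ((isHomogeneous_X ℂ 1).pow 3)
      · exact (isHomogeneous_X ℂ 0).mul ((isHomogeneous_X ℂ 1).pow 2)
      · exact ((isHomogeneous_X ℂ 0).pow 3).neg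
    · simp [Fin.sum_univ_three]
      ring⟩

theorem omega1_ne_zero : omega1 ≠ 0 := by
  intro h
  have h1 : (X 0 * X 1 ^ 2 : MvPolynomial (Fin 3) ℂ) = 0 :=
    congrArg (fun ω : formSpace => ω.1 1) h
  exact mul_ne_zero (X_ne_zero _) (pow_ne_zero _ (X_ne_zero _)) h1

/-- The foliation `𝓕₁`. -/
def F1 : FormProj := Projectivization.mk ℂ omega1 omega1_ne_zero

end QuadFol

end

/-!
A form `ω` of the space `formSpace` is the cross product of the radial vector field with a quadratic
vector field on `ℂ³`, which is unique up to multiples of the radial field. This gives fifteen linear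
coordinates `w`, in which pullbacks are `rho g w` and Lie derivatives are `kappa (lie A (can w))`.
Closures of orbits are computed in the cone `ℂ¹⁵` (`pt_mem_closure_orbit_iff`), and the dimension of
an orbit is `9` minus that of the infinitesimal stabilizer `stab w` in `𝔤𝔩₃`
(`orbitDim_add_finrank_stab`).

*Orbits of dimension seven.* A generic form has singular points in general position. Moving four of
them to the points of the standard frame, it becomes equivalent to a member of the seven-parameter
family `familyAt 0 n`. This is `exists_equivalent_familyAt`: the map `(g, n) ↦ rho g (familyAt 0 n)`
has an invertible Jacobian at one point, so that it is dominant, and Chevalley's theorem provides a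
hypersurface outside of which all forms are reached by parameters satisfying an open condition. At a
singular point with distinct eigenvalues, the one-parameter group `diag(1, t, t²)` adapted to an
eigenline which is not invariant degenerates the foliation to a model `eta r`, where `-r` is the
quotient of the two eigenvalues. The orbit of `eta r` has dimension `7`, and it determines `r`
(`eq_of_equivalent_eta`). The two eigenlines at a point give the two different numbers `r` and
`r⁻¹`, which are determined by the Baum-Bott index `tr ^ 2 / dt` of the point. Generically the four
points have different indices, hence there are eight orbits of dimension `7` in the closure.

*The orbit of `𝓕₁`.* It has dimension `6`. In turn, `eta r` has an inflectional tangent, along which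
the one-parameter group `diag(1, t, t³)` degenerates it to `𝓕₁` (`f1_mem_closure_eta`).

*No other orbit of dimension six.* A foliation with an orbit of dimension `6` has two independent
trace-free symmetries, and some combination of them and of the identity has a double eigenvalue `0`.
Going through its possible Jordan forms shows that the foliation is equivalent to `𝓕₁`, or that it
has a nondegenerate singular point whose linear part has a multiple eigenvalue
(`isF1OrDegenerate_of_finrank_stab`). The second case does not occur in the closure of a generic
orbit. Indeed, the forms which have a singular point of vanishing discriminant depend on fourteen
parameters, hence lie on a hypersurface (`exists_noDegenerate`). For a form outside of it, the
quotient of the discriminant and the determinant of the linear part at a singular point is bounded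
away from zero, because the singular points form a compact set; this quotient is invariant by
changes of coordinates, so the bound holds on the whole orbit. Since nondegenerate singular points
persist under small perturbations, the bound passes to the closure (`NoDegenerate.disc_ne_zero`).
-/

noncomputable section

namespace QuadFol

/-! ### Quadratic vector fields and forms -/

section Tensor

variable {R S : Type*} [CommRing R] [CommRing S]

/-- The transformation law of the quadratic vector field with coefficients `T` under the linear
change of coordinates `g`, up to the factor `det g`: `q ↦ adj(g) (q ∘ g)`. -/
def act (g : Matrix (Fin 3) (Fin 3) R) (T : Fin 3 → Fin 3 → Fin 3 → R) :
    Fin 3 → Fin 3 → Fin 3 → R :=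
  fun i j k => ∑ l, g.adjugate i l * ∑ a, ∑ b, T l a b * g a j * g b k

/-- The derivative of `act` at the identity, in the direction `A`. -/
def lie (A : Matrix (Fin 3) (Fin 3) R) (T : Fin 3 → Fin 3 → Fin 3 → R) :
    Fin 3 → Fin 3 → Fin 3 → R :=
  fun i j k => A.trace * T i j k - ∑ l, A i l * T l j k +
    ∑ a, (T i a k * A a j + T i j a * A a k)

/-- Fifteen linear coordinates of a quadratic vector field `T` modulo symmetrization and modulo
the multiples of the radial vector field. -/
def kappa (T : Fin 3 → Fin 3 → Fin 3 → R) : Fin 15 → R :=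
  ![T 2 0 0, T 2 0 1 + T 2 1 0, T 2 1 1, T 2 0 2 + T 2 2 0 - T 0 0 0, T 2 1 2 + T 2 2 1 - T 1 1 1,
    T 1 2 2, T 1 2 0 + T 1 0 2, T 1 0 0, T 1 2 1 + T 1 1 2 - T 2 2 2, T 1 1 0 + T 1 0 1 - T 0 0 0,
    T 0 1 1, T 0 1 2 + T 0 2 1, T 0 2 2, T 0 1 0 + T 0 0 1 - T 1 1 1, T 0 0 2 + T 0 2 0 - T 2 2 2]

/-- The quadratic vector field with coordinates `w` such that the `i`-th component contains no
multiple of the square of the `i`-th variable. -/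
def can (w : Fin 15 → R) : Fin 3 → Fin 3 → Fin 3 → R :=
  ![![![0, w 13, w 14], ![0, w 10, w 11], ![0, 0, w 12]],
    ![![w 7, w 9, w 6], ![0, 0, w 8], ![0, 0, w 5]],
    ![![w 0, w 1, w 3], ![0, w 2, w 4], ![0, 0, 0]]]

/-- The action of a linear change of coordinates on the fifteen coordinates of a form. -/
def rho (g : Matrix (Fin 3) (Fin 3) R) (w : Fin 15 → R) : Fin 15 → R := kappa (act g (can w))

theorem kappa_apply (T : Fin 3 → Fin 3 → Fin 3 → R) :
      kappa T 0 = T 2 0 0 ∧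
      kappa T 1 = T 2 0 1 + T 2 1 0 ∧
      kappa T 2 = T 2 1 1 ∧
      kappa T 3 = T 2 0 2 + T 2 2 0 - T 0 0 0 ∧
      kappa T 4 = T 2 1 2 + T 2 2 1 - T 1 1 1 ∧
      kappa T 5 = T 1 2 2 ∧
      kappa T 6 = T 1 2 0 + T 1 0 2 ∧
      kappa T 7 = T 1 0 0 ∧
      kappa T 8 = T 1 2 1 + T 1 1 2 - T 2 2 2 ∧
      kappa T 9 = T 1 1 0 + T 1 0 1 - T 0 0 0 ∧
      kappa T 10 = T 0 1 1 ∧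
      kappa T 11 = T 0 1 2 + T 0 2 1 ∧
      kappa T 12 = T 0 2 2 ∧
      kappa T 13 = T 0 1 0 + T 0 0 1 - T 1 1 1 ∧
      kappa T 14 = T 0 0 2 + T 0 2 0 - T 2 2 2 :=
  ⟨rfl, rfl, rfl, rfl, rfl, rfl, rfl, rfl, rfl, rfl, rfl, rfl, rfl, rfl, rfl⟩

theorem can_apply (w : Fin 15 → R) :
      can w 0 0 0 = 0 ∧ can w 0 0 1 = w 13 ∧ can w 0 0 2 = w 14 ∧
      can w 0 1 0 = 0 ∧ can w 0 1 1 = w 10 ∧ can w 0 1 2 = w 11 ∧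
      can w 0 2 0 = 0 ∧ can w 0 2 1 = 0 ∧ can w 0 2 2 = w 12 ∧
      can w 1 0 0 = w 7 ∧ can w 1 0 1 = w 9 ∧ can w 1 0 2 = w 6 ∧
      can w 1 1 0 = 0 ∧ can w 1 1 1 = 0 ∧ can w 1 1 2 = w 8 ∧
      can w 1 2 0 = 0 ∧ can w 1 2 1 = 0 ∧ can w 1 2 2 = w 5 ∧
      can w 2 0 0 = w 0 ∧ can w 2 0 1 = w 1 ∧ can w 2 0 2 = w 3 ∧
      can w 2 1 0 = 0 ∧ can w 2 1 1 = w 2 ∧ can w 2 1 2 = w 4 ∧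
      can w 2 2 0 = 0 ∧ can w 2 2 1 = 0 ∧ can w 2 2 2 = 0 := by
  refine ⟨rfl, rfl, rfl, rfl, rfl, rfl, rfl, rfl, rfl, rfl, rfl, rfl, rfl, rfl,
    rfl, rfl, rfl, rfl, rfl, rfl, rfl, rfl, rfl, rfl, rfl, rfl, rfl⟩

theorem funext_fifteen {α : Type*} {v v' : Fin 15 → α} (h0 : v 0 = v' 0) (h1 : v 1 = v' 1)
    (h2 : v 2 = v' 2) (h3 : v 3 = v' 3) (h4 : v 4 = v' 4) (h5 : v 5 = v' 5) (h6 : v 6 = v' 6)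
    (h7 : v 7 = v' 7) (h8 : v 8 = v' 8) (h9 : v 9 = v' 9) (h10 : v 10 = v' 10)
    (h11 : v 11 = v' 11) (h12 : v 12 = v' 12) (h13 : v 13 = v' 13) (h14 : v 14 = v' 14) :
    v = v' := by
  funext i
  fin_cases i <;> assumption

theorem kappa_can (w : Fin 15 → R) : kappa (can w) = w := by
  funext i
  fin_cases i <;> simp [kappa, can]

theorem map_act (φ : R →+* S) (g : Matrix (Fin 3) (Fin 3) R) (T : Fin 3 → Fin 3 → Fin 3 → R)
    (i j k : Fin 3) :
    φ (act g T i j k) = act (g.map φ) (fun i j k => φ (T i j k)) i j k := by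
  have h : (g.map φ).adjugate = g.adjugate.map φ := (φ.map_adjugate g).symm
  simp [act, h]

theorem map_kappa (φ : R →+* S) (T : Fin 3 → Fin 3 → Fin 3 → R) (i : Fin 15) :
    φ (kappa T i) = kappa (fun i j k => φ (T i j k)) i := by
  fin_cases i <;> simp [kappa]

theorem map_can (φ : R →+* S) (w : Fin 15 → R) (i j k : Fin 3) :
    φ (can w i j k) = can (fun i => φ (w i)) i j k := by
  fin_cases i <;> fin_cases j <;> fin_cases k <;> simp [can]

theorem map_rho (φ : R →+* S) (g : Matrix (Fin 3) (Fin 3) R) (w : Fin 15 → R) (i : Fin 15) :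
    φ (rho g w i) = rho (g.map φ) (fun i => φ (w i)) i := by
  simp only [rho, map_kappa, map_act, map_can]

end Tensor

/-- The `i`-th component of the quadratic vector field with coefficients `T`. -/
def quad (T : Fin 3 → Fin 3 → Fin 3 → ℂ) (i : Fin 3) : MvPolynomial (Fin 3) ℂ :=
  ∑ j, ∑ k, C (T i j k) * X j * X k

/-- The contraction of the volume form with the radial field and the quadratic vector field with
coefficients `T`: the coefficients are those of the cross product of the two fields. -/
def form (T : Fin 3 → Fin 3 → Fin 3 → ℂ) : PolyForm :=
  ![quad T 1 * X 2 - quad T 2 * X 1, quad T 2 * X 0 - quad T 0 * X 2,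
    quad T 0 * X 1 - quad T 1 * X 0]

theorem quad_isHomogeneous (T : Fin 3 → Fin 3 → Fin 3 → ℂ) (i : Fin 3) :
    (quad T i).IsHomogeneous 2 :=
  IsHomogeneous.sum _ _ _ fun j _ => IsHomogeneous.sum _ _ _ fun k _ =>
    ((isHomogeneous_C_mul_X (T i j k) j).mul (isHomogeneous_X ℂ k))

theorem form_mem (T : Fin 3 → Fin 3 → Fin 3 → ℂ) : form T ∈ formSpace := by
  have h : ∀ i j : Fin 3, (quad T i * X j).IsHomogeneous 3 := fun i j =>
    (quad_isHomogeneous T i).mul (isHomogeneous_X ℂ j)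
  refine ⟨fun i => ?_, ?_⟩
  · fin_cases i <;> exact (h _ _).sub (h _ _)
  · simp [form, Fin.sum_univ_three]
    ring

theorem quad_act (g : Matrix (Fin 3) (Fin 3) ℂ) (T : Fin 3 → Fin 3 → Fin 3 → ℂ) (i : Fin 3) :
    quad (act g T) i = ∑ l, C (g.adjugate i l) * aeval (linForm g) (quad T l) := by
  have h : ∀ l, aeval (linForm g) (quad T l)
      = ∑ j, ∑ k, C (∑ a, ∑ b, T l a b * g a j * g b k) * X j * X k := by
    intro l
    simp only [quad, linForm, Fin.sum_univ_three, map_add, map_mul, aeval_X, algHom_C,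
      algebraMap_eq]
    ring
  simp only [h]
  simp only [quad, act, Fin.sum_univ_three, map_add, map_mul]
  ring

theorem pullback_form (g : Matrix (Fin 3) (Fin 3) ℂ) (T : Fin 3 → Fin 3 → Fin 3 → ℂ) :
    pullback g (form T) = form (act g T) := by
  funext j
  simp only [pullback, form, quad_act, Fin.sum_univ_three]
  simp only [Matrix.cons_val, Matrix.cons_val_zero, Matrix.cons_val_one, map_sub, map_mul, aeval_X]
  generalize aeval (linForm g) (quad T 0) = a
  generalize aeval (linForm g) (quad T 1) = b
  generalize aeval (linForm g) (quad T 2) = c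
  rw [Matrix.adjugate_fin_three]
  fin_cases j <;>
  · simp [linForm, Fin.sum_univ_three]
    ring

theorem pderiv_quad (T : Fin 3 → Fin 3 → Fin 3 → ℂ) (i l : Fin 3) :
    pderiv l (quad T i) = ∑ a, C (T i a l + T i l a) * X a := by
  fin_cases l <;> simp [quad, Fin.sum_univ_three, pderiv_X] <;> ring

theorem lieDerivative_form (A : Matrix (Fin 3) (Fin 3) ℂ) (T : Fin 3 → Fin 3 → Fin 3 → ℂ) :
    lieDerivative (form T) A = form (lie A T) := by
  have h : ∀ i, quad (lie A T) i = C A.trace * quad T i - ∑ l, C (A i l) * quad T l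
      + ∑ l, linForm A l * pderiv l (quad T i) := by
    intro i
    simp only [pderiv_quad]
    simp only [quad, lie, linForm, Fin.sum_univ_three, map_add, map_mul, map_sub]
    ring
  funext j
  change ∑ i, (linForm A i * pderiv i (form T j) + form T i * C (A i j)) = _
  fin_cases j <;>
  · simp [form, h, Fin.sum_univ_three, pderiv_X, Pi.single_apply, Matrix.trace_fin_three, linForm]
    ring

/-- The form depends only on the coordinates `kappa` of the vector field: changing the field by a
multiple of the radial field does not change the cross product. -/
theorem form_eq_can (T : Fin 3 → Fin 3 → Fin 3 → ℂ) : form T = form (can (kappa T)) := by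
  funext j
  fin_cases j <;>
  · simp [form, quad, can, kappa, Fin.sum_univ_three]
    ring

/-- The form with coordinates `w`. -/
def formK (w : Fin 15 → ℂ) : formSpace := ⟨form (can w), form_mem _⟩

theorem coe_formK (w : Fin 15 → ℂ) : (formK w : PolyForm) = form (can w) := rfl

/-- The exponent of the monomial `X ^ a * Y ^ b * Z ^ c`. -/
def mon (a b c : ℕ) : Fin 3 →₀ ℕ := Finsupp.equivFunOnFinite.symm ![a, b, c]

theorem mon_inj {a b c a' b' c' : ℕ} : mon a b c = mon a' b' c' ↔ a = a' ∧ b = b' ∧ c = c' := by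
  simp [mon]

theorem mon_add (a b c a' b' c' : ℕ) :
    mon a b c + mon a' b' c' = mon (a + a') (b + b') (c + c') := by
  ext i
  fin_cases i <;> simp [mon]

theorem eq_mon (d : Fin 3 →₀ ℕ) : d = mon (d 0) (d 1) (d 2) := by
  ext i
  fin_cases i <;> simp [mon]

theorem X_eq_mon : (X 0 : MvPolynomial (Fin 3) ℂ) = monomial (mon 1 0 0) 1 ∧
    (X 1 : MvPolynomial (Fin 3) ℂ) = monomial (mon 0 1 0) 1 ∧
    (X 2 : MvPolynomial (Fin 3) ℂ) = monomial (mon 0 0 1) 1 := by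
  have h0 : Finsupp.single (0 : Fin 3) 1 = mon 1 0 0 := by
    ext i
    fin_cases i <;> simp [mon]
  have h1 : Finsupp.single (1 : Fin 3) 1 = mon 0 1 0 := by
    ext i
    fin_cases i <;> simp [mon]
  have h2 : Finsupp.single (2 : Fin 3) 1 = mon 0 0 1 := by
    ext i
    fin_cases i <;> simp [mon]
  exact ⟨by rw [← h0]; rfl, by rw [← h1]; rfl, by rw [← h2]; rfl⟩

theorem C_eq_mon (c : ℂ) : (C c : MvPolynomial (Fin 3) ℂ) = monomial (mon 0 0 0) c := by
  have h0 : mon 0 0 0 = 0 := by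
    ext i
    fin_cases i <;> simp [mon]
  rw [h0]
  rfl

/-- The coordinates of a form, read off from its coefficients. -/
def sec (ω : PolyForm) : Fin 15 → ℂ :=
  ![coeff (mon 3 0 0) (ω 1), coeff (mon 2 1 0) (ω 1), coeff (mon 1 2 0) (ω 1),
    coeff (mon 2 0 1) (ω 1), -coeff (mon 0 2 1) (ω 0),
    coeff (mon 0 0 3) (ω 0), coeff (mon 1 0 2) (ω 0), coeff (mon 2 0 1) (ω 0),
    coeff (mon 0 1 2) (ω 0), -coeff (mon 2 1 0) (ω 2),
    coeff (mon 0 3 0) (ω 2), coeff (mon 0 2 1) (ω 2), coeff (mon 0 1 2) (ω 2),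
    coeff (mon 1 2 0) (ω 2), -coeff (mon 1 0 2) (ω 1)]

theorem sec_form_can (w : Fin 15 → ℂ) : sec (form (can w)) = w := by
  funext i
  fin_cases i <;>
  simp [sec, form, quad, can, Fin.sum_univ_three, X_eq_mon, C_eq_mon, monomial_mul, mon_add,
    coeff_monomial, mon_inj, add_mul]

/-- The ternary cubic with the given coefficients. -/
def cubic (a1 a2 a3 a4 a5 a6 a7 a8 a9 a10 : ℂ) : MvPolynomial (Fin 3) ℂ :=
  monomial (mon 3 0 0) a1 + monomial (mon 2 1 0) a2 + monomial (mon 2 0 1) a3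
    + monomial (mon 1 2 0) a4 + monomial (mon 1 1 1) a5 + monomial (mon 1 0 2) a6
    + monomial (mon 0 3 0) a7 + monomial (mon 0 2 1) a8 + monomial (mon 0 1 2) a9
    + monomial (mon 0 0 3) a10

theorem eq_cubic_of_isHomogeneous {p : MvPolynomial (Fin 3) ℂ} (hp : p.IsHomogeneous 3) :
    p = cubic (coeff (mon 3 0 0) p) (coeff (mon 2 1 0) p) (coeff (mon 2 0 1) p)
      (coeff (mon 1 2 0) p) (coeff (mon 1 1 1) p) (coeff (mon 1 0 2) p) (coeff (mon 0 3 0) p)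
      (coeff (mon 0 2 1) p) (coeff (mon 0 1 2) p) (coeff (mon 0 0 3) p) := by
  ext d
  by_cases h : d.degree = 3
  · rw [eq_mon d] at h ⊢
    generalize d 0 = a at *
    generalize d 1 = b at *
    generalize d 2 = c at *
    have h' : a + b + c = 3 := by
      simpa [mon, Finsupp.degree_eq_sum, Fin.sum_univ_three] using h
    have ha : a ≤ 3 := by omega
    have hb : b ≤ 3 := by omega
    obtain rfl : c = 3 - a - b := by omega
    interval_cases a <;> interval_cases b <;>
      first | omega | simp [cubic, coeff_monomial, mon_inj]
  · rw [hp.coeff_eq_zero h]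
    have h' : ∀ a b c : ℕ, a + b + c = 3 → mon a b c ≠ d := by
      rintro a b c habc rfl
      apply h
      simpa [mon, Finsupp.degree_eq_sum, Fin.sum_univ_three] using habc
    simp [cubic, coeff_monomial, h']

theorem cubic_eq (a1 a2 a3 a4 a5 a6 a7 a8 a9 a10 : ℂ) :
    cubic a1 a2 a3 a4 a5 a6 a7 a8 a9 a10 = C a1 * X 0 ^ 3 + C a2 * X 0 ^ 2 * X 1
      + C a3 * X 0 ^ 2 * X 2 + C a4 * X 0 * X 1 ^ 2 + C a5 * X 0 * X 1 * X 2
      + C a6 * X 0 * X 2 ^ 2 + C a7 * X 1 ^ 3 + C a8 * X 1 ^ 2 * X 2 + C a9 * X 1 * X 2 ^ 2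
      + C a10 * X 2 ^ 3 := by
  simp [cubic, X_eq_mon, C_eq_mon, monomial_mul, mon_add, pow_succ]

theorem form_can_eq (w : Fin 15 → ℂ) : form (can w) =
    ![cubic 0 (-w 0) (w 7) (-w 1) (w 9 - w 3) (w 6) (-w 2) (-w 4) (w 8) (w 5),
      cubic (w 0) (w 1) (w 3) (w 2) (w 4 - w 13) (-w 14) 0 (-w 10) (-w 11) (-w 12),
      cubic (-w 7) (-w 9) (-w 6) (w 13) (w 14 - w 8) (-w 5) (w 10) (w 11) (w 12) 0] := by
  funext j
  fin_cases j <;>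
  · simp [cubic_eq, form, quad, can, Fin.sum_univ_three]
    ring

theorem form_can_sec {ω : PolyForm} (hω : ω ∈ formSpace) : form (can (sec ω)) = ω := by
  obtain ⟨h1, h2⟩ := hω
  have e0 := eq_cubic_of_isHomogeneous (h1 0)
  have e1 := eq_cubic_of_isHomogeneous (h1 1)
  have e2 := eq_cubic_of_isHomogeneous (h1 2)
  have hc : ∀ a b c : ℕ, coeff (mon a b c) (∑ i, ω i * X i) = 0 := fun a b c => by rw [h2]; simp
  rw [Fin.sum_univ_three, e0, e1, e2] at hc
  simp only [cubic, X_eq_mon, add_mul, monomial_mul, mon_add, mul_one, coeff_add, coeff_monomial,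
    mon_inj] at hc
  have c1 := hc 4 0 0
  have c2 := hc 3 1 0
  have c3 := hc 3 0 1
  have c4 := hc 2 2 0
  have c5 := hc 2 1 1
  have c6 := hc 2 0 2
  have c7 := hc 1 3 0
  have c8 := hc 1 2 1
  have c9 := hc 1 1 2
  have c10 := hc 1 0 3
  have c11 := hc 0 4 0
  have c12 := hc 0 3 1
  have c13 := hc 0 2 2
  have c14 := hc 0 1 3
  have c15 := hc 0 0 4
  clear hc
  norm_num at c1 c2 c3 c4 c5 c6 c7 c8 c9 c10 c11 c12 c13 c14 c15
  have s0 : sec ω 0 = coeff (mon 3 0 0) (ω 1) := rfl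
  have s1 : sec ω 1 = coeff (mon 2 1 0) (ω 1) := rfl
  have s2 : sec ω 2 = coeff (mon 1 2 0) (ω 1) := rfl
  have s3 : sec ω 3 = coeff (mon 2 0 1) (ω 1) := rfl
  have s4 : sec ω 4 = -coeff (mon 0 2 1) (ω 0) := rfl
  have s5 : sec ω 5 = coeff (mon 0 0 3) (ω 0) := rfl
  have s6 : sec ω 6 = coeff (mon 1 0 2) (ω 0) := rfl
  have s7 : sec ω 7 = coeff (mon 2 0 1) (ω 0) := rfl
  have s8 : sec ω 8 = coeff (mon 0 1 2) (ω 0) := rfl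
  have s9 : sec ω 9 = -coeff (mon 2 1 0) (ω 2) := rfl
  have s10 : sec ω 10 = coeff (mon 0 3 0) (ω 2) := rfl
  have s11 : sec ω 11 = coeff (mon 0 2 1) (ω 2) := rfl
  have s12 : sec ω 12 = coeff (mon 0 1 2) (ω 2) := rfl
  have s13 : sec ω 13 = coeff (mon 1 2 0) (ω 2) := rfl
  have s14 : sec ω 14 = -coeff (mon 1 0 2) (ω 1) := rfl
  rw [form_can_eq, s0, s1, s2, s3, s4, s5, s6, s7, s8, s9, s10, s11, s12, s13, s14]
  clear s0 s1 s2 s3 s4 s5 s6 s7 s8 s9 s10 s11 s12 s13 s14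
  funext j
  fin_cases j
  · refine Eq.trans ?_ e0.symm
    clear e0 e1 e2 h1 h2
    simp only [Fin.zero_eta, Matrix.cons_val_zero]
    congr 1 <;> grind
  · refine Eq.trans ?_ e1.symm
    clear e0 e1 e2 h1 h2
    simp only [Fin.mk_one, Matrix.cons_val_one, Matrix.cons_val_zero]
    congr 1 <;> grind
  · refine Eq.trans ?_ e2.symm
    clear e0 e1 e2 h1 h2
    simp only [Fin.reduceFinMk, Matrix.cons_val]
    congr 1 <;> grind

/-! ### Coordinates on the space of forms and on its projectivization -/

theorem formK_sec (v : formSpace) : formK (sec v) = v := Subtype.ext (form_can_sec v.2)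

theorem sec_formK (w : Fin 15 → ℂ) : sec (formK w) = w := sec_form_can w

theorem sec_smul (c : ℂ) (v : formSpace) : sec ((c • v : formSpace) : PolyForm) = c • sec v := by
  funext i
  fin_cases i <;> simp [sec]

theorem formK_smul (c : ℂ) (w : Fin 15 → ℂ) : formK (c • w) = c • formK w := by
  rw [← formK_sec (c • formK w), sec_smul, sec_formK]

theorem formK_injective : Function.Injective formK := fun w w' h => by
  rw [← sec_formK w, h, sec_formK]

theorem formK_zero : formK 0 = 0 := by
  have := formK_smul 0 0
  simpa using this

theorem formK_ne_zero {w : Fin 15 → ℂ} (hw : w ≠ 0) : formK w ≠ 0 := fun h =>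
  hw (formK_injective (h.trans formK_zero.symm))

theorem pullback_formK (g : Matrix (Fin 3) (Fin 3) ℂ) (w : Fin 15 → ℂ) :
    pullback g (formK w) = formK (rho g w) := by
  rw [coe_formK, pullback_form, form_eq_can, coe_formK, rho]

theorem form_can_injective {w w' : Fin 15 → ℂ} (h : form (can w) = form (can w')) : w = w' := by
  rw [← sec_form_can w, h, sec_form_can]

theorem rho_mul (g h : Matrix (Fin 3) (Fin 3) ℂ) (w : Fin 15 → ℂ) :
    rho (g * h) w = rho h (rho g w) := by
  apply form_can_injective
  rw [← coe_formK, ← coe_formK, ← pullback_formK, ← pullback_formK, ← pullback_formK, pullback_mul]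

theorem rho_one (w : Fin 15 → ℂ) : rho 1 w = w := by
  apply form_can_injective
  rw [← coe_formK, ← coe_formK, ← pullback_formK, pullback_one]

theorem rho_smul (g : Matrix (Fin 3) (Fin 3) ℂ) (c : ℂ) (w : Fin 15 → ℂ) :
    rho g (c • w) = c • rho g w := by
  apply formK_injective
  apply Subtype.ext
  rw [← pullback_formK, formK_smul, formK_smul]
  change pullback g (c • (formK w : PolyForm)) = c • ((formK (rho g w) : formSpace) : PolyForm)
  rw [pullback_smul, pullback_formK]

/-- Two coordinate vectors represent forms that are equivalent up to a linear change of
coordinates and a non-zero factor. -/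
def Equivalent (w w' : Fin 15 → ℂ) : Prop :=
  ∃ (g : Matrix (Fin 3) (Fin 3) ℂ) (c : ℂ), g.det ≠ 0 ∧ c ≠ 0 ∧ w' = c • rho g w

theorem Equivalent.trans {w w' w'' : Fin 15 → ℂ} (h : Equivalent w w') (h' : Equivalent w' w'') :
    Equivalent w w'' := by
  obtain ⟨g, c, hg, hc, rfl⟩ := h
  obtain ⟨g', c', hg', hc', rfl⟩ := h'
  refine ⟨g * g', c' * c, by rw [Matrix.det_mul]; exact mul_ne_zero hg hg', mul_ne_zero hc' hc, ?_⟩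
  rw [rho_mul, rho_smul, smul_smul]

theorem Equivalent.symm {w w' : Fin 15 → ℂ} (h : Equivalent w w') : Equivalent w' w := by
  obtain ⟨g, c, hg, hc, rfl⟩ := h
  refine ⟨g⁻¹, c⁻¹, ?_, inv_ne_zero hc, ?_⟩
  · rw [Matrix.det_nonsing_inv]
    simpa using hg
  · rw [rho_smul, smul_smul, inv_mul_cancel₀ hc, one_smul, ← rho_mul,
      Matrix.mul_nonsing_inv _ (isUnit_iff_ne_zero.mpr hg), rho_one]

theorem equivalent_rho {g : Matrix (Fin 3) (Fin 3) ℂ} (hg : g.det ≠ 0) (w : Fin 15 → ℂ) :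
    Equivalent w (rho g w) := ⟨g, 1, hg, one_ne_zero, by rw [one_smul]⟩

theorem rho_zero (g : Matrix (Fin 3) (Fin 3) ℂ) : rho g 0 = 0 := by
  simpa using rho_smul g 0 0

theorem Equivalent.ne_zero {w w' : Fin 15 → ℂ} (h : Equivalent w w') (hw : w ≠ 0) : w' ≠ 0 := by
  rintro rfl
  obtain ⟨g, c, -, -, e⟩ := h.symm
  rw [rho_zero, smul_zero] at e
  exact hw e

/-- The point of the projective space with homogeneous coordinates `w`. -/
def pt (w : Fin 15 → ℂ) (hw : w ≠ 0) : FormProj :=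
  Projectivization.mk ℂ (formK w) (formK_ne_zero hw)

theorem exists_pt (F : FormProj) : ∃ w hw, F = pt w hw := by
  have h : sec F.rep ≠ 0 := by
    intro h
    apply F.rep_nonzero
    rw [← formK_sec F.rep, h, formK_zero]
  refine ⟨sec F.rep, h, ?_⟩
  conv_lhs => rw [← F.mk_rep]
  simp only [pt, formK_sec]

theorem mk_smul_pt (g : GL (Fin 3) ℂ) (w : Fin 15 → ℂ) (hw : w ≠ 0)
    (h : rho ((g⁻¹ : GL (Fin 3) ℂ) : Matrix (Fin 3) (Fin 3) ℂ) w ≠ 0) :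
    (Matrix.ProjGenLinGroup.mk g : PGL(3, ℂ)) • pt w hw = pt _ h := by
  change g • pt w hw = _
  simp only [pt, Projectivization.smul_mk]
  congr 1
  exact Subtype.ext (pullback_formK _ _)

theorem pt_eq_pt_iff {w w' : Fin 15 → ℂ} (hw : w ≠ 0) (hw' : w' ≠ 0) :
    pt w hw = pt w' hw' ↔ ∃ c : ℂ, c ≠ 0 ∧ w' = c • w := by
  simp only [pt, Projectivization.mk_eq_mk_iff']
  constructor
  · rintro ⟨a, ha⟩
    rw [← formK_smul] at ha
    have h := formK_injective ha
    have ha0 : a ≠ 0 := by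
      rintro rfl
      exact hw (by rw [← h, zero_smul])
    exact ⟨a⁻¹, inv_ne_zero ha0, by rw [← h, smul_smul, inv_mul_cancel₀ ha0, one_smul]⟩
  · rintro ⟨c, hc, rfl⟩
    exact ⟨c⁻¹, by rw [← formK_smul, smul_smul, inv_mul_cancel₀ hc, one_smul]⟩

theorem pt_mem_orbit_iff {w w' : Fin 15 → ℂ} (hw : w ≠ 0) (hw' : w' ≠ 0) :
    pt w' hw' ∈ MulAction.orbit PGL(3, ℂ) (pt w hw) ↔ Equivalent w w' := by
  constructor
  · rintro ⟨g, hg⟩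
    induction g using Matrix.ProjGenLinGroup.induction_on with
    | mk g =>
      have hd : (((g⁻¹ : GL (Fin 3) ℂ) : Matrix (Fin 3) (Fin 3) ℂ)).det ≠ 0 :=
        (Matrix.GeneralLinearGroup.det g⁻¹).ne_zero
      have hr := (equivalent_rho hd w).ne_zero hw
      change (Matrix.ProjGenLinGroup.mk g : PGL(3, ℂ)) • pt w hw = _ at hg
      rw [mk_smul_pt g w hw hr, pt_eq_pt_iff] at hg
      obtain ⟨c, hc, rfl⟩ := hg
      exact ⟨_, c, hd, hc, rfl⟩
  · rintro ⟨g, c, hg, hc, rfl⟩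
    let G : GL (Fin 3) ℂ := Matrix.GeneralLinearGroup.mkOfDetNeZero g hg
    have e : ((((G⁻¹)⁻¹ : GL (Fin 3) ℂ)) : Matrix (Fin 3) (Fin 3) ℂ) = g := by
      rw [inv_inv]
      rfl
    have hr : rho ((((G⁻¹)⁻¹ : GL (Fin 3) ℂ)) : Matrix (Fin 3) (Fin 3) ℂ) w ≠ 0 := by
      rw [e]
      exact (equivalent_rho hg w).ne_zero hw
    refine ⟨Matrix.ProjGenLinGroup.mk G⁻¹, ?_⟩
    change (Matrix.ProjGenLinGroup.mk G⁻¹ : PGL(3, ℂ)) • pt w hw = _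
    rw [mk_smul_pt G⁻¹ w hw hr, pt_eq_pt_iff]
    exact ⟨c, hc, by rw [e]⟩

theorem exists_rep_pt (w : Fin 15 → ℂ) (hw : w ≠ 0) :
    ∃ a : ℂ, a ≠ 0 ∧ (pt w hw).rep = a • formK w := by
  obtain ⟨a, ha⟩ := Projectivization.exists_smul_eq_mk_rep ℂ (formK w) (formK_ne_zero hw)
  exact ⟨a, a.ne_zero, ha.symm⟩

/-- The coefficients of the form with coordinates `w` have no common factor. -/
def Saturated (w : Fin 15 → ℂ) : Prop :=
  ∀ p : MvPolynomial (Fin 3) ℂ, (∀ i, p ∣ form (can w) i) → IsUnit p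

theorem pt_mem_foliations_iff (w : Fin 15 → ℂ) (hw : w ≠ 0) :
    pt w hw ∈ foliations ↔ Saturated w := by
  obtain ⟨a, ha, e⟩ := exists_rep_pt w hw
  have h : ∀ (p : MvPolynomial (Fin 3) ℂ) (i : Fin 3),
      p ∣ (pt w hw).rep.1 i ↔ p ∣ form (can w) i := by
    intro p i
    rw [e]
    change p ∣ a • form (can w) i ↔ _
    rw [smul_eq_C_mul]
    exact (isUnit_iff_ne_zero.mpr ha |>.map C).dvd_mul_left
  simp only [foliations, Set.mem_ofPred_eq, Saturated, h]

theorem Saturated.ne_zero {w : Fin 15 → ℂ} (h : Saturated w) : w ≠ 0 := by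
  rintro rfl
  have := h 0 fun i => by
    rw [← coe_formK, formK_zero]
    exact dvd_zero _
  exact not_isUnit_zero this

theorem Saturated.equivalent {w w' : Fin 15 → ℂ} (h : Saturated w) (h' : Equivalent w w') :
    Saturated w' := by
  obtain ⟨g, c, hg, hc, e⟩ := h'.symm
  intro p hp
  have hp' : ∀ i, aeval (linForm g) p ∣ form (can w) i := by
    intro i
    rw [← coe_formK, e, formK_smul]
    change _ ∣ c • ((formK (rho g w') : formSpace) : PolyForm) i
    rw [← pullback_formK, smul_eq_C_mul]
    exact dvd_mul_of_dvd_right (Finset.dvd_sum fun l _ =>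
      dvd_mul_of_dvd_left (map_dvd (aeval (linForm g)) (hp l)) _) _
  have hu := (h _ hp').map (aeval (linForm g⁻¹) : MvPolynomial (Fin 3) ℂ →ₐ[ℂ] _)
  have hinv : aeval (linForm g⁻¹) (aeval (linForm g) p) = p := by
    have hcomp : (aeval (linForm g⁻¹)).comp (aeval (linForm g))
        = AlgHom.id ℂ (MvPolynomial (Fin 3) ℂ) := by
      refine algHom_ext fun i => ?_
      have h1 := Matrix.mul_nonsing_inv g (isUnit_iff_ne_zero.mpr hg)
      rw [AlgHom.comp_apply, aeval_X]
      simp only [linForm, map_sum, map_mul, aeval_X, algHom_C, algebraMap_eq, Finset.mul_sum,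
        AlgHom.id_apply]
      rw [Finset.sum_comm]
      simp only [← mul_assoc, ← C_mul, ← Finset.sum_mul, ← map_sum, ← Matrix.mul_apply, h1]
      simp [Matrix.one_apply, apply_ite C, ite_mul]
    exact DFunLike.congr_fun hcomp p
  rwa [hinv] at hu

/-! ### The stabilizer and the dimension of the orbit -/

/-- The infinitesimal stabilizer in `𝔤𝔩₃` of the line spanned by the form with coordinates `w`. -/
def stab (w : Fin 15 → ℂ) : Submodule ℂ (Matrix (Fin 3) (Fin 3) ℂ) :=
  LinearMap.ker ((Submodule.span ℂ {(formK w : PolyForm)}).mkQ ∘ₗ lieDerivative (formK w))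

theorem lieDerivative_formK (A : Matrix (Fin 3) (Fin 3) ℂ) (w : Fin 15 → ℂ) :
    lieDerivative (formK w) A = formK (kappa (lie A (can w))) := by
  rw [coe_formK, lieDerivative_form, form_eq_can, coe_formK]

theorem mem_stab {w : Fin 15 → ℂ} {A : Matrix (Fin 3) (Fin 3) ℂ} :
    A ∈ stab w ↔ ∃ c : ℂ, kappa (lie A (can w)) = c • w := by
  simp only [stab, LinearMap.mem_ker, LinearMap.comp_apply, Submodule.mkQ_apply,
    Submodule.Quotient.mk_eq_zero, Submodule.mem_span_singleton, lieDerivative_formK]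
  refine exists_congr fun c => ⟨fun h => ?_, fun h => ?_⟩
  · apply formK_injective
    rw [formK_smul]
    exact Subtype.ext h.symm
  · rw [h, formK_smul]
    rfl

theorem lieDerivative_smul (a : ℂ) (ω : PolyForm) (A : Matrix (Fin 3) (Fin 3) ℂ) :
    lieDerivative (a • ω) A = a • lieDerivative ω A := by
  funext j
  change ∑ i, (linForm A i * pderiv i ((a • ω) j) + (a • ω) i * C (A i j))
    = a • ∑ i, (linForm A i * pderiv i (ω j) + ω i * C (A i j))
  simp [Finset.smul_sum]

theorem orbitDim_add_finrank_stab (w : Fin 15 → ℂ) (hw : w ≠ 0) :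
    orbitDim (pt w hw) + Module.finrank ℂ (stab w) = 9 := by
  obtain ⟨a, ha, e⟩ := exists_rep_pt w hw
  have hspan : Submodule.span ℂ {((pt w hw).rep.1 : PolyForm)}
      = Submodule.span ℂ {(formK w : PolyForm)} := by
    rw [e]
    exact Submodule.span_singleton_smul_eq (isUnit_iff_ne_zero.mpr ha) _
  have hker : LinearMap.ker ((Submodule.span ℂ {((pt w hw).rep.1 : PolyForm)}).mkQ ∘ₗ
      lieDerivative (pt w hw).rep.1) = stab w := by
    ext A
    rw [stab, hspan, LinearMap.mem_ker, LinearMap.mem_ker, LinearMap.comp_apply,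
      LinearMap.comp_apply, e]
    change Submodule.mkQ (Submodule.span ℂ {(formK w : PolyForm)})
      (lieDerivative (a • (formK w : PolyForm)) A) = 0 ↔ _
    rw [lieDerivative_smul, map_smul, smul_eq_zero]
    simp [ha]
  have h := LinearMap.finrank_range_add_finrank_ker
    ((Submodule.span ℂ {((pt w hw).rep.1 : PolyForm)}).mkQ ∘ₗ lieDerivative (pt w hw).rep.1)
  rw [hker, LinearMap.range_comp, Module.finrank_matrix] at h
  simpa [orbitDim] using h

/-! ### The topology in coordinates -/

theorem continuous_sec : Continuous fun v : formSpace => sec v := by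
  have h : ∀ (i : Fin 3) (d : Fin 3 →₀ ℕ), Continuous fun v : formSpace => coeff d (v.1 i) := by
    intro i d
    have h1 : Continuous fun (v : formSpace) (i : Fin 3) (d : Fin 3 →₀ ℕ) => coeff d (v.1 i) :=
      continuous_induced_dom
    exact (continuous_apply d).comp ((continuous_apply i).comp h1)
  refine continuous_pi fun i => ?_
  fin_cases i <;> first | exact h _ _ | exact (h _ _).neg

theorem formK_add (w w' : Fin 15 → ℂ) : formK (w + w') = formK w + formK w' := by
  have h : sec ((formK w + formK w' : formSpace) : PolyForm) = w + w' := by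
    conv_rhs => rw [← sec_formK w, ← sec_formK w']
    funext i
    fin_cases i <;> simp [sec] <;> ring
  rw [← formK_sec (formK w + formK w'), h]

theorem continuous_formK : Continuous formK := by
  refine continuous_induced_rng.mpr (continuous_pi fun i => continuous_pi fun d => ?_)
  let L : (Fin 15 → ℂ) →ₗ[ℂ] ℂ :=
    { toFun := fun w => coeff d ((formK w).1 i)
      map_add' := fun w w' => by rw [formK_add]; exact coeff_add _ _ _
      map_smul' := fun c w => by rw [formK_smul]; exact coeff_smul _ _ _ }
  exact L.continuous_of_finiteDimensional

theorem continuous_rho : Continuous fun x : Matrix (Fin 3) (Fin 3) ℂ × (Fin 15 → ℂ) =>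
    rho x.1 x.2 := by
  have h : ∀ i j k, Continuous fun x : Matrix (Fin 3) (Fin 3) ℂ × (Fin 15 → ℂ) =>
      act x.1 (can x.2) i j k := by
    intro i j k
    have h1 : Continuous fun x : Matrix (Fin 3) (Fin 3) ℂ × (Fin 15 → ℂ) => x.1.adjugate :=
      continuous_fst.matrix_adjugate
    have h2 : ∀ a b c, Continuous fun x : Matrix (Fin 3) (Fin 3) ℂ × (Fin 15 → ℂ) =>
        can x.2 a b c := by
      intro a b c
      fin_cases a <;> fin_cases b <;> fin_cases c <;> simp [can] <;> fun_prop
    refine continuous_finsetSum _ fun l _ => (h1.matrix_elem i l).mul ?_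
    refine continuous_finsetSum _ fun a _ => continuous_finsetSum _ fun b _ => ?_
    exact ((h2 l a b).mul (continuous_fst.matrix_elem a j)).mul (continuous_fst.matrix_elem b k)
  refine continuous_pi fun i => ?_
  simp only [rho]
  fin_cases i <;> simp [kappa_apply] <;> fun_prop

/-- Closures of orbits can be computed in the affine cone `ℂ¹⁵`. -/
theorem pt_mem_closure_orbit_iff {w w' : Fin 15 → ℂ} (hw : w ≠ 0) (hw' : w' ≠ 0) :
    pt w' hw' ∈ closure (MulAction.orbit PGL(3, ℂ) (pt w hw)) ↔
      w' ∈ closure {u | Equivalent w u} := by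
  have hq : Continuous fun v : {v : formSpace // v ≠ 0} => Projectivization.mk ℂ v.1 v.2 :=
    continuous_coinduced_rng
  constructor
  · intro h
    rw [mem_closure_iff] at h ⊢
    intro U hU hwU
    -- the cone over `U` is a union of dilates of `U`, hence open
    have hV : IsOpen {F : FormProj | ∃ u ∈ U, ∃ hu : u ≠ 0, F = pt u hu} := by
      rw [isOpen_coinduced]
      have e : (fun v : {v : formSpace // v ≠ 0} => Projectivization.mk ℂ v.1 v.2) ⁻¹'
          {F : FormProj | ∃ u ∈ U, ∃ hu : u ≠ 0, F = pt u hu}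
          = ⋃ c : {c : ℂ // c ≠ 0}, (fun v : {v : formSpace // v ≠ 0} => c.1 • sec v.1) ⁻¹' U := by
        ext ⟨v, hv⟩
        have hsv : sec v ≠ 0 := by
          intro h0
          apply hv
          rw [← formK_sec v, h0, formK_zero]
        have hmk : Projectivization.mk ℂ v hv = pt (sec v) hsv := by
          simp only [pt, formK_sec]
        simp only [Set.mem_preimage, Set.mem_ofPred_eq, Set.mem_iUnion, Subtype.exists, hmk,
          pt_eq_pt_iff]
        constructor
        · rintro ⟨u, hu, hu0, c, hc, rfl⟩
          exact ⟨c, hc, hu⟩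
        · rintro ⟨c, hc, hu⟩
          exact ⟨_, hu, smul_ne_zero hc hsv, c, hc, rfl⟩
      rw [e]
      exact isOpen_iUnion fun c => hU.preimage
        ((continuous_sec.comp continuous_subtype_val).const_smul c.1)
    obtain ⟨F, ⟨u, hu, hu0, rfl⟩, hF⟩ := h _ hV ⟨w', hwU, hw', rfl⟩
    exact ⟨u, hu, (pt_mem_orbit_iff hw hu0).mp hF⟩
  · intro h
    let f : {u : Fin 15 → ℂ // u ≠ 0} → FormProj := fun u => pt u.1 u.2
    have hf : Continuous f :=
      hq.comp (Continuous.subtype_mk (continuous_formK.comp continuous_subtype_val)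
        fun u => formK_ne_zero u.2)
    have h' : (⟨w', hw'⟩ : {u : Fin 15 → ℂ // u ≠ 0}) ∈
        closure ((↑) ⁻¹' {u | Equivalent w u} : Set {u : Fin 15 → ℂ // u ≠ 0}) := by
      have hsub : {u | Equivalent w u} ⊆
          (Subtype.val '' (Subtype.val ⁻¹' {u | Equivalent w u} : Set {u : Fin 15 → ℂ // u ≠ 0})) :=
        fun u hu => ⟨⟨u, Equivalent.ne_zero hu hw⟩, hu, rfl⟩
      exact closure_subtype.mpr (closure_mono hsub h)
    refine closure_mono ?_ (image_closure_subset_closure_image hf ⟨_, h', rfl⟩)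
    rintro _ ⟨u, hu, rfl⟩
    exact (pt_mem_orbit_iff hw u.2).mpr hu

theorem Equivalent.mem_closure {w u u' : Fin 15 → ℂ} (h : u ∈ closure {u | Equivalent w u})
    (h' : Equivalent u u') : u' ∈ closure {u | Equivalent w u} := by
  obtain ⟨g, c, hg, hc, rfl⟩ := h'
  have hcont : Continuous fun w => c • rho g w :=
    (continuous_rho.comp (Continuous.prodMk_right g)).const_smul c
  refine closure_mono ?_ (image_closure_subset_closure_image hcont ⟨_, h, rfl⟩)
  rintro _ ⟨v, hv, rfl⟩
  exact Equivalent.trans hv ⟨g, c, hg, hc, rfl⟩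

theorem mem_closure_trans {w u v : Fin 15 → ℂ} (h : u ∈ closure {u | Equivalent w u})
    (h' : v ∈ closure {v | Equivalent u v}) : v ∈ closure {u | Equivalent w u} :=
  closure_minimal (fun _ hx => Equivalent.mem_closure h hx) isClosed_closure h'

theorem Equivalent.mem_closure_of_left {w w' u : Fin 15 → ℂ} (h : Equivalent w w')
    (h' : u ∈ closure {u | Equivalent w' u}) : u ∈ closure {u | Equivalent w u} :=
  closure_mono (fun _ hx => h.trans hx) h'

/-- The orbit of `u` lies in the closure of the orbit of `w` as soon as `u` does. -/
theorem orbit_subset_closureIn_iff {w u : Fin 15 → ℂ} (hw : w ≠ 0) (hu : Saturated u) :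
    MulAction.orbit PGL(3, ℂ) (pt u hu.ne_zero) ⊆ closureIn (MulAction.orbit PGL(3, ℂ) (pt w hw)) ↔
      u ∈ closure {u | Equivalent w u} := by
  constructor
  · intro h
    exact (pt_mem_closure_orbit_iff hw hu.ne_zero).mp (h (MulAction.mem_orbit_self _)).1
  · intro h F hF
    obtain ⟨v, hv, rfl⟩ := exists_pt F
    rw [pt_mem_orbit_iff] at hF
    exact ⟨(pt_mem_closure_orbit_iff hw hv).mpr (Equivalent.mem_closure h hF),
      (pt_mem_foliations_iff v hv).mpr (hu.equivalent hF)⟩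

/-! ### Polynomial maps between affine spaces -/

section Chevalley

open PrimeSpectrum

/-- A polynomial map with algebraically independent components, restricted to the complement of a
hypersurface, still covers the complement of a hypersurface. -/
theorem exists_forall_exists_preimage {n m : ℕ} (f : Fin n → MvPolynomial (Fin m) ℂ)
    (hf : AlgebraicIndependent ℂ f) (h : MvPolynomial (Fin m) ℂ) (hh : h ≠ 0) :
    ∃ P : MvPolynomial (Fin n) ℂ, P ≠ 0 ∧ ∀ v : Fin n → ℂ, eval v P ≠ 0 →
      ∃ u : Fin m → ℂ, (∀ i, eval u (f i) = v i) ∧ eval u h ≠ 0 := by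
  classical
  let φ : MvPolynomial (Fin n) ℂ →ₐ[ℂ] MvPolynomial (Fin m) ℂ := aeval f
  have hφ : Function.Injective φ := hf
  have hfin : φ.toRingHom.FinitePresentation := by
    have h1 : (φ.comp (Algebra.ofId ℂ _)).FiniteType := by
      have : (φ.comp (Algebra.ofId ℂ (MvPolynomial (Fin n) ℂ)))
        = Algebra.ofId ℂ (MvPolynomial (Fin m) ℂ) := Subsingleton.elim _ _
      rw [this]
      change (algebraMap ℂ (MvPolynomial (Fin m) ℂ)).FiniteType
      rw [RingHom.finiteType_algebraMap]
      infer_instance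
    have h2 : φ.FiniteType := AlgHom.FiniteType.of_comp_finiteType h1
    exact (RingHom.FinitePresentation.of_finiteType (f := φ.toRingHom)).mp h2
  have hc := isConstructible_comap_image hfin (s := (basicOpen h : Set _)) isConstructible_basicOpen
  obtain ⟨D, hD⟩ := exists_constructibleSetData_iff.mpr hc
  -- the image contains the generic point, hence a basic open set around it
  let η : PrimeSpectrum (MvPolynomial (Fin m) ℂ) := ⟨⊥, Ideal.isPrime_bot⟩
  have hη : comap φ.toRingHom η ∈ comap φ.toRingHom '' (basicOpen h : Set _) := by
    refine ⟨η, ?_, rfl⟩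
    rw [SetLike.mem_coe, mem_basicOpen]
    exact fun h0 => hh (Ideal.mem_bot.mp h0)
  rw [← hD, ConstructibleSetData.toSet, Set.mem_iUnion₂] at hη
  obtain ⟨E, hE, hηE⟩ := hη
  have hbot : (comap φ.toRingHom η).asIdeal = ⊥ := by
    ext x
    change φ x ∈ (⊥ : Ideal _) ↔ x ∈ (⊥ : Ideal _)
    rw [Ideal.mem_bot, Ideal.mem_bot]
    exact map_eq_zero_iff _ hφ
  rw [BasicConstructibleSetData.toSet, Set.mem_sdiff, mem_zeroLocus, mem_zeroLocus, hbot] at hηE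
  obtain ⟨hg, hf0⟩ := hηE
  have hEf : E.f ≠ 0 := by
    intro h0
    apply hf0
    simp [h0]
  refine ⟨E.f, hEf, fun v hv => ?_⟩
  -- the maximal ideal of the point `v`
  let M : PrimeSpectrum (MvPolynomial (Fin n) ℂ) :=
    ⟨RingHom.ker (eval v), RingHom.ker_isPrime _⟩
  have hM : M ∈ comap φ.toRingHom '' (basicOpen h : Set _) := by
    rw [← hD, ConstructibleSetData.toSet, Set.mem_iUnion₂]
    refine ⟨E, hE, ?_⟩
    rw [BasicConstructibleSetData.toSet, Set.mem_sdiff, mem_zeroLocus, mem_zeroLocus]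
    refine ⟨fun x hx => ?_, fun hx => hv ?_⟩
    · rw [Ideal.mem_bot.mp (hg hx)]
      exact Ideal.zero_mem _
    · exact hx rfl
  obtain ⟨Q, hQh, hQ⟩ := hM
  -- the Nullstellensatz gives a closed point of the fibre at which `h` does not vanish
  rw [SetLike.mem_coe, mem_basicOpen] at hQh
  have hnull : h ∉ vanishingIdeal ℂ (zeroLocus ℂ Q.asIdeal) := by
    rw [MvPolynomial.vanishingIdeal_zeroLocus_eq_radical, Q.2.radical]
    exact hQh
  rw [mem_vanishingIdeal_iff] at hnull
  push Not at hnull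
  obtain ⟨u, hu, huh⟩ := hnull
  refine ⟨u, fun i => ?_, by simpa using huh⟩
  have hmem : X i - C (v i) ∈ (comap φ.toRingHom Q).asIdeal := by
    rw [hQ]
    change eval v (X i - C (v i)) = 0
    simp
  have hmem' : φ (X i - C (v i)) ∈ Q.asIdeal := hmem
  have h0 := hu _ hmem'
  have : eval u (f i) - v i = 0 := by simpa [φ] using h0
  exact sub_eq_zero.mp this

end Chevalley

/-- The components of a polynomial map from a space of smaller dimension satisfy a polynomial
relation. -/
theorem exists_relation {n m : ℕ} (hmn : m < n) (f : Fin n → MvPolynomial (Fin m) ℂ) :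
    ∃ P : MvPolynomial (Fin n) ℂ, P ≠ 0 ∧ ∀ u : Fin m → ℂ, eval (fun i => eval u (f i)) P = 0 := by
  have h : ¬ AlgebraicIndependent ℂ f := by
    intro h
    have h1 := h.cardinalMk_le_trdeg
    rw [MvPolynomial.trdeg_of_isDomain] at h1
    simp at h1
    omega
  rw [algebraicIndependent_iff] at h
  push Not at h
  obtain ⟨P, hP, hP0⟩ := h
  refine ⟨P, hP0, fun u => ?_⟩
  have h1 := congrArg (eval u) hP
  rw [map_zero] at h1
  rw [← h1]
  have e : (aeval u : MvPolynomial (Fin m) ℂ →ₐ[ℂ] ℂ).comp (aeval f)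
      = aeval (fun i => eval u (f i)) := algHom_ext fun i => by simp
  exact (DFunLike.congr_fun e P).symm

/-- The differential of a polynomial function in the direction `x` is the infinitesimal part of its
value at the dual point `u + ε x`. -/
theorem hasStrictFDerivAt_eval {σ : Type*} [Fintype σ] (p : MvPolynomial σ ℂ) (u : σ → ℂ) :
    ∃ L : (σ → ℂ) →L[ℂ] ℂ, HasStrictFDerivAt (fun u => eval u p) L u ∧
      ∀ x, L x = (aeval (fun j => TrivSqZeroExt.inl (u j) + TrivSqZeroExt.inr (x j)) p :
        DualNumber ℂ).snd ∧
        (aeval (fun j => TrivSqZeroExt.inl (u j) + TrivSqZeroExt.inr (x j)) p :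
        DualNumber ℂ).fst = eval u p := by
  induction p using MvPolynomial.induction_on with
  | C a =>
    refine ⟨0, ?_, fun x => ?_⟩
    · simpa using hasStrictFDerivAt_const a u
    · rw [algHom_C, eval_C]
      exact ⟨rfl, rfl⟩
  | add p q hp hq =>
    obtain ⟨L, h1, h2⟩ := hp
    obtain ⟨L', h1', h2'⟩ := hq
    refine ⟨L + L', ?_, fun x => ?_⟩
    · simp only [map_add]
      exact h1.add h1'
    · rw [map_add, TrivSqZeroExt.snd_add, TrivSqZeroExt.fst_add, map_add, ← (h2 x).1, ← (h2' x).1,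
        (h2 x).2, (h2' x).2]
      exact ⟨rfl, rfl⟩
  | mul_X p i hp =>
    obtain ⟨L, h1, h2⟩ := hp
    refine ⟨eval u p • ContinuousLinearMap.proj i + u i • L, ?_, fun x => ?_⟩
    · simp only [map_mul, eval_X]
      exact h1.mul (hasStrictFDerivAt_apply i u)
    · rw [map_mul, aeval_X, TrivSqZeroExt.snd_mul, TrivSqZeroExt.fst_mul, map_mul, eval_X,
        ← (h2 x).1, (h2 x).2]
      simp [mul_comm]

/-- A polynomial map between affine spaces of the same dimension whose differential is injective
at a point is locally surjective at this point. The differential is computed with dual numbers. -/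
theorem map_nhds_eval {σ : Type*} [Fintype σ] (f : σ → MvPolynomial σ ℂ) (u : σ → ℂ)
    (hu : ∀ x : σ → ℂ, (∀ i, (aeval (fun j => TrivSqZeroExt.inl (u j) +
      TrivSqZeroExt.inr (x j)) (f i) : DualNumber ℂ).snd = 0) → x = 0) :
    Filter.map (fun (u : σ → ℂ) (i : σ) => eval u (f i)) (nhds u) =
      nhds (fun i => eval u (f i)) := by
  choose L hL hL' using fun i => hasStrictFDerivAt_eval (f i) u
  have hF : HasStrictFDerivAt (fun (u : σ → ℂ) (i : σ) => eval u (f i))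
      (ContinuousLinearMap.pi L) u := hasStrictFDerivAt_pi'.mpr hL
  have hinj : Function.Injective (ContinuousLinearMap.pi L : (σ → ℂ) →L[ℂ] (σ → ℂ)) := by
    rw [injective_iff_map_eq_zero]
    intro x hx
    refine hu x fun i => ?_
    rw [← (hL' i x).1]
    exact congrFun hx i
  exact hF.map_nhds_eq_of_surj
    (LinearMap.range_eq_top.mpr (LinearMap.injective_iff_surjective.mp hinj))

/-- A polynomial map between affine spaces of the same dimension whose differential is injective
at a point has algebraically independent components. -/
theorem algebraicIndependent_of_injective {n : ℕ} (f : Fin n → MvPolynomial (Fin n) ℂ)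
    (u : Fin n → ℂ)
    (hu : ∀ x : Fin n → ℂ, (∀ i, (aeval (fun j => TrivSqZeroExt.inl (u j) +
      TrivSqZeroExt.inr (x j)) (f i) : DualNumber ℂ).snd = 0) → x = 0) :
    AlgebraicIndependent ℂ f := by
  have hmap := map_nhds_eval f u hu
  rw [algebraicIndependent_iff]
  intro P hP
  have hz : ∀ᶠ v in nhds (fun i => eval u (f i)), eval v P = 0 := by
    rw [← hmap, Filter.eventually_map]
    refine Filter.Eventually.of_forall fun u' => ?_
    have h1 := congrArg (eval u') hP
    rw [map_zero] at h1
    rw [← h1]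
    have e : (aeval u' : MvPolynomial (Fin n) ℂ →ₐ[ℂ] ℂ).comp (aeval f)
        = aeval (fun i => eval u' (f i)) := algHom_ext fun i => by simp
    exact (DFunLike.congr_fun e P).symm
  rw [Metric.eventually_nhds_iff_ball] at hz
  obtain ⟨ε, hε, hz⟩ := hz
  refine MvPolynomial.funext_set (fun i => Metric.ball (eval u (f i)) ε) (fun i => ?_)
    fun x hx => ?_
  · exact infinite_of_mem_nhds _ (Metric.ball_mem_nhds _ hε)
  · rw [map_zero]
    apply hz
    rw [ball_pi _ hε]
    exact hx

/-! ### The infinitesimal action in coordinates -/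

theorem kappa_lie {R : Type*} [CommRing R] (A : Matrix (Fin 3) (Fin 3) R) (w : Fin 15 → R) :
    kappa (lie A (can w)) =
    ![3 * A 0 0 * w 0 + A 1 1 * w 0 - A 2 1 * w 7 + A 1 0 * w 1 + A 2 0 * w 3,
    2 * A 0 0 * w 1 + 2 * A 1 1 * w 1 - A 2 0 * w 13 - A 2 1 * w 9 + 2 * A 0 1 * w 0 + 2 * A 1 0
      * w 2 + A 2 1 * w 3 + A 2 0 * w 4,
    A 0 0 * w 2 + 3 * A 1 1 * w 2 - A 2 0 * w 10 + A 0 1 * w 1 + A 2 1 * w 4,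
    2 * A 0 0 * w 3 + A 1 1 * w 3 - 2 * A 2 0 * w 14 - A 2 1 * w 6 + 3 * A 0 2 * w 0 + A 1 0 * w
      4 + A 1 2 * w 1 + A 2 2 * w 3 + A 0 1 * w 7 - A 1 0 * w 13,
    A 0 0 * w 4 + 2 * A 1 1 * w 4 - A 2 0 * w 11 - 2 * A 2 1 * w 8 + A 0 1 * w 3 + 3 * A 1 2 * w
      2 + A 2 2 * w 4 + A 0 2 * w 1 + A 1 0 * w 10 - A 0 1 * w 9,
    A 0 0 * w 5 + 3 * A 2 2 * w 5 - A 1 0 * w 12 + A 0 2 * w 6 + A 1 2 * w 8,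
    2 * A 0 2 * w 7 + 2 * A 2 0 * w 5 + 2 * A 0 0 * w 6 + 2 * A 2 2 * w 6 - A 1 0 * w 14 - A 1 2
      * w 3 + A 1 0 * w 8 + A 1 2 * w 9,
    3 * A 0 0 * w 7 + A 2 2 * w 7 - A 1 2 * w 0 + A 1 0 * w 9 + A 2 0 * w 6,
    A 0 2 * w 9 + 3 * A 2 1 * w 5 + A 0 0 * w 8 + 2 * A 2 2 * w 8 - A 1 0 * w 11 - 2 * A 1 2 * w
      4 + A 0 1 * w 6 + A 1 1 * w 8 + A 2 0 * w 12 - A 0 2 * w 3,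
    3 * A 0 1 * w 7 + A 2 0 * w 8 + 2 * A 0 0 * w 9 + A 2 2 * w 9 - 2 * A 1 0 * w 13 - A 1 2 * w
      1 + A 1 1 * w 9 + A 2 1 * w 6 + A 0 2 * w 0 - A 2 0 * w 14,
    3 * A 1 1 * w 10 + A 2 2 * w 10 - A 0 2 * w 2 + A 0 1 * w 13 + A 2 1 * w 11,
    2 * A 1 1 * w 11 + 2 * A 2 2 * w 11 - A 0 1 * w 8 - A 0 2 * w 4 + A 0 1 * w 14 + 2 * A 1 2 *
      w 10 + 2 * A 2 1 * w 12 + A 0 2 * w 13,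
    A 1 1 * w 12 + 3 * A 2 2 * w 12 - A 0 1 * w 5 + A 0 2 * w 14 + A 1 2 * w 11,
    3 * A 1 0 * w 10 + A 2 0 * w 11 + 2 * A 1 1 * w 13 + A 2 2 * w 13 - 2 * A 0 1 * w 9 - A 0 2
      * w 1 + A 0 0 * w 13 + A 2 1 * w 14 + A 1 2 * w 2 - A 2 1 * w 8,
    A 1 1 * w 14 + 2 * A 2 2 * w 14 - A 0 1 * w 6 - 2 * A 0 2 * w 3 + A 0 0 * w 14 + A 1 0 * w
      11 + A 1 2 * w 13 + 3 * A 2 0 * w 12 + A 2 1 * w 5 - A 1 2 * w 4] := by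
  apply funext_fifteen
  all_goals
    simp only [kappa_apply, lie, Fin.sum_univ_three, Matrix.trace_fin_three, can_apply,
      Matrix.cons_val]
    ring

theorem rho_diagonal (d : Fin 3 → ℂ) (w : Fin 15 → ℂ) :
    rho (Matrix.diagonal d) w =
    ![d 0 ^ 3 * d 1 * w 0, d 0 ^ 2 * d 1 ^ 2 * w 1, d 0 * d 1 ^ 3 * w 2, d 0 ^ 2 * d 1 * d 2 * w 3,
      d 0 * d 1 ^ 2 * d 2 * w 4, d 0 * d 2 ^ 3 * w 5, d 0 ^ 2 * d 2 ^ 2 * w 6,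
      d 0 ^ 3 * d 2 * w 7, d 0 * d 1 * d 2 ^ 2 * w 8, d 0 ^ 2 * d 1 * d 2 * w 9,
      d 1 ^ 3 * d 2 * w 10, d 1 ^ 2 * d 2 ^ 2 * w 11, d 1 * d 2 ^ 3 * w 12,
      d 0 * d 1 ^ 2 * d 2 * w 13, d 0 * d 1 * d 2 ^ 2 * w 14] := by
  have h : (Matrix.diagonal d).adjugate = Matrix.diagonal ![d 1 * d 2, d 0 * d 2, d 0 * d 1] := by
    rw [Matrix.adjugate_fin_three]
    ext i j
    fin_cases i <;> fin_cases j <;> simp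
  apply funext_fifteen
  all_goals
    simp only [rho, act, h, kappa_apply, Fin.sum_univ_three, can_apply, Matrix.cons_val]
    simp
    try ring

theorem act_eq (g : Matrix (Fin 3) (Fin 3) ℂ) (T : Fin 3 → Fin 3 → Fin 3 → ℂ) (i : Fin 3) :
    Matrix.of (act g T i)
      = ∑ l, g.adjugate i l • (g.transpose * Matrix.of (T l) * g) := by
  ext j k
  simp only [act, Matrix.of_apply, Matrix.sum_apply, Matrix.smul_apply, smul_eq_mul]
  refine Finset.sum_congr rfl fun l _ => ?_
  congr 1
  simp only [Matrix.mul_apply, Matrix.transpose_apply, Matrix.of_apply, Finset.sum_mul]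
  rw [Finset.sum_comm]
  exact Finset.sum_congr rfl fun a _ => Finset.sum_congr rfl fun b _ => by ring

theorem lie_eq (A : Matrix (Fin 3) (Fin 3) ℂ) (T : Fin 3 → Fin 3 → Fin 3 → ℂ) (i : Fin 3) :
    Matrix.of (lie A T i) = A.trace • Matrix.of (T i) - ∑ l, A i l • Matrix.of (T l)
      + (A.transpose * Matrix.of (T i) + Matrix.of (T i) * A) := by
  ext j k
  simp only [lie, Matrix.of_apply, Matrix.sum_apply, Matrix.smul_apply, smul_eq_mul,
    Matrix.add_apply, Matrix.sub_apply, Matrix.mul_apply, Matrix.transpose_apply,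
    Finset.sum_add_distrib]
  congr 2
  exact Finset.sum_congr rfl fun a _ => by ring

/-- The infinitesimal action is equivariant. -/
theorem lie_act {g A B : Matrix (Fin 3) (Fin 3) ℂ} (hg : g.det ≠ 0) (h : g * B = A * g)
    (T : Fin 3 → Fin 3 → Fin 3 → ℂ) : lie B (act g T) = act g (lie A T) := by
  have hu := isUnit_iff_ne_zero.mpr hg
  have hB : B = g⁻¹ * A * g := by
    rw [mul_assoc, ← h, ← mul_assoc, Matrix.nonsing_inv_mul _ hu, one_mul]
  have htr : B.trace = A.trace := by
    rw [hB, Matrix.trace_mul_cycle, Matrix.mul_nonsing_inv _ hu, one_mul]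
  have hadj : B * g.adjugate = g.adjugate * A := by
    have h1 : g.adjugate * A * g = B * g.adjugate * g := by
      rw [mul_assoc, ← h, ← mul_assoc, Matrix.adjugate_mul, mul_assoc, Matrix.adjugate_mul]
      simp
    have h2 := congrArg (· * g⁻¹) h1
    simpa [mul_assoc, Matrix.mul_nonsing_inv _ hu] using h2.symm
  have ht : B.transpose * g.transpose = g.transpose * A.transpose := by
    rw [← Matrix.transpose_mul, h, Matrix.transpose_mul]
  funext i
  apply Matrix.of.injective
  rw [lie_eq, act_eq, htr]
  simp only [act_eq, lie_eq, Matrix.mul_add, Matrix.mul_sub, Matrix.add_mul, Matrix.sub_mul,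
    smul_add, smul_sub, Finset.sum_add_distrib, Finset.sum_sub_distrib, Finset.smul_sum,
    Finset.mul_sum, Finset.sum_mul, Matrix.mul_smul, Matrix.smul_mul]
  congr 1
  · congr 1
    · exact Finset.sum_congr rfl fun l _ => smul_comm _ _ _
    · rw [Finset.sum_comm]
      conv_rhs => rw [Finset.sum_comm]
      refine Finset.sum_congr rfl fun l _ => ?_
      simp only [smul_smul, ← Finset.sum_smul, ← Matrix.mul_apply, hadj]
  · congr 1
    · refine Finset.sum_congr rfl fun l _ => ?_
      rw [← mul_assoc, ← mul_assoc, ht, ← mul_assoc]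
    · refine Finset.sum_congr rfl fun l _ => ?_
      rw [mul_assoc, mul_assoc, h]
      simp only [mul_assoc]

theorem lie_form_congr {A : Matrix (Fin 3) (Fin 3) ℂ} {T T' : Fin 3 → Fin 3 → Fin 3 → ℂ}
    (h : kappa T = kappa T') : kappa (lie A T) = kappa (lie A T') := by
  apply form_can_injective
  rw [← form_eq_can, ← form_eq_can, ← lieDerivative_form, ← lieDerivative_form, form_eq_can T, h,
    ← form_eq_can T']

theorem act_form_congr {g : Matrix (Fin 3) (Fin 3) ℂ} {T T' : Fin 3 → Fin 3 → Fin 3 → ℂ}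
    (h : kappa T = kappa T') : kappa (act g T) = kappa (act g T') := by
  apply form_can_injective
  rw [← form_eq_can, ← form_eq_can, ← pullback_form, ← pullback_form, form_eq_can T, h,
    ← form_eq_can T']

theorem kappa_lie_rho {g A B : Matrix (Fin 3) (Fin 3) ℂ} (hg : g.det ≠ 0) (h : g * B = A * g)
    (w : Fin 15 → ℂ) : kappa (lie B (can (rho g w))) = rho g (kappa (lie A (can w))) := by
  rw [lie_form_congr (T' := act g (can w)) (by rw [kappa_can, rho]), lie_act hg h]
  exact act_form_congr (by rw [kappa_can])

theorem kappa_lie_smul (A : Matrix (Fin 3) (Fin 3) ℂ) (c : ℂ) (w : Fin 15 → ℂ) :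
    kappa (lie A (can (c • w))) = c • kappa (lie A (can w)) := by
  apply formK_injective
  apply Subtype.ext
  rw [← lieDerivative_formK, formK_smul, formK_smul]
  change lieDerivative (c • (formK w : PolyForm)) A
    = c • ((formK (kappa (lie A (can w))) : formSpace) : PolyForm)
  rw [lieDerivative_smul, lieDerivative_formK]

/-- Conjugation transports infinitesimal symmetries, with the same eigenvalue. -/
theorem kappa_lie_equivalent {g A B : Matrix (Fin 3) (Fin 3) ℂ} (hg : g.det ≠ 0)
    (h : g * B = A * g) {w : Fin 15 → ℂ} {c : ℂ} (hA : kappa (lie A (can w)) = c • w) (a : ℂ) :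
    kappa (lie B (can (a • rho g w))) = c • (a • rho g w) := by
  rw [kappa_lie_smul, kappa_lie_rho hg h, hA, rho_smul, smul_comm]

/-! ### The model foliations -/

/-- The coordinates of the form which reads `(y² + z) dy + r y dz` in the chart `X = 1`. -/
def eta (r : ℂ) : Fin 15 → ℂ := ![0, 0, 1, 1, 0, 0, 0, 0, 0, -r, 0, 0, 0, 0, 0]

/-- The coordinates of `omega1`. -/
def f1 : Fin 15 → ℂ := ![0, 0, 1, 0, 0, 0, 0, 1, 0, 0, 0, 0, 0, 0, 0]

theorem eta_ne_zero (r : ℂ) : eta r ≠ 0 := fun h => by simpa [eta] using congrFun h 2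

theorem f1_ne_zero : f1 ≠ 0 := fun h => by simpa [f1] using congrFun h 2

theorem F1_eq : F1 = pt f1 f1_ne_zero := by
  have h : formK f1 = omega1 := by
    apply Subtype.ext
    funext j
    rw [coe_formK]
    fin_cases j <;>
    · simp [form, quad, can, f1, omega1, Fin.sum_univ_three]
      ring
  simp only [F1, pt, h]

theorem kappa_lie_eta {r : ℂ} (hr : r ≠ 0) (hr1 : r ≠ -1) (A : Matrix (Fin 3) (Fin 3) ℂ) (c : ℂ) :
    kappa (lie A (can (eta r))) = c • eta r ↔
      A 0 1 = 0 ∧ A 0 2 = 0 ∧ A 1 0 = 0 ∧ A 1 2 = 0 ∧ A 2 0 = 0 ∧ A 2 1 = 0 ∧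
        A 0 0 + 3 * A 1 1 = c ∧ 2 * A 0 0 + A 1 1 + A 2 2 = c := by
  have hr1' : 1 + r ≠ 0 := fun h => hr1 (by linear_combination h)
  rw [kappa_lie]
  constructor
  · intro h
    have h0 := congrFun h 0
    have h1 := congrFun h 1
    have h2 := congrFun h 2
    have h3 := congrFun h 3
    have h4 := congrFun h 4
    have h6 := congrFun h 6
    have h7 := congrFun h 7
    have h10 := congrFun h 10
    simp [eta] at h0 h1 h2 h3 h4 h6 h7 h10
    have a10 : A 1 0 = 0 := by tauto
    have a12 : A 1 2 = 0 := by
      have : A 1 2 * (1 + r) = 0 := by linear_combination -h6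
      exact (mul_eq_zero.mp this).resolve_right hr1'
    have a21 : A 2 1 = 0 := by
      have : A 2 1 * (1 + r) = 0 := by linear_combination h1 - 2 * a10
      exact (mul_eq_zero.mp this).resolve_right hr1'
    have a01 : A 0 1 = 0 := by
      have : A 0 1 * (1 + r) = 0 := by linear_combination h4 - 3 * a12
      exact (mul_eq_zero.mp this).resolve_right hr1'
    exact ⟨a01, h10, a10, a12, h0, a21, h2, h3⟩
  · rintro ⟨a1, a2, a3, a4, a5, a6, h2, h3⟩
    funext i
    fin_cases i <;> simp [eta, a1, a2, a3, a4, a5, a6]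
    · exact h2
    · exact h3
    · linear_combination -r * h3

theorem kappa_lie_f1 (A : Matrix (Fin 3) (Fin 3) ℂ) (c : ℂ) :
    kappa (lie A (can f1)) = c • f1 ↔
      A 0 1 = 0 ∧ A 0 2 = 0 ∧ A 1 0 = 0 ∧ A 1 2 = 0 ∧ A 2 1 = 0 ∧
        A 0 0 + 3 * A 1 1 = c ∧ 3 * A 0 0 + A 2 2 = c := by
  rw [kappa_lie]
  constructor
  · intro h
    have h0 := congrFun h 0
    have h1 := congrFun h 1
    have h2 := congrFun h 2
    have h3 := congrFun h 3
    have h4 := congrFun h 4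
    have h6 := congrFun h 6
    have h7 := congrFun h 7
    simp [f1] at h0 h1 h2 h3 h4 h6 h7
    exact ⟨h3, h6, h1, h4, h0, h2, h7⟩
  · rintro ⟨a1, a2, a3, a4, a5, h2, h3⟩
    funext i
    fin_cases i <;> simp [f1, a1, a2, a3, a4, a5] <;> assumption

/-! ### Orbits of the model foliations -/

theorem finrank_stab_eta {r : ℂ} (hr : r ≠ 0) (hr1 : r ≠ -1) :
    Module.finrank ℂ (stab (eta r)) = 2 := by
  have e : stab (eta r) = Submodule.span ℂ (Set.range
      ![(1 : Matrix (Fin 3) (Fin 3) ℂ), Matrix.diagonal ![2, 1, 0]]) := by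
    ext A
    rw [mem_stab, Matrix.range_cons, Matrix.range_cons, Matrix.range_empty, Set.union_empty,
      Set.singleton_union, Submodule.mem_span_pair]
    simp only [kappa_lie_eta hr hr1]
    constructor
    · rintro ⟨c, a1, a2, a3, a4, a5, a6, h2, h3⟩
      refine ⟨A 2 2, A 1 1 - A 2 2, ?_⟩
      ext i j
      fin_cases i <;> fin_cases j <;> simp [a1, a2, a3, a4, a5, a6]
      linear_combination h2 - h3
    · rintro ⟨a, b, rfl⟩
      refine ⟨4 * a + 5 * b, ?_⟩
      simp
      constructor <;> ring
  have hli : LinearIndependent ℂ ![(1 : Matrix (Fin 3) (Fin 3) ℂ), Matrix.diagonal ![2, 1, 0]] := by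
    rw [LinearIndependent.pair_iff]
    intro a b h
    have h0 := congrFun (congrFun h 2) 2
    have h1 := congrFun (congrFun h 1) 1
    simp at h0 h1
    exact ⟨h0, by simpa [h0] using h1⟩
  rw [e, finrank_span_eq_card hli]
  simp

theorem finrank_stab_f1 : Module.finrank ℂ (stab f1) = 3 := by
  have e : stab f1 = Submodule.span ℂ (Set.range
      ![(1 : Matrix (Fin 3) (Fin 3) ℂ), Matrix.diagonal ![0, 1, 3], Matrix.single 2 0 1]) := by
    ext A
    rw [mem_stab, Matrix.range_cons, Matrix.range_cons, Matrix.range_cons, Matrix.range_empty,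
      Set.union_empty, Set.singleton_union, Set.singleton_union, Submodule.mem_span_triple]
    simp only [kappa_lie_f1]
    constructor
    · rintro ⟨c, a1, a2, a3, a4, a5, h2, h3⟩
      refine ⟨A 0 0, A 1 1 - A 0 0, A 2 0, ?_⟩
      ext i j
      fin_cases i <;> fin_cases j <;> simp [a1, a2, a3, a4, a5]
      linear_combination h2 - h3
    · rintro ⟨a, b, d, rfl⟩
      refine ⟨4 * a + 3 * b, ?_⟩
      simp
      constructor <;> ring
  have hli : LinearIndependent ℂ ![(1 : Matrix (Fin 3) (Fin 3) ℂ), Matrix.diagonal ![0, 1, 3],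
      Matrix.single 2 0 1] := by
    rw [Fintype.linearIndependent_iff]
    intro a h
    rw [Fin.sum_univ_three] at h
    have h0 := congrFun (congrFun h 0) 0
    have h1 := congrFun (congrFun h 1) 1
    have h2 := congrFun (congrFun h 2) 0
    simp at h0 h1 h2
    intro i
    fin_cases i
    · exact h0
    · simpa [h0] using h1
    · exact h2
  rw [e, finrank_span_eq_card hli]
  simp

/-- The parameter `r` is an invariant of the orbit: a linear equivalence has to commute with the
one-parameter group of symmetries, hence is diagonal. -/
theorem eq_of_equivalent_eta {r s : ℂ} (hr : r ≠ 0) (hr1 : r ≠ -1) (hs : s ≠ 0) (hs1 : s ≠ -1)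
    (h : Equivalent (eta r) (eta s)) : r = s := by
  obtain ⟨g, a, hg, ha, e⟩ := h
  have hu := isUnit_iff_ne_zero.mpr hg
  have hD : kappa (lie (Matrix.diagonal ![2, 1, 0]) (can (eta r))) = (5 : ℂ) • eta r := by
    rw [kappa_lie_eta hr hr1]
    simp
    norm_num
  have hgB : g * (g⁻¹ * Matrix.diagonal ![2, 1, 0] * g) = Matrix.diagonal ![2, 1, 0] * g := by
    rw [mul_assoc, ← mul_assoc, Matrix.mul_nonsing_inv _ hu, one_mul]
  have htr : (g⁻¹ * Matrix.diagonal ![2, 1, 0] * g).trace = 3 := by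
    rw [Matrix.trace_mul_cycle, Matrix.mul_nonsing_inv _ hu, one_mul]
    simp [Fin.sum_univ_three]
    norm_num
  have hB := kappa_lie_equivalent hg hgB hD a
  rw [← e, kappa_lie_eta hs hs1] at hB
  generalize g⁻¹ * Matrix.diagonal ![2, 1, 0] * g = B at hgB hB htr
  obtain ⟨b1, b2, b3, b4, b5, b6, h1, h2⟩ := hB
  rw [Matrix.trace_fin_three] at htr
  have c1 : B 1 1 = 1 := by linear_combination (1 / 3 : ℂ) * (htr - h2 + h1)
  have c0 : B 0 0 = 2 := by linear_combination h1 - 3 * c1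
  have c2 : B 2 2 = 0 := by linear_combination htr - c0 - c1
  have hBd : B = Matrix.diagonal ![2, 1, 0] := by
    ext i j
    fin_cases i <;> fin_cases j <;> simp [b1, b2, b3, b4, b5, b6, c0, c1, c2]
  rw [hBd] at hgB
  have hgd : g = Matrix.diagonal ![g 0 0, g 1 1, g 2 2] := by
    ext i j
    have := congrFun (congrFun hgB i) j
    rw [Matrix.mul_diagonal, Matrix.diagonal_mul] at this
    fin_cases i <;> fin_cases j <;> simp at this ⊢ <;>
      first | exact this | linear_combination this | linear_combination -this
  rw [hgd, rho_diagonal] at e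
  have e3 := congrFun e 3
  have e9 := congrFun e 9
  simp [eta] at e3 e9
  linear_combination -e9 + r * e3

/-! ### Degenerations along one-parameter subgroups -/

theorem mem_closure_of_curve {w : Fin 15 → ℂ} (γ : ℂ → Fin 15 → ℂ) (hγ : Continuous γ)
    (h : ∀ t, t ≠ 0 → Equivalent w (γ t)) : γ 0 ∈ closure {u | Equivalent w u} := by
  have h0 : (0 : ℂ) ∈ closure {t : ℂ | t ≠ 0} := by
    have : closure ({0}ᶜ : Set ℂ) = Set.univ := dense_compl_singleton (0 : ℂ) |>.closure_eq
    change (0 : ℂ) ∈ closure ({0}ᶜ : Set ℂ)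
    rw [this]
    trivial
  refine closure_mono ?_ (image_closure_subset_closure_image hγ ⟨0, h0, rfl⟩)
  rintro _ ⟨t, ht, rfl⟩
  exact h t ht

/-- If the line `Z = 0` has second order contact with the foliation at the singular point
`[1 : 0 : 0]`, then the one-parameter group `diag(1, t, t²)` degenerates the foliation to a
model. -/
theorem eta_mem_closure_of_eigenline {w : Fin 15 → ℂ} (h0 : w 0 = 0) (h7 : w 7 = 0) (h1 : w 1 = 0)
    (h2 : w 2 ≠ 0) (h3 : w 3 ≠ 0) : eta (-(w 9 / w 3)) ∈ closure {u | Equivalent w u} := by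
  let γ : ℂ → Fin 15 → ℂ := fun t =>
    ![0, 0, w 2, w 3, t * w 4, t ^ 3 * w 5, t * w 6, 0, t ^ 2 * w 8, w 9, t ^ 2 * w 10,
      t ^ 3 * w 11, t ^ 4 * w 12, t * w 13, t ^ 2 * w 14]
  have hγ : Continuous γ := by
    refine continuous_pi fun i => ?_
    fin_cases i <;> simp only [γ] <;> first | exact continuous_const | (simp; fun_prop)
  have hlim := mem_closure_of_curve (w := w) γ hγ fun t ht => by
    refine ⟨Matrix.diagonal ![1, t, t ^ 2], (t ^ 3)⁻¹, ?_, inv_ne_zero (pow_ne_zero _ ht), ?_⟩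
    · simp [Fin.prod_univ_three, ht]
    · rw [rho_diagonal]
      apply funext_fifteen
      all_goals
        simp [γ, h0, h1, h7]
        try field_simp
  refine Equivalent.mem_closure hlim
    ⟨Matrix.diagonal ![1, 1, w 2 / w 3], (w 2)⁻¹, ?_, inv_ne_zero h2, ?_⟩
  · simp [Fin.prod_univ_three, h2, h3]
  · rw [rho_diagonal]
    apply funext_fifteen
    all_goals
      simp [γ, eta]
      try field_simp

/-- If the line `Z = 0` has second order contact with the foliation at the regular point
`[1 : 0 : 0]`, then the one-parameter group `diag(1, t, t³)` degenerates the foliation to `𝓕₁`. -/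
theorem f1_mem_closure_of_inflection {w : Fin 15 → ℂ} (h0 : w 0 = 0) (h1 : w 1 = 0)
    (h2 : w 2 ≠ 0) (h7 : w 7 ≠ 0) : f1 ∈ closure {u | Equivalent w u} := by
  let γ : ℂ → Fin 15 → ℂ := fun t =>
    ![0, 0, w 2, t * w 3, t ^ 2 * w 4, t ^ 6 * w 5, t ^ 3 * w 6, w 7, t ^ 4 * w 8, t * w 9,
      t ^ 3 * w 10, t ^ 5 * w 11, t ^ 7 * w 12, t ^ 2 * w 13, t ^ 4 * w 14]
  have hγ : Continuous γ := by
    refine continuous_pi fun i => ?_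
    fin_cases i <;> simp only [γ] <;> first | exact continuous_const | (simp; fun_prop)
  have hlim := mem_closure_of_curve (w := w) γ hγ fun t ht => by
    refine ⟨Matrix.diagonal ![1, t, t ^ 3], (t ^ 3)⁻¹, ?_, inv_ne_zero (pow_ne_zero _ ht), ?_⟩
    · simp [Fin.prod_univ_three, ht]
    · rw [rho_diagonal]
      apply funext_fifteen
      all_goals
        simp [γ, h0, h1]
        try field_simp
  refine Equivalent.mem_closure hlim
    ⟨Matrix.diagonal ![1, 1, w 2 / w 7], (w 2)⁻¹, ?_, inv_ne_zero h2, ?_⟩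
  · simp [Fin.prod_univ_three, h2, h7]
  · rw [rho_diagonal]
    apply funext_fifteen
    all_goals
      simp [γ, f1]
      try field_simp

/-- The first two columns of the change of coordinates span an inflectional tangent of the
model. -/
theorem f1_mem_closure_eta {r : ℂ} (hr : r ≠ 0) (hr1 : r ≠ -1) :
    f1 ∈ closure {u | Equivalent (eta r) u} := by
  have hr1' : 1 + r ≠ 0 := fun h => hr1 (by linear_combination h)
  let g : Matrix (Fin 3) (Fin 3) ℂ := !![1 + r, 0, 0; 1 + r, 1 + r, 0; r - 1, -2, 1]
  have hg : g.det ≠ 0 := by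
    simp [g, Matrix.det_fin_three, hr1']
  have e : ∀ i, rho g (eta r) i =
      ![0, 0, (1 + r) ^ 4, (1 + r) ^ 3, 0, 0, 0, -(r * (1 + r) ^ 3), 0, -(r * (1 + r) ^ 3), 0,
        0, 0, 0, 0] i := by
    apply congrFun
    apply funext_fifteen
    all_goals
      simp only [rho, act, kappa_apply, Fin.sum_univ_three, can_apply, g, eta,
        Matrix.adjugate_fin_three_of, Matrix.cons_val, Matrix.of_apply]
      ring
  refine Equivalent.mem_closure_of_left (equivalent_rho hg _)
    (f1_mem_closure_of_inflection ?_ ?_ ?_ ?_)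
  all_goals simp [e, hr, hr1']

/-! ### Nondegenerate singular points -/

/-- The trace of the linear part at a singular point `[1 : 0 : 0]`. -/
def tr {R : Type*} [CommRing R] (w : Fin 15 → R) : R := w 9 + w 3

/-- The determinant of the linear part at a singular point `[1 : 0 : 0]`. -/
def dt {R : Type*} [CommRing R] (w : Fin 15 → R) : R := w 9 * w 3 - w 6 * w 1

/-- The discriminant of the linear part at a singular point `[1 : 0 : 0]`. -/
def disc {R : Type*} [CommRing R] (w : Fin 15 → R) : R := (w 9 - w 3) ^ 2 + 4 * w 6 * w 1

/-- A resultant which vanishes when an eigenline of the linear part at `[1 : 0 : 0]` is invariant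
by the foliation. -/
def res {R : Type*} [CommRing R] (w : Fin 15 → R) : R :=
  let e := w 9 - w 3
  let a := w 2 * w 6 ^ 3 - w 8 * w 6 ^ 2 * w 1 + w 5 * e * w 6 * w 1
  let b := w 4 * w 6 ^ 2 + w 8 * w 6 * e - w 5 * (e ^ 2 + w 6 * w 1)
  a ^ 2 - a * b * e - b ^ 2 * w 6 * w 1

/-- The point `[1 : 0 : 0]` is a nondegenerate singular point with distinct eigenvalues of
non-zero sum, and no eigenline at this point is invariant by the foliation. -/
structure Good (w : Fin 15 → ℂ) : Prop where
  h0 : w 0 = 0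
  h7 : w 7 = 0
  h6 : w 6 ≠ 0
  tr_ne : tr w ≠ 0
  dt_ne : dt w ≠ 0
  disc_ne : disc w ≠ 0
  res_ne : res w ≠ 0

/-- The degeneration along the eigenline `(w 6, m)` at `[1 : 0 : 0]`; the eigenvalues are `m + w 9`
and `w 3 - m`. -/
theorem eta_mem_closure_of_good {w : Fin 15 → ℂ} (h : Good w) {m : ℂ}
    (hm : m ^ 2 + (w 9 - w 3) * m - w 6 * w 1 = 0) :
    w 3 - m ≠ 0 ∧ eta (-((w 9 + m) / (w 3 - m))) ∈ closure {u | Equivalent w u} := by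
  obtain ⟨h0, h7, h6, -, hd, -, hres⟩ := h
  have h3 : w 3 - m ≠ 0 := by
    intro h
    apply hd
    rw [dt]
    linear_combination hm + (m + w 9) * h
  refine ⟨h3, ?_⟩
  let g : Matrix (Fin 3) (Fin 3) ℂ := !![1, 0, 0; 0, w 6, 0; 0, m, 1]
  have hg : g.det ≠ 0 := by
    simp [g, Matrix.det_fin_three, h6]
  have hC : w 2 * w 6 ^ 3 + w 4 * w 6 ^ 2 * m - w 8 * w 6 * m ^ 2 - w 5 * m ^ 3 ≠ 0 := by
    intro hC
    apply hres
    have hab : (w 2 * w 6 ^ 3 - w 8 * w 6 ^ 2 * w 1 + w 5 * (w 9 - w 3) * w 6 * w 1)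
      + (w 4 * w 6 ^ 2 + w 8 * w 6 * (w 9 - w 3) - w 5 * ((w 9 - w 3) ^ 2 + w 6 * w 1)) * m
      = 0 := by
      linear_combination hC + (w 8 * w 6 + w 5 * m - w 5 * (w 9 - w 3)) * hm
    simp only [res]
    generalize w 2 * w 6 ^ 3 - w 8 * w 6 ^ 2 * w 1 + w 5 * (w 9 - w 3) * w 6 * w 1 = a at hab
    generalize w 4 * w 6 ^ 2 + w 8 * w 6 * (w 9 - w 3) - w 5 * ((w 9 - w 3) ^ 2 + w 6 * w 1) = b
      at hab
    linear_combination (a - b * m - b * (w 9 - w 3)) * hab + b ^ 2 * hm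
  have e0 : rho g w 0 = 0 := by
    simp only [rho, act, kappa_apply, Fin.sum_univ_three, can_apply, g,
        Matrix.adjugate_fin_three_of, Matrix.cons_val, Matrix.of_apply, h0, h7]
    ring
  have e7 : rho g w 7 = 0 := by
    simp only [rho, act, kappa_apply, Fin.sum_univ_three, can_apply, g,
        Matrix.adjugate_fin_three_of, Matrix.cons_val, Matrix.of_apply, h0, h7]
    ring
  have e1 : rho g w 1 = 0 := by
    simp only [rho, act, kappa_apply, Fin.sum_univ_three, can_apply, g,
        Matrix.adjugate_fin_three_of, Matrix.cons_val, Matrix.of_apply, h0, h7]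
    linear_combination -w 6 * hm
  have e2 : rho g w 2 =
      w 2 * w 6 ^ 3 + w 4 * w 6 ^ 2 * m - w 8 * w 6 * m ^ 2 - w 5 * m ^ 3 := by
    simp only [rho, act, kappa_apply, Fin.sum_univ_three, can_apply, g,
        Matrix.adjugate_fin_three_of, Matrix.cons_val, Matrix.of_apply]
    ring
  have e3 : rho g w 3 = w 6 * (w 3 - m) := by
    simp only [rho, act, kappa_apply, Fin.sum_univ_three, can_apply, g,
        Matrix.adjugate_fin_three_of, Matrix.cons_val, Matrix.of_apply, h0, h7]
    ring
  have e9 : rho g w 9 = w 6 * (w 9 + m) := by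
    simp only [rho, act, kappa_apply, Fin.sum_univ_three, can_apply, g,
        Matrix.adjugate_fin_three_of, Matrix.cons_val, Matrix.of_apply, h0, h7]
    ring
  have hlim := eta_mem_closure_of_eigenline e0 e7 e1 (by rw [e2]; exact hC)
    (by rw [e3]; exact mul_ne_zero h6 h3)
  rw [e3, e9, mul_div_mul_left _ _ h6] at hlim
  exact Equivalent.mem_closure_of_left (equivalent_rho hg _) hlim

/-- The two eigenlines at a good point give two different models in the closure of the orbit. -/
theorem Good.exists_eta {w : Fin 15 → ℂ} (h : Good w) : ∃ r s : ℂ, r ≠ s ∧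
    ∀ x, x = r ∨ x = s → x ≠ 0 ∧ x ≠ -1 ∧ dt w * (x ^ 2 + 1) = (2 * dt w - tr w ^ 2) * x ∧
      eta x ∈ closure {u | Equivalent w u} := by
  obtain ⟨d, hd⟩ := IsAlgClosed.exists_pow_nat_eq (disc w) (n := 2) (by norm_num)
  have hd0 : d ≠ 0 := by
    rintro rfl
    apply h.disc_ne
    rw [← hd]
    norm_num
  have key : ∀ d : ℂ, d ^ 2 = disc w → d ≠ 0 → ∃ x, x * (tr w - d) = -(tr w + d) ∧ tr w - d ≠ 0 ∧
      x ≠ 0 ∧ x ≠ -1 ∧ dt w * (x ^ 2 + 1) = (2 * dt w - tr w ^ 2) * x ∧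
      eta x ∈ closure {u | Equivalent w u} := by
    intro d hd hd0
    have hm : ((d - (w 9 - w 3)) / 2) ^ 2 + (w 9 - w 3) * ((d - (w 9 - w 3)) / 2) - w 6 * w 1
        = 0 := by
      rw [disc] at hd
      linear_combination (1 / 4 : ℂ) * hd
    obtain ⟨h3, hmem⟩ := eta_mem_closure_of_good h hm
    have e1 : w 3 - (d - (w 9 - w 3)) / 2 = (tr w - d) / 2 := by rw [tr]; ring
    have e2 : w 9 + (d - (w 9 - w 3)) / 2 = (tr w + d) / 2 := by rw [tr]; ring
    rw [e1, e2] at hmem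
    rw [e1] at h3
    have h3' : tr w - d ≠ 0 := fun h => h3 (by rw [h]; norm_num)
    have hx : -((tr w + d) / 2 / ((tr w - d) / 2)) * (tr w - d) = -(tr w + d) := by
      field_simp
    have hdt : 4 * dt w = (tr w - d) * (tr w + d) := by
      rw [disc] at hd
      rw [dt, tr]
      linear_combination hd
    generalize -((tr w + d) / 2 / ((tr w - d) / 2)) = x at hx hmem
    refine ⟨x, hx, h3', ?_, ?_, ?_, hmem⟩
    · rintro rfl
      apply h.dt_ne
      linear_combination (1 / 4 : ℂ) * hdt + (1 / 4 : ℂ) * (tr w - d) * hx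
    · rintro rfl
      apply hd0
      linear_combination (1 / 2 : ℂ) * hx
    · have : (tr w - d) ^ 2 * (dt w * (x ^ 2 + 1) - (2 * dt w - tr w ^ 2) * x) = 0 := by
        linear_combination (dt w * (x * (tr w - d) - (tr w + d)) -
          (2 * dt w - tr w ^ 2) * (tr w - d)) * hx + tr w ^ 2 * hdt
      have := (mul_eq_zero.mp this).resolve_left (pow_ne_zero _ h3')
      linear_combination this
  obtain ⟨r, hr, hr', hr1, hr2, hr3, hr4⟩ := key d hd hd0
  obtain ⟨s, hs, hs', hs1, hs2, hs3, hs4⟩ := key (-d) (by rw [neg_sq, hd]) (neg_ne_zero.mpr hd0)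
  refine ⟨r, s, ?_, ?_⟩
  · rintro rfl
    have h1 : (r + 1) * tr w = 0 := by linear_combination (1 / 2 : ℂ) * (hr + hs)
    rcases mul_eq_zero.mp h1 with h1 | h1
    · exact hr2 (by linear_combination h1)
    · exact h.tr_ne h1
  · rintro x (rfl | rfl)
    · exact ⟨hr1, hr2, hr3, hr4⟩
    · exact ⟨hs1, hs2, hs3, hs4⟩

/-! ### Common factors -/

/-- The substitution `x ↦ t x`, which separates the homogeneous components. -/
def dilate {σ : Type*} : MvPolynomial σ ℂ →ₐ[ℂ] Polynomial (MvPolynomial σ ℂ) :=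
  aeval fun i => Polynomial.C (X i) * Polynomial.X

theorem dilate_of_isHomogeneous {σ : Type*} {p : MvPolynomial σ ℂ} {n : ℕ}
    (hp : p.IsHomogeneous n) :
    dilate p = Polynomial.C p * Polynomial.X ^ n := by
  conv_rhs => rw [p.as_sum]
  conv_lhs => rw [p.as_sum]
  rw [map_sum, map_sum, Finset.sum_mul]
  refine Finset.sum_congr rfl fun d hd => ?_
  have hd3 : d.degree = n := by
    have := hp (mem_support_iff.mp hd)
    rwa [Finsupp.degree_eq_weight_one]
  rw [dilate, aeval_monomial, monomial_eq, Finsupp.prod, Finsupp.prod]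
  simp only [mul_pow, Finset.prod_mul_distrib, Finset.prod_pow_eq_pow_sum, map_mul, map_prod,
    map_pow]
  rw [← Finsupp.degree_apply, hd3, ← mul_assoc]
  rfl

theorem coeff_dilate {σ : Type*} (p : MvPolynomial σ ℂ) (n : ℕ) :
    (dilate p).coeff n = homogeneousComponent n p := by
  conv_lhs => rw [← sum_homogeneousComponent p]
  rw [map_sum, Polynomial.finsetSum_coeff]
  simp only [dilate_of_isHomogeneous (homogeneousComponent_isHomogeneous _ p),
    Polynomial.coeff_C_mul_X_pow]
  rw [Finset.sum_ite_eq]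
  split_ifs with h
  · rfl
  · rw [homogeneousComponent_eq_zero]
    simpa using h

/-- If the coefficients of a non-zero form have a non-trivial common factor, they have a
homogeneous one, namely its component of highest degree. -/
theorem exists_homogeneous_factor {w : Fin 15 → ℂ} (hw : w ≠ 0) (h : ¬ Saturated w) :
    ∃ (P : MvPolynomial (Fin 3) ℂ) (n : ℕ), 0 < n ∧ P.IsHomogeneous n ∧
      ∀ i, P ∣ form (can w) i := by
  rw [Saturated] at h
  push Not at h
  obtain ⟨p, hp, hpu⟩ := h
  have hp0 : p ≠ 0 := by
    rintro rfl
    apply formK_ne_zero hw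
    apply Subtype.ext
    funext i
    exact zero_dvd_iff.mp (hp i)
  have hH0 : dilate p ≠ 0 := by
    intro h0
    apply hp0
    rw [← sum_homogeneousComponent p]
    refine Finset.sum_eq_zero fun n _ => ?_
    rw [← coeff_dilate, h0, Polynomial.coeff_zero]
  refine ⟨(dilate p).leadingCoeff, (dilate p).natDegree, ?_, ?_, fun i => ?_⟩
  · rw [Nat.pos_iff_ne_zero]
    intro hn
    apply hpu
    have h1 : p = C (coeff 0 p) := by
      rw [← homogeneousComponent_zero]
      conv_lhs => rw [← sum_homogeneousComponent p]
      refine Finset.sum_eq_single_of_mem 0 (by simp) fun n _ hn0 => ?_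
      rw [← coeff_dilate]
      exact Polynomial.coeff_eq_zero_of_natDegree_lt (by omega)
    have h2 : coeff 0 p ≠ 0 := by
      intro h2
      rw [h2, map_zero] at h1
      exact hp0 h1
    rw [h1]
    exact (isUnit_iff_ne_zero.mpr h2).map C
  · rw [Polynomial.leadingCoeff, coeff_dilate]
    exact homogeneousComponent_isHomogeneous _ _
  · obtain ⟨t, ht⟩ := hp i
    have h1 := congrArg (fun q => (dilate q).leadingCoeff) ht
    simp only [map_mul, Polynomial.leadingCoeff_mul,
      dilate_of_isHomogeneous ((form_mem (can w)).1 i), Polynomial.leadingCoeff_C,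
      Polynomial.leadingCoeff_X_pow, mul_one] at h1
    exact ⟨_, h1⟩

theorem eval_smul_of_isHomogeneous {σ : Type*} {P : MvPolynomial σ ℂ} {n : ℕ}
    (hP : P.IsHomogeneous n) (c : ℂ) (x : σ → ℂ) : eval (c • x) P = c ^ n * eval x P := by
  have h : eval (c • x) P = ((dilate P).map (eval x)).eval c := by
    have e : (aeval (c • x) : MvPolynomial σ ℂ →ₐ[ℂ] ℂ).toRingHom
        = ((Polynomial.evalRingHom c).comp (Polynomial.mapRingHom (eval x))).comp
          dilate.toRingHom := by
      ext i
      · simp [dilate]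
      · simp only [dilate, AlgHom.toRingHom_eq_coe, RingHom.coe_comp, RingHom.coe_coe,
          Function.comp_apply, aeval_X, Polynomial.coe_mapRingHom, Polynomial.map_mul,
          Polynomial.map_C, Polynomial.map_X, Polynomial.coe_evalRingHom, Polynomial.eval_mul,
          Polynomial.eval_C, Polynomial.eval_X, eval_X, Pi.smul_apply, smul_eq_mul]
        ring
    exact DFunLike.congr_fun e P
  rw [h, dilate_of_isHomogeneous hP, Polynomial.map_mul, Polynomial.map_C, Polynomial.map_pow,
    Polynomial.map_X, Polynomial.eval_mul, Polynomial.eval_C, Polynomial.eval_pow,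
    Polynomial.eval_X, mul_comm]

/-- A homogeneous polynomial of positive degree has a zero on every projective line. -/
theorem exists_eval_eq_zero {P : MvPolynomial (Fin 3) ℂ} {n : ℕ} (hn : 0 < n)
    (hP : P.IsHomogeneous n) (a b : Fin 3 → ℂ) :
    ∃ s t : ℂ, (s ≠ 0 ∨ t ≠ 0) ∧ eval (s • a + t • b) P = 0 := by
  by_contra! hcon
  have hline : ∀ a b : Fin 3 → ℂ, ∃ r : Polynomial ℂ, ∀ t, r.eval t = eval (t • a + b) P := by
    intro a b
    refine ⟨aeval (fun i => Polynomial.C (a i) * Polynomial.X + Polynomial.C (b i)) P, fun t => ?_⟩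
    have e : (Polynomial.evalRingHom t).comp
        (aeval (fun i => Polynomial.C (a i) * Polynomial.X + Polynomial.C (b i)) :
          MvPolynomial (Fin 3) ℂ →ₐ[ℂ] Polynomial ℂ).toRingHom
        = (eval (t • a + b)) := by
      ext i
      · simp
      · simp only [AlgHom.toRingHom_eq_coe, RingHom.coe_comp, RingHom.coe_coe,
          Function.comp_apply, aeval_X, Polynomial.coe_evalRingHom, Polynomial.eval_add,
          Polynomial.eval_mul, Polynomial.eval_C, Polynomial.eval_X, eval_X, Pi.add_apply,
          Pi.smul_apply, smul_eq_mul]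
        ring
    exact DFunLike.congr_fun e P
  obtain ⟨r, hr⟩ := hline a b
  obtain ⟨q, hq⟩ := hline b a
  -- without zeros the restriction to the affine line is constant
  have hdeg : r.degree = 0 := by
    by_contra hdeg
    obtain ⟨t, ht⟩ := IsAlgClosed.exists_root r hdeg
    rw [Polynomial.IsRoot, hr] at ht
    refine hcon t 1 (Or.inr one_ne_zero) ?_
    rwa [one_smul]
  rw [Polynomial.eq_C_of_degree_eq_zero hdeg] at hr
  simp only [Polynomial.eval_C] at hr
  have hq' : q = Polynomial.C (r.coeff 0) * Polynomial.X ^ n := by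
    refine Polynomial.eq_of_infinite_eval_eq _ _ (Set.Infinite.mono ?_
      (Set.infinite_univ.sdiff (Set.finite_singleton (0 : ℂ))))
    intro t ht
    have ht0 : t ≠ 0 := by simpa using ht
    change q.eval t = _
    rw [hq, Polynomial.eval_mul, Polynomial.eval_C, Polynomial.eval_pow, Polynomial.eval_X,
      hr t⁻¹, mul_comm, ← eval_smul_of_isHomogeneous hP, smul_add, smul_smul,
      mul_inv_cancel₀ ht0, one_smul, add_comm]
  have h0 := hq 0
  rw [hq', zero_smul, zero_add] at h0
  refine hcon 1 0 (Or.inl one_ne_zero) ?_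
  rw [one_smul, zero_smul, add_zero, ← h0]
  simp [hn.ne']

theorem eval_form_can (w : Fin 15 → ℂ) (x : Fin 3 → ℂ) :
    let q2 := w 0 * x 0 ^ 2 + w 1 * x 0 * x 1 + w 2 * x 1 ^ 2 + w 3 * x 0 * x 2 + w 4 * x 1 * x 2
    let q1 := w 5 * x 2 ^ 2 + w 6 * x 0 * x 2 + w 7 * x 0 ^ 2 + w 8 * x 1 * x 2 + w 9 * x 0 * x 1
    let q0 := w 10 * x 1 ^ 2 + w 11 * x 1 * x 2 + w 12 * x 2 ^ 2 + w 13 * x 0 * x 1 +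
      w 14 * x 0 * x 2
    eval x (form (can w) 0) = q1 * x 2 - q2 * x 1 ∧ eval x (form (can w) 1) = q2 * x 0 - q0 * x 2 ∧
      eval x (form (can w) 2) = q0 * x 1 - q1 * x 0 := by
  refine ⟨?_, ?_, ?_⟩ <;>
  · simp only [form, quad, Fin.sum_univ_three, can_apply, Matrix.cons_val, map_sub, map_mul,
      map_add, eval_C, eval_X]
    ring

/-- The coefficients of a form without zeros on some projective line have no common factor. -/
theorem saturated_of_line {w : Fin 15 → ℂ} (a b : Fin 3 → ℂ)
    (h : ∀ s t : ℂ, (∀ i, eval (s • a + t • b) (form (can w) i) = 0) → s = 0 ∧ t = 0) :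
    Saturated w := by
  have hw : w ≠ 0 := by
    rintro rfl
    have := h 1 1 fun i => by
      rw [← coe_formK, formK_zero]
      exact map_zero _
    exact one_ne_zero this.1
  by_contra hs
  obtain ⟨P, n, hn, hP, hdvd⟩ := exists_homogeneous_factor hw hs
  obtain ⟨s, t, hst, h0⟩ := exists_eval_eq_zero hn hP a b
  have := h s t fun i => by
    obtain ⟨τ, hτ⟩ := hdvd i
    rw [hτ, map_mul, h0, zero_mul]
  tauto

theorem saturated_eta {r : ℂ} (hr : r ≠ 0) : Saturated (eta r) := by
  refine saturated_of_line ![1, 0, 1] ![0, 1, 0] fun s t h => ?_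
  have h0 := h 0
  have h1 := h 1
  have h2 := h 2
  rw [(eval_form_can _ _).1] at h0
  rw [(eval_form_can _ _).2.1] at h1
  rw [(eval_form_can _ _).2.2] at h2
  simp [eta] at h0 h1 h2
  simp only [hr, false_or] at h2
  have hst : s = 0 ∨ t = 0 := by tauto
  rcases hst with rfl | rfl
  · simp at h0
    exact ⟨rfl, h0⟩
  · simp at h0 h1
    tauto

theorem saturated_f1 : Saturated f1 := by
  refine saturated_of_line ![1, 0, 0] ![0, 1, 0] fun s t h => ?_
  have h0 := h 0
  have h2 := h 2
  rw [(eval_form_can _ _).1] at h0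
  rw [(eval_form_can _ _).2.2] at h2
  simp [f1] at h0 h2
  exact ⟨h2, h0⟩

/-- A common factor cannot vanish at a nondegenerate zero. -/
theorem jacobian_eq_zero_of_dvd {P f g : MvPolynomial (Fin 3) ℂ} (hf : P ∣ f) (hg : P ∣ g)
    {x : Fin 3 → ℂ} (hx : eval x P = 0) (i j : Fin 3) :
    eval x (pderiv i f) * eval x (pderiv j g) - eval x (pderiv j f) * eval x (pderiv i g) = 0 := by
  obtain ⟨s, rfl⟩ := hf
  obtain ⟨t, rfl⟩ := hg
  simp [hx]
  ring

/-- A form whose only zeros on the line `Z = 0` are two nondegenerate singular points has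
coefficients without common factor. -/
theorem saturated_of_nondegenerate {w : Fin 15 → ℂ} (h0 : w 0 = 0) (h7 : w 7 = 0) (h2 : w 2 = 0)
    (h10 : w 10 = 0) (h1 : w 1 ≠ 0) (hd : dt w ≠ 0) (hd' : w 4 * w 13 - w 11 * w 1 ≠ 0) :
    Saturated w := by
  have hw : w ≠ 0 := by
    rintro rfl
    exact h1 rfl
  by_contra hs
  obtain ⟨P, n, hn, hP, hdvd⟩ := exists_homogeneous_factor hw hs
  obtain ⟨s, t, hst, hz⟩ := exists_eval_eq_zero hn hP ![1, 0, 0] ![0, 1, 0]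
  have hzero : ∀ i, eval (s • ![1, 0, 0] + t • ![0, 1, 0]) (form (can w) i) = 0 := fun i => by
    obtain ⟨τ, hτ⟩ := hdvd i
    rw [hτ, map_mul, hz, zero_mul]
  have z0 := hzero 0
  have z1 := hzero 1
  rw [(eval_form_can _ _).1] at z0
  rw [(eval_form_can _ _).2.1] at z1
  simp [h0, h2, h1] at z0 z1
  have hst0 : s = 0 ∨ t = 0 := by tauto
  rcases hst0 with rfl | rfl
  · have ht : t ≠ 0 := by tauto
    rw [zero_smul, zero_add, eval_smul_of_isHomogeneous hP] at hz
    have hz' := (mul_eq_zero.mp hz).resolve_left (pow_ne_zero _ ht)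
    have hJ := jacobian_eq_zero_of_dvd (hdvd 0) (hdvd 2) hz' 0 2
    apply hd'
    rw [← hJ]
    simp [form, quad, Fin.sum_univ_three, can_apply, pderiv_X]
    ring
  · have hs : s ≠ 0 := by tauto
    rw [zero_smul, add_zero, eval_smul_of_isHomogeneous hP] at hz
    have hz' := (mul_eq_zero.mp hz).resolve_left (pow_ne_zero _ hs)
    have hJ := jacobian_eq_zero_of_dvd (hdvd 1) (hdvd 2) hz' 1 2
    apply hd
    rw [← hJ, dt]
    simp [form, quad, Fin.sum_univ_three, can_apply, pderiv_X]
    ring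

/-! ### Generic forms -/

section Family

variable {R S : Type*} [CommRing R] [CommRing S]

/-- Linear changes of coordinates which move the points `[1 : 0 : 0]`, `[0 : 1 : 0]`, `[0 : 0 : 1]`
and `[1 : 1 : 1]` to `[1 : 0 : 0]`. -/
def frame (k : Fin 4) : Matrix (Fin 3) (Fin 3) R :=
  ![!![1, 0, 0; 0, 1, 0; 0, 0, 1], !![0, 0, 1; 1, 0, 0; 0, 1, 0], !![0, 1, 0; 0, 0, 1; 1, 0, 0],
    !![1, 0, 0; 1, 1, 0; 1, 0, 1]] k

/-- The forms with singular points at `[1 : 0 : 0]`, `[0 : 1 : 0]`, `[0 : 0 : 1]`, `[1 : 1 : 1]`,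
written in the coordinates `frame k`. The quadratic vector field is `N (YZ, XZ, XY)`, where the
rows `(n 0, n 1, _)`, `(n 2, n 3, _)`, `(n 4, n 5, _)` of the matrix `N` have the sum `n 6`. -/
def familyAt (k : Fin 4) (n : Fin 7 → R) : Fin 15 → R :=
  ![![0, n 6 - n 4 - n 5, 0, n 5, n 4, 0, n 3, 0, n 2, n 6 - n 2 - n 3, 0, n 0, 0, n 6 - n 0 -
    n 1, n 1],
    ![0, n 0, 0, n 6 - n 0 - n 1, n 1, 0, n 6 - n 4 - n 5, 0, n 5, n 4, 0, n 3, 0, n 2, n 6 -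
    n 2 - n 3],
    ![0, n 3, 0, n 2, n 6 - n 2 - n 3, 0, n 0, 0, n 6 - n 0 - n 1, n 1, 0, n 6 - n 4 - n 5, 0,
    n 5, n 4],
    ![0, n 1 - n 5, 0, -n 1 - n 0 + n 5 + n 4 - n 6, -n 0 + n 4, 0, -n 1 - n 0 + n 3 + n 2, 0,
    -n 0 + n 2, n 1 - n 3 - n 6, 0, n 0, 0, n 6 - n 1, n 1 + n 0]] k

theorem rho_frame_familyAt (k : Fin 4) (n : Fin 7 → R) :
    rho (frame k) (familyAt 0 n) = familyAt k n := by
  refine funext_fifteen ?_ ?_ ?_ ?_ ?_ ?_ ?_ ?_ ?_ ?_ ?_ ?_ ?_ ?_ ?_ <;> fin_cases k <;>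
  · simp only [Fin.zero_eta, Fin.mk_one, Fin.reduceFinMk, rho, act, kappa_apply,
      Fin.sum_univ_three, can_apply, frame, familyAt,
      Matrix.adjugate_fin_three_of, Matrix.cons_val, Matrix.of_apply]
    ring

theorem map_familyAt (φ : R →+* S) (k : Fin 4) (n : Fin 7 → R) (i : Fin 15) :
    φ (familyAt k n i) = familyAt k (fun j => φ (n j)) i := by
  fin_cases k <;> fin_cases i <;> simp [familyAt]

/-- A polynomial in the parameters of the family whose non-vanishing guarantees that the form is
saturated, that its four singular points are good, and that they have distinct Baum-Bott indices
`tr ^ 2 / dt`. -/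
def genericity (n : Fin 7 → R) : R :=
  let w := fun k => familyAt k n
  (w 0 1 * (w 0 4 * w 0 13 - w 0 11 * w 0 1)) *
    (∏ k, w k 6 * tr (w k) * dt (w k) * disc (w k) * res (w k)) *
    ∏ k, ∏ l, if k = l then 1 else tr (w k) ^ 2 * dt (w l) - tr (w l) ^ 2 * dt (w k)

theorem map_genericity (φ : R →+* S) (n : Fin 7 → R) :
    φ (genericity n) = genericity (fun j => φ (n j)) := by
  have e : ∀ k i, φ (familyAt k n i) = familyAt k (fun j => φ (n j)) i :=
    fun k i => map_familyAt φ k n i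
  simp only [genericity, tr, dt, disc, res, map_mul, map_prod, map_sub, map_add, map_pow,
    apply_ite φ, map_one, map_ofNat, e]

end Family

/-- A member of the family at which `genericity` does not vanish and the Jacobian of
`(g, n) ↦ rho g (familyAt 0 n)` is invertible. -/
def baseParam : Fin 7 → ℂ := ![-2, 1, 1, -1, 0, 0, 1]

theorem genericity_baseParam : genericity baseParam ≠ 0 := by
  simp only [genericity]
  refine mul_ne_zero (mul_ne_zero ?_ ?_) ?_
  · simp only [familyAt, baseParam, Matrix.cons_val]
    norm_num
  · refine Finset.prod_ne_zero_iff.mpr fun k _ => ?_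
    fin_cases k <;>
    · simp only [Fin.zero_eta, Fin.mk_one, Fin.reduceFinMk, familyAt, baseParam, Matrix.cons_val,
        tr, dt, disc, res]
      norm_num
  · refine Finset.prod_ne_zero_iff.mpr fun k _ => Finset.prod_ne_zero_iff.mpr fun l _ => ?_
    split_ifs with h
    · exact one_ne_zero
    · fin_cases k <;> fin_cases l <;> first | exact absurd rfl h | skip
      all_goals
        simp only [Fin.zero_eta, Fin.mk_one, Fin.reduceFinMk, familyAt, baseParam,
          Matrix.cons_val, tr, dt]
        norm_num

section Jacobian

open TrivSqZeroExt

/-- Over the dual numbers, `lie` is the derivative of `act` at the identity. -/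
theorem snd_act (A : Matrix (Fin 3) (Fin 3) ℂ) (T T' : Fin 3 → Fin 3 → Fin 3 → ℂ)
    (i j k : Fin 3) :
    (act (fun a b => inl ((1 : Matrix (Fin 3) (Fin 3) ℂ) a b) + inr (A a b))
      (fun a b c => inl (T a b c) + inr (T' a b c)) i j k : DualNumber ℂ).snd =
      lie A T i j k + T' i j k := by
  have hg : (fun a b => inl ((1 : Matrix (Fin 3) (Fin 3) ℂ) a b) + inr (A a b) :
      Matrix (Fin 3) (Fin 3) (DualNumber ℂ)) =
      !![1 + inr (A 0 0), inr (A 0 1), inr (A 0 2); inr (A 1 0), 1 + inr (A 1 1), inr (A 1 2);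
        inr (A 2 0), inr (A 2 1), 1 + inr (A 2 2)] := by
    ext a b <;> fin_cases a <;> fin_cases b <;> simp
  rw [hg]
  simp only [act, lie, Fin.sum_univ_three, Matrix.adjugate_fin_three_of, Matrix.trace_fin_three]
  fin_cases i <;> fin_cases j <;> fin_cases k <;>
  · simp only [Fin.zero_eta, Fin.mk_one, Fin.reduceFinMk, Matrix.cons_val, Matrix.of_apply]
    simp only [snd_add, snd_mul, snd_sub, snd_neg, fst_add, fst_mul, fst_sub, fst_neg, fst_inl,
      snd_inl, fst_inr, snd_inr, fst_one, snd_one, smul_eq_mul, MulOpposite.smul_eq_mul_unop,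
      MulOpposite.unop_op]
    ring

theorem snd_rho (A : Matrix (Fin 3) (Fin 3) ℂ) (w w' : Fin 15 → ℂ) (i : Fin 15) :
    (rho (fun a b => inl ((1 : Matrix (Fin 3) (Fin 3) ℂ) a b) + inr (A a b))
      (fun a => inl (w a) + inr (w' a)) i : DualNumber ℂ).snd = kappa (lie A (can w)) i + w' i := by
  have e : can (fun a => (inl (w a) + inr (w' a) : DualNumber ℂ)) =
      fun a b c => inl (can w a b c) + inr (can w' a b c) := by
    funext a b c
    fin_cases a <;> fin_cases b <;> fin_cases c <;> simp [can]
  conv_rhs => rw [← kappa_can w']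
  unfold rho
  rw [e]
  fin_cases i <;> simp [kappa_apply, snd_act, -DualNumber.inr_eq_smul_eps] <;> ring

end Jacobian

/-- The differential of `(g, n) ↦ rho g (familyAt 0 n)` at `(1, baseParam)` is injective on the
matrices whose first diagonal entry vanishes. This normalization removes the scalar matrices, whose
action only rescales the form, as do the homotheties of the parameter space. -/
theorem eq_zero_of_kappa_lie_baseParam (x : Fin 15 → ℂ)
    (h : ∀ i, kappa (lie !![0, x 0, x 1; x 2, x 3, x 4; x 5, x 6, x 7]
      (can (familyAt 0 baseParam))) i +
      familyAt 0 ![x 8, x 9, x 10, x 11, x 12, x 13, x 14] i = 0) : x = 0 := by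
  have h0 := h 0
  have h1 := h 1
  have h2 := h 2
  have h3 := h 3
  have h4 := h 4
  have h5 := h 5
  have h6 := h 6
  have h7 := h 7
  have h8 := h 8
  have h9 := h 9
  have h10 := h 10
  have h11 := h 11
  have h12 := h 12
  have h13 := h 13
  have h14 := h 14
  simp [Matrix.cons_val, kappa_lie, familyAt, baseParam]
    at h0 h1 h2 h3 h4 h5 h6 h7 h8 h9 h10 h11 h12 h13 h14
  have x0 : x 0 = 0 := by linear_combination h2
  have x1 : x 1 = 0 := by linear_combination -(2) * h5 - h12
  have x2 : x 2 = 0 := by linear_combination h0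
  have x3 : x 3 = 0 := by linear_combination h1 + (2) * h2 + h3 + h4 - h5 - h10 - h11 -
      h12 - h13 - h14
  have x4 : x 4 = 0 := by linear_combination -h5 - h12
  have x5 : x 5 = 0 := by linear_combination h0 - h7
  have x6 : x 6 = 0 := by linear_combination h2 - (1/2) * h10
  have x7 : x 7 = 0 := by linear_combination -(2) * h0 - h1 - h2 - h3 - h4 - h5 + h6 +
      (2) * h7 + h8 + h9 + (1/2) * h10 - h12
  have x8 : x 8 = 0 := by linear_combination -(8) * h0 + (4) * h2 - (4) * h5 + (4) * h6 +
      (8) * h7 + (4) * h8 + (4) * h9 - (2) * h10 - (3) * h11 - (6) * h12 - (4) * h13 - (4)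
      * h14
  have x9 : x 9 = 0 := by linear_combination (6) * h0 + h1 - h2 + h3 + h4 + (5) * h5 -
      (2) * h6 - (4) * h7 - (2) * h8 - (2) * h9 + h11 + (5) * h12 + h13 + (2) * h14
  have x10 : x 10 = 0 := by linear_combination (2) * h0 + h1 + h2 + h3 + h4 + (5) * h5 -
      (2) * h6 - (4) * h7 - h8 - (2) * h9 + h11 + (4) * h12 + h13 + h14
  have x11 : x 11 = 0 := by linear_combination -(4) * h0 - (2) * h1 - (2) * h2 - (2) * h3
      - (2) * h4 - h5 + (3) * h6 + (4) * h7 + (2) * h8 + (2) * h9 + h10 - h12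
  have x12 : x 12 = 0 := by linear_combination -(2) * h0 + (3) * h2 + h4 + (2) * h5 + (2)
      * h7 - h10 + h12
  have x13 : x 13 = 0 := by linear_combination (4) * h0 - h2 + h3 + h5 - (2) * h7 + (1/2)
      * h10 + h12
  have x14 : x 14 = 0 := by linear_combination (4) * h0 - h1 - h2 - h3 - h4 + (5) * h5 -
      (2) * h7 + h10 + (2) * h11 + (4) * h12 + (2) * h13 + (2) * h14
  exact funext_fifteen x0 x1 x2 x3 x4 x5 x6 x7 x8 x9 x10 x11 x12 x13 x14

/-- A generic form is equivalent to a generic member of the family. -/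
theorem exists_equivalent_familyAt : ∃ P : MvPolynomial (Fin 15) ℂ, P ≠ 0 ∧
    ∀ v, eval v P ≠ 0 → ∃ n, Equivalent v (familyAt 0 n) ∧ genericity n ≠ 0 := by
  let g : Matrix (Fin 3) (Fin 3) (MvPolynomial (Fin 15) ℂ) :=
    !![1, X 0, X 1; X 2, X 3, X 4; X 5, X 6, X 7]
  let n : Fin 7 → MvPolynomial (Fin 15) ℂ := ![X 8, X 9, X 10, X 11, X 12, X 13, X 14]
  have hf : AlgebraicIndependent ℂ (rho g (familyAt 0 n)) := by
    refine algebraicIndependent_of_injective _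
      ![0, 0, 0, 1, 0, 0, 0, 1, -2, 1, 1, -1, 0, 0, 1] fun x hx => ?_
    refine eq_zero_of_kappa_lie_baseParam x fun i => ?_
    rw [← snd_rho]
    refine Eq.trans ?_ (hx i)
    let z : Fin 15 → DualNumber ℂ := fun j => TrivSqZeroExt.inl ((![0, 0, 0, 1, 0, 0, 0, 1, -2, 1,
      1, -1, 0, 0, 1] : Fin 15 → ℂ) j) + TrivSqZeroExt.inr (x j)
    refine congrArg TrivSqZeroExt.snd (Eq.symm ?_)
    refine (map_rho (aeval z : MvPolynomial (Fin 15) ℂ →ₐ[ℂ] DualNumber ℂ).toRingHom g _ i).trans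
      ?_
    congr 1
    · ext a b <;> fin_cases a <;> fin_cases b <;> simp [g, z]
    · funext k
      rw [map_familyAt]
      fin_cases k <;> ext <;> simp [familyAt, n, z, baseParam]
  have hh : genericity n * g.det ≠ 0 := by
    intro h0
    have h1 := congrArg (eval ![0, 0, 0, 1, 0, 0, 0, 1, -2, 1, 1, -1, 0, 0, 1]) h0
    rw [map_mul, map_genericity, map_zero] at h1
    rcases mul_eq_zero.mp h1 with h1 | h1
    · refine genericity_baseParam (Eq.trans (congrArg _ ?_) h1)
      funext j
      fin_cases j <;> simp [n, baseParam]
    · simp [g, Matrix.det_fin_three] at h1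
  obtain ⟨P, hP, h⟩ := exists_forall_exists_preimage _ hf _ hh
  refine ⟨P, hP, fun v hv => ?_⟩
  obtain ⟨u, hu, hne⟩ := h v hv
  rw [map_mul, map_genericity, RingHom.map_det] at hne
  refine ⟨fun j => eval u (n j), Equivalent.symm ?_, left_ne_zero_of_mul hne⟩
  have e : v = rho (g.map (eval u)) (familyAt 0 fun j => eval u (n j)) := by
    funext i
    rw [← hu i, map_rho]
    simp only [map_familyAt]
  rw [e]
  exact equivalent_rho (right_ne_zero_of_mul hne) _

theorem saturated_familyAt {n : Fin 7 → ℂ} (h : genericity n ≠ 0) : Saturated (familyAt 0 n) := by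
  obtain ⟨h1, h2⟩ := mul_ne_zero_iff.mp (left_ne_zero_of_mul (left_ne_zero_of_mul h))
  have h3 := Finset.prod_ne_zero_iff.mp (right_ne_zero_of_mul (left_ne_zero_of_mul h)) 0
    (Finset.mem_univ _)
  refine saturated_of_nondegenerate rfl rfl rfl rfl h1 ?_ h2
  exact right_ne_zero_of_mul (left_ne_zero_of_mul (left_ne_zero_of_mul h3))

theorem good_familyAt {n : Fin 7 → ℂ} (h : genericity n ≠ 0) (k : Fin 4) : Good (familyAt k n) := by
  have h3 := Finset.prod_ne_zero_iff.mp (right_ne_zero_of_mul (left_ne_zero_of_mul h)) k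
    (Finset.mem_univ _)
  simp only [mul_ne_zero_iff] at h3
  obtain ⟨⟨⟨⟨h6, h7⟩, h8⟩, h9⟩, h10⟩ := h3
  refine ⟨?_, ?_, h6, h7, h8, h9, h10⟩ <;> fin_cases k <;> rfl

theorem det_frame_ne_zero (k : Fin 4) : (frame k : Matrix (Fin 3) (Fin 3) ℂ).det ≠ 0 := by
  fin_cases k <;> simp [frame, Matrix.det_fin_three]

theorem equivalent_familyAt (n : Fin 7 → ℂ) (k : Fin 4) :
    Equivalent (familyAt 0 n) (familyAt k n) := by
  rw [← rho_frame_familyAt k]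
  exact equivalent_rho (det_frame_ne_zero k) _

/-- The eigenlines at the four singular points give eight models `eta r` in the closure of the
orbit: the two values of `r` at a point determine the index `tr ^ 2 / dt` of this point. -/
theorem exists_eta_mem_closure {n : Fin 7 → ℂ} (h : genericity n ≠ 0) :
    ∃ r : Fin 4 × Bool → ℂ, Function.Injective r ∧ ∀ p, r p ≠ 0 ∧ r p ≠ -1 ∧
      eta (r p) ∈ closure {u | Equivalent (familyAt 0 n) u} := by
  choose r s hrs hr using fun k => (good_familyAt h k).exists_eta
  let f : Fin 4 × Bool → ℂ := fun p => bif p.2 then r p.1 else s p.1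
  have hf : ∀ p, f p = r p.1 ∨ f p = s p.1 := by
    rintro ⟨k, _ | _⟩
    · exact Or.inr rfl
    · exact Or.inl rfl
  refine ⟨f, ?_, fun p => ?_⟩
  · intro p q hpq
    obtain ⟨hp, -, hp', -⟩ := hr p.1 (f p) (hf p)
    obtain ⟨-, -, hq', -⟩ := hr q.1 (f q) (hf q)
    rw [← hpq] at hq'
    have hk : p.1 = q.1 := by
      by_contra hk
      have h4 := Finset.prod_ne_zero_iff.mp (Finset.prod_ne_zero_iff.mp (right_ne_zero_of_mul h)
        p.1 (Finset.mem_univ _)) q.1 (Finset.mem_univ _)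
      rw [if_neg hk] at h4
      apply mul_ne_zero h4 hp
      linear_combination dt (familyAt q.1 n) * hp' - dt (familyAt p.1 n) * hq'
    obtain ⟨k, b⟩ := p
    obtain ⟨l, c⟩ := q
    obtain rfl : k = l := hk
    cases b <;> cases c
    · rfl
    · exact absurd hpq.symm (hrs k)
    · exact absurd hpq (hrs k)
    · rfl
  · obtain ⟨h1, h2, -, h3⟩ := hr p.1 (f p) (hf p)
    exact ⟨h1, h2, Equivalent.mem_closure_of_left (equivalent_familyAt n p.1) h3⟩

/-! ### Degenerate singular points of generic forms -/

/-- The linear change of coordinates which moves the point `[1 : p : r]` to `[1 : 0 : 0]`. -/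
def shear {R : Type*} [CommRing R] (p r : R) : Matrix (Fin 3) (Fin 3) R :=
  !![1, 0, 0; p, 1, 0; r, 0, 1]

theorem shear_mul_shear_neg {R : Type*} [CommRing R] (p r : R) :
    shear p r * shear (-p) (-r) = 1 := by
  ext i j
  fin_cases i <;> fin_cases j <;> simp [shear]

theorem det_shear {R : Type*} [CommRing R] (p r : R) : (shear p r).det = 1 := by
  simp [shear, Matrix.det_fin_three]

/-- The forms with a singular point of vanishing discriminant in the chart `X ≠ 0` depend on
fourteen parameters only. -/
theorem exists_disc_ne_zero_of_chart : ∃ P : MvPolynomial (Fin 15) ℂ, P ≠ 0 ∧ ∀ v, eval v P ≠ 0 →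
    ∀ p r, rho (shear p r) v 0 = 0 → rho (shear p r) v 7 = 0 → disc (rho (shear p r) v) ≠ 0 := by
  -- the two coordinates of the point, the square roots `a`, `b` of `w 1` and `- w 6`, such that
  -- `w 9 - w 3 = 2 a b` when the discriminant vanishes, and ten more coordinates of the moved form
  let w : Fin 15 → MvPolynomial (Fin 14) ℂ := ![0, X 2 ^ 2, X 5, X 4, X 6, X 7, -X 3 ^ 2, 0, X 8,
    X 4 + 2 * X 2 * X 3, X 9, X 10, X 11, X 12, X 13]
  obtain ⟨P, hP, h⟩ := exists_relation (by norm_num) (rho (shear (-X 0) (-X 1)) w)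
  refine ⟨P, hP, fun v hv p r h0 h7 hdisc => hv ?_⟩
  generalize hu : rho (shear p r) v = u at h0 h7 hdisc
  have huv : v = rho (shear (-p) (-r)) u := by
    rw [← hu, ← rho_mul, shear_mul_shear_neg, rho_one]
  obtain ⟨a, ha⟩ := IsAlgClosed.exists_pow_nat_eq (u 1) (n := 2) (by norm_num)
  obtain ⟨b, hb⟩ := IsAlgClosed.exists_pow_nat_eq (-u 6) (n := 2) (by norm_num)
  have hab : ∃ a b, a ^ 2 = u 1 ∧ b ^ 2 = -u 6 ∧ u 9 = u 3 + 2 * a * b := by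
    have hsq : (u 9 - u 3 - 2 * a * b) * (u 9 - u 3 + 2 * a * b) = 0 := by
      rw [disc] at hdisc
      linear_combination hdisc - 4 * b ^ 2 * ha - 4 * u 1 * hb
    rcases mul_eq_zero.mp hsq with h | h
    · exact ⟨a, b, ha, hb, by linear_combination h⟩
    · exact ⟨a, -b, ha, by rw [neg_sq, hb], by linear_combination h⟩
  obtain ⟨a, b, ha, hb, h9⟩ := hab
  have h1 := h ![p, r, a, b, u 3, u 2, u 4, u 5, u 8, u 10, u 11, u 12, u 13, u 14]
  rw [huv, ← h1]
  congr 2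
  funext i
  rw [map_rho]
  congr 1
  · ext i j
    fin_cases i <;> fin_cases j <;> simp [shear]
  · funext j
    fin_cases j <;> simp [w, h0, h7, ha, hb, h9]

/-- No singular point of the form has a linear part of vanishing discriminant: in each of the three
standard charts, a singular point is moved to `[1 : 0 : 0]`. -/
def NoDegenerate (v : Fin 15 → ℂ) : Prop :=
  ∀ (k : Fin 3) (p r : ℂ), rho (frame k.castSucc * shear p r) v 0 = 0 →
    rho (frame k.castSucc * shear p r) v 7 = 0 → disc (rho (frame k.castSucc * shear p r) v) ≠ 0

/-- The forms with a degenerate singular point lie on a hypersurface. -/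
theorem exists_noDegenerate : ∃ P : MvPolynomial (Fin 15) ℂ, P ≠ 0 ∧ ∀ v, eval v P ≠ 0 →
    NoDegenerate v := by
  obtain ⟨P, hP, h⟩ := exists_disc_ne_zero_of_chart
  let Q : Fin 3 → MvPolynomial (Fin 15) ℂ := fun k => aeval (rho (frame k.castSucc) X) P
  have hQ : ∀ k v, eval v (Q k) = eval (rho (frame k.castSucc) v) P := by
    intro k v
    have e : (aeval v : MvPolynomial (Fin 15) ℂ →ₐ[ℂ] ℂ).comp (aeval (rho (frame k.castSucc) X))
        = aeval (rho (frame k.castSucc) v) := by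
      refine algHom_ext fun i => ?_
      rw [AlgHom.comp_apply, aeval_X, aeval_X]
      refine (map_rho (aeval v : MvPolynomial (Fin 15) ℂ →ₐ[ℂ] ℂ).toRingHom _ _ i).trans ?_
      congr 1
      · ext i j
        fin_cases k <;> fin_cases i <;> fin_cases j <;> simp [frame]
      · funext j
        simp
    exact DFunLike.congr_fun e P
  refine ⟨∏ k, Q k, Finset.prod_ne_zero_iff.mpr fun k _ h0 => hP ?_, fun v hv k p r h0 h7 => ?_⟩
  · refine MvPolynomial.funext fun x => ?_
    have h1 := congrArg (eval (rho (frame k.castSucc)⁻¹ x)) h0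
    rwa [hQ, ← rho_mul, Matrix.nonsing_inv_mul _ (isUnit_iff_ne_zero.mpr (det_frame_ne_zero _)),
      rho_one] at h1
  · rw [map_prod] at hv
    have h1 := Finset.prod_ne_zero_iff.mp hv k (Finset.mem_univ _)
    rw [hQ] at h1
    rw [rho_mul] at h0 h7 ⊢
    exact h _ h1 p r h0 h7

theorem continuous_shear : Continuous fun x : ℂ × ℂ => shear x.1 x.2 := by
  refine continuous_matrix fun i j => ?_
  fin_cases i <;> fin_cases j <;> simp [shear] <;> fun_prop

theorem continuous_dt : Continuous (dt : (Fin 15 → ℂ) → ℂ) := by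
  unfold dt
  fun_prop

theorem continuous_disc : Continuous (disc : (Fin 15 → ℂ) → ℂ) := by
  unfold disc
  fun_prop

/-- The linear part at a singular point `[1 : 0 : 0]` is conjugated and rescaled by a change of
coordinates which fixes this point. -/
theorem rho_of_fixed {h : Matrix (Fin 3) (Fin 3) ℂ} (h1 : h 1 0 = 0) (h2 : h 2 0 = 0)
    {w : Fin 15 → ℂ} (w0 : w 0 = 0) (w7 : w 7 = 0) :
    rho h w 0 = 0 ∧ rho h w 7 = 0 ∧ dt (rho h w) = (h 0 0 * h.det) ^ 2 * dt w ∧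
      disc (rho h w) = (h 0 0 * h.det) ^ 2 * disc w := by
  obtain ⟨a, b, c, d, e, f, g, rfl⟩ : ∃ a b c d e f g, h = !![a, b, c; 0, d, e; 0, f, g] :=
    ⟨h 0 0, h 0 1, h 0 2, h 1 1, h 1 2, h 2 1, h 2 2, by
      ext i j
      fin_cases i <;> fin_cases j <;> simp [h1, h2]⟩
  refine ⟨?_, ?_, ?_, ?_⟩ <;>
  · simp only [dt, disc, rho, act, kappa_apply, Fin.sum_univ_three, can_apply,
      Matrix.adjugate_fin_three_of, Matrix.cons_val, Matrix.of_apply, w0, w7, Matrix.det_fin_three]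
    ring

section Persistence

attribute [local irreducible] rho

/-- On each of the three charts the singular points with bounded coordinates form a compact set. -/
theorem NoDegenerate.exists_bound {v : Fin 15 → ℂ} (hv : NoDegenerate v) :
    ∃ δ : ℝ, 0 < δ ∧ ∀ (k : Fin 3) (p r : ℂ), ‖p‖ ≤ 1 → ‖r‖ ≤ 1 →
      rho (frame k.castSucc * shear p r) v 0 = 0 → rho (frame k.castSucc * shear p r) v 7 = 0 →
      δ * ‖dt (rho (frame k.castSucc * shear p r) v)‖ ≤
        ‖disc (rho (frame k.castSucc * shear p r) v)‖ := by
  have key : ∀ k : Fin 3, ∃ δ : ℝ, 0 < δ ∧ ∀ p r : ℂ, ‖p‖ ≤ 1 → ‖r‖ ≤ 1 →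
      rho (frame k.castSucc * shear p r) v 0 = 0 → rho (frame k.castSucc * shear p r) v 7 = 0 →
      δ * ‖dt (rho (frame k.castSucc * shear p r) v)‖ ≤
        ‖disc (rho (frame k.castSucc * shear p r) v)‖ := by
    intro k
    let φ : ℂ × ℂ → Fin 15 → ℂ := fun x => rho (frame k.castSucc * shear x.1 x.2) v
    have hφ : Continuous φ := continuous_rho.comp
      ((continuous_const.matrix_mul continuous_shear).prodMk continuous_const)
    let K : Set (ℂ × ℂ) := Metric.closedBall 0 1 ∩ {x | φ x 0 = 0 ∧ φ x 7 = 0}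
    have hK : IsCompact K := (isCompact_closedBall _ _).inter_right
      ((isClosed_eq ((continuous_apply 0).comp hφ) continuous_const).inter
        (isClosed_eq ((continuous_apply 7).comp hφ) continuous_const))
    have hmem : ∀ p r : ℂ, ‖p‖ ≤ 1 → ‖r‖ ≤ 1 → φ (p, r) 0 = 0 → φ (p, r) 7 = 0 → (p, r) ∈ K :=
      fun p r hp hr h0 h7 => ⟨by simp [Prod.norm_def, hp, hr], h0, h7⟩
    rcases K.eq_empty_or_nonempty with hE | hE
    · refine ⟨1, one_pos, fun p r hp hr h0 h7 => ?_⟩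
      have := hmem p r hp hr h0 h7
      rw [hE] at this
      exact this.elim
    have hc : ContinuousOn (fun x => ‖dt (φ x)‖ / ‖disc (φ x)‖) K := by
      refine ((continuous_dt.comp hφ).norm.continuousOn).div
        ((continuous_disc.comp hφ).norm.continuousOn) fun x hx => ?_
      exact norm_ne_zero_iff.mpr (hv k x.1 x.2 hx.2.1 hx.2.2)
    obtain ⟨M, hM⟩ := hK.bddAbove_image hc
    have hM0 : 0 ≤ M := by
      obtain ⟨x, hx⟩ := hE
      exact le_trans (by positivity) (hM ⟨x, hx, rfl⟩)
    refine ⟨(M + 1)⁻¹, by positivity, fun p r hp hr h0 h7 => ?_⟩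
    have h1 : ‖dt (φ (p, r))‖ / ‖disc (φ (p, r))‖ ≤ M := hM ⟨_, hmem p r hp hr h0 h7, rfl⟩
    have h2 : 0 < ‖disc (φ (p, r))‖ := norm_pos_iff.mpr (hv k p r h0 h7)
    rw [div_le_iff₀ h2] at h1
    rw [inv_mul_le_iff₀ (by positivity)]
    change ‖dt (φ (p, r))‖ ≤ (M + 1) * ‖disc (φ (p, r))‖
    linarith
  choose δ hδ h using key
  refine ⟨min (δ 0) (min (δ 1) (δ 2)), by simp [hδ], fun k p r hp hr h0 h7 => ?_⟩
  refine le_trans (mul_le_mul_of_nonneg_right ?_ (norm_nonneg _)) (h k p r hp hr h0 h7)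
  fin_cases k <;> simp

/-- Every non-zero vector is a multiple of one with entries of absolute value at most `1` and some
entry equal to `1`. -/
theorem exists_eq_smul_frame_col {x : Fin 3 → ℂ} (hx : x ≠ 0) : ∃ (k : Fin 3) (p r c : ℂ), ‖p‖ ≤ 1 ∧
    ‖r‖ ≤ 1 ∧ c ≠ 0 ∧ x = c • (frame k.castSucc * shear p r).col 0 := by
  obtain ⟨i, -, hi⟩ := Finset.exists_max_image Finset.univ (fun i => ‖x i‖) Finset.univ_nonempty
  have hi0 : x i ≠ 0 := by
    intro h0
    apply hx
    funext j
    have := hi j (Finset.mem_univ _)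
    rw [h0, norm_zero] at this
    exact norm_le_zero_iff.mp this
  have hle : ∀ j, ‖x j / x i‖ ≤ 1 := fun j => by
    rw [norm_div]
    exact div_le_one_of_le₀ (hi j (Finset.mem_univ _)) (norm_nonneg _)
  have hmul : ∀ j, x j = x i * (x j / x i) := fun j => by field_simp
  fin_cases i
  · refine ⟨0, _, _, _, hle 1, hle 2, hi0, ?_⟩
    funext j
    fin_cases j <;> simp [frame, shear, Matrix.col] <;>
      exact hmul _
  · refine ⟨1, _, _, _, hle 2, hle 0, hi0, ?_⟩
    funext j
    fin_cases j <;> simp [frame, shear, Matrix.col] <;>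
      exact hmul _
  · refine ⟨2, _, _, _, hle 0, hle 1, hi0, ?_⟩
    funext j
    fin_cases j <;> simp [frame, shear, Matrix.col] <;>
      exact hmul _

/-- The ratio of the discriminant and the determinant at the singular points is bounded below on
the whole orbit, since it is invariant. -/
theorem NoDegenerate.exists_bound_orbit {v : Fin 15 → ℂ} (hv : NoDegenerate v) :
    ∃ δ : ℝ, 0 < δ ∧ ∀ u, Equivalent v u → u 0 = 0 → u 7 = 0 → δ * ‖dt u‖ ≤ ‖disc u‖ := by
  obtain ⟨δ, hδ, h⟩ := hv.exists_bound
  refine ⟨δ, hδ, ?_⟩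
  rintro _ ⟨g, c, hg, hc, rfl⟩ h0 h7
  have h0' : rho g v 0 = 0 := (mul_eq_zero.mp h0).resolve_left hc
  have h7' : rho g v 7 = 0 := (mul_eq_zero.mp h7).resolve_left hc
  have hdt : dt (c • rho g v) = c ^ 2 * dt (rho g v) := by
    simp only [dt, Pi.smul_apply, smul_eq_mul]
    ring
  have hdisc : disc (c • rho g v) = c ^ 2 * disc (rho g v) := by
    simp only [disc, Pi.smul_apply, smul_eq_mul]
    ring
  have hx : g.col 0 ≠ 0 := by
    intro h0
    apply hg
    exact Matrix.det_eq_zero_of_column_eq_zero 0 fun i => congrFun h0 i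
  obtain ⟨k, p, r, d, hp, hr, hd, hcol⟩ := exists_eq_smul_frame_col hx
  let s := frame k.castSucc * shear p r
  have hu : IsUnit g.det := isUnit_iff_ne_zero.mpr hg
  let b := g⁻¹ * s
  have hb : g * b = s := by
    rw [← mul_assoc, Matrix.mul_nonsing_inv _ hu, one_mul]
  have hbdet : b.det ≠ 0 := by
    intro h0
    have h1 := congrArg Matrix.det hb
    rw [Matrix.det_mul, h0, mul_zero, Matrix.det_mul, det_shear, mul_one] at h1
    exact det_frame_ne_zero _ h1.symm
  -- the matrix `b` fixes the point `[1 : 0 : 0]`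
  have hbcol : ∀ i, b i 0 = d⁻¹ * (1 : Matrix (Fin 3) (Fin 3) ℂ) i 0 := by
    intro i
    have h1 : ∀ j, s j 0 = d⁻¹ * g j 0 := by
      intro j
      have := congrFun hcol j
      change g j 0 = d * s j 0 at this
      rw [this, inv_mul_cancel_left₀ hd]
    rw [← Matrix.nonsing_inv_mul _ hu]
    change (g⁻¹ * s) i 0 = _
    rw [Matrix.mul_apply, Matrix.mul_apply, Finset.mul_sum]
    refine Finset.sum_congr rfl fun j _ => ?_
    rw [h1]
    ring
  obtain ⟨e0, e7, edt, edisc⟩ := rho_of_fixed (h := b) (by simp [hbcol]) (by simp [hbcol]) h0' h7'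
  rw [← rho_mul, hb] at e0 e7 edt edisc
  have h1 := h k p r hp hr e0 e7
  change δ * ‖dt (rho s v)‖ ≤ ‖disc (rho s v)‖ at h1
  have hpos : 0 < ‖(b 0 0 * b.det) ^ 2‖ := by
    rw [norm_pos_iff, hbcol]
    simp [hd, hbdet]
  rw [edt, edisc, norm_mul, norm_mul, mul_left_comm, mul_le_mul_iff_right₀ hpos] at h1
  rw [hdt, hdisc, norm_mul, norm_mul, mul_left_comm]
  exact mul_le_mul_of_nonneg_left h1 (norm_nonneg _)

open Topology in
/-- A nondegenerate singular point persists under small perturbations of the form. -/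
theorem eventually_exists_singular {u : Fin 15 → ℂ} (h0 : u 0 = 0) (h7 : u 7 = 0) (hd : dt u ≠ 0)
    {s : (Fin 15 → ℂ) → Prop} (hs : ∀ᶠ w in 𝓝 u, s w) :
    ∀ᶠ w in 𝓝 u, ∃ p r, s (rho (shear p r) w) ∧ rho (shear p r) w 0 = 0 ∧
      rho (shear p r) w 7 = 0 := by
  let z : Fin 15 ⊕ Fin 2 → ℂ := Sum.elim u 0
  let W : Fin 15 → MvPolynomial (Fin 15 ⊕ Fin 2) ℂ :=
    rho (shear (X (Sum.inr 0)) (X (Sum.inr 1))) fun i => X (Sum.inl i)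
  let f : Fin 15 ⊕ Fin 2 → MvPolynomial (Fin 15 ⊕ Fin 2) ℂ :=
    Sum.elim (fun i => X (Sum.inl i)) ![W 0, W 7]
  have hW : ∀ x i, eval x (W i) =
      rho (shear (x (Sum.inr 0)) (x (Sum.inr 1))) (fun i => x (Sum.inl i)) i := by
    intro x i
    rw [map_rho]
    congr 1
    · ext a b
      fin_cases a <;> fin_cases b <;> simp [shear]
    · funext j
      simp
  have hmap := map_nhds_eval f z fun x hx => by
    have hx1 : ∀ i, x (Sum.inl i) = 0 := fun i => by
      have := hx (Sum.inl i)
      simpa [f] using this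
    have hx2 : ∀ i, i = 0 ∨ i = 7 →
        kappa (lie !![0, 0, 0; x (Sum.inr 0), 0, 0; x (Sum.inr 1), 0, 0] (can u)) i = 0 := by
      intro i hi
      have h1 : (aeval (fun j => TrivSqZeroExt.inl (z j) + TrivSqZeroExt.inr (x j)) (W i) :
          DualNumber ℂ).snd = 0 := by
        rcases hi with rfl | rfl
        · exact hx (Sum.inr 0)
        · exact hx (Sum.inr 1)
      rw [← add_zero (kappa _ i), ← Pi.zero_apply (ι := Fin 15) (M := fun _ => ℂ) i, ← snd_rho]
      refine Eq.trans (congrArg TrivSqZeroExt.snd (Eq.symm ?_)) h1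
      refine (map_rho (aeval fun j => TrivSqZeroExt.inl (z j) + TrivSqZeroExt.inr (x j) :
        MvPolynomial (Fin 15 ⊕ Fin 2) ℂ →ₐ[ℂ] DualNumber ℂ).toRingHom _ _ i).trans ?_
      congr 1
      · ext a b <;> fin_cases a <;> fin_cases b <;> simp [shear, z]
      · funext k
        simp [z, hx1]
    have e0 := hx2 0 (Or.inl rfl)
    have e7 := hx2 7 (Or.inr rfl)
    simp [kappa_lie, h0, h7] at e0 e7
    rw [dt] at hd
    have y0 : x (Sum.inr 0) = 0 := by
      apply (mul_eq_zero.mp _).resolve_left hd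
      linear_combination u 3 * e7 - u 6 * e0
    have y1 : x (Sum.inr 1) = 0 := by
      apply (mul_eq_zero.mp _).resolve_left hd
      linear_combination u 9 * e0 - u 1 * e7
    funext i
    rcases i with i | i
    · exact hx1 i
    · fin_cases i
      · exact y0
      · exact y1
  have hz : (fun i => eval z (f i)) = z := by
    funext i
    rcases i with i | i
    · simp [f]
    · have e : (shear (z (Sum.inr 0)) (z (Sum.inr 1))) = 1 := by
        ext a b
        fin_cases a <;> fin_cases b <;> simp [shear, z]
      fin_cases i
      · change eval z (W 0) = 0
        rw [hW, e, rho_one]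
        exact h0
      · change eval z (W 7) = 0
        rw [hW, e, rho_one]
        exact h7
  rw [hz] at hmap
  have hcont : Continuous fun x : Fin 15 ⊕ Fin 2 → ℂ =>
      rho (shear (x (Sum.inr 0)) (x (Sum.inr 1))) fun i => x (Sum.inl i) := by
    refine continuous_rho.comp (Continuous.prodMk ?_ (by fun_prop))
    exact continuous_shear.comp (by fun_prop : Continuous fun x : Fin 15 ⊕ Fin 2 → ℂ =>
      (x (Sum.inr 0), x (Sum.inr 1)))
  have hs' : ∀ᶠ x in 𝓝 z,
      s (rho (shear (x (Sum.inr 0)) (x (Sum.inr 1))) fun i => x (Sum.inl i)) := by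
    refine hcont.continuousAt.eventually ?_
    convert hs using 2
    have e : (shear (z (Sum.inr 0)) (z (Sum.inr 1))) = 1 := by
      ext a b
      fin_cases a <;> fin_cases b <;> simp [shear, z]
    change rho (shear (z (Sum.inr 0)) (z (Sum.inr 1))) u = u
    rw [e, rho_one]
  have h1 := Filter.image_mem_map (m := fun x i => eval x (f i)) hs'
  rw [hmap] at h1
  have hι : Continuous fun w : Fin 15 → ℂ => (Sum.elim w 0 : Fin 15 ⊕ Fin 2 → ℂ) := by
    refine continuous_pi fun i => ?_
    rcases i with i | i
    · exact continuous_apply i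
    · exact continuous_const
  filter_upwards [hι.continuousAt.eventually_mem (x := u) h1] with w hw
  obtain ⟨x, hx, hxw⟩ := hw
  have hx1 : (fun i => x (Sum.inl i)) = w := by
    funext i
    have := congrFun hxw (Sum.inl i)
    simpa [f] using this
  have hx2 := congrFun hxw (Sum.inr 0)
  have hx3 := congrFun hxw (Sum.inr 1)
  change eval x (W 0) = 0 at hx2
  change eval x (W 7) = 0 at hx3
  rw [hW, hx1] at hx2 hx3
  rw [Set.mem_ofPred, hx1] at hx
  exact ⟨_, _, hx, hx2, hx3⟩

/-- No degeneration of a form without degenerate singular points has a nondegenerate singular point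
of vanishing discriminant. -/
theorem NoDegenerate.disc_ne_zero {v u : Fin 15 → ℂ} (hv : NoDegenerate v)
    (hu : u ∈ closure {u | Equivalent v u}) (h0 : u 0 = 0) (h7 : u 7 = 0) (hd : dt u ≠ 0) :
    disc u ≠ 0 := by
  intro hdisc
  obtain ⟨δ, hδ, h⟩ := hv.exists_bound_orbit
  have hs : ∀ᶠ w in nhds u, ‖disc w‖ < δ * ‖dt w‖ := by
    refine continuous_disc.norm.continuousAt.eventually_lt
      (continuous_const.mul continuous_dt.norm).continuousAt ?_
    rw [hdisc, norm_zero]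
    exact mul_pos hδ (norm_pos_iff.mpr hd)
  obtain ⟨w, hw, p, r, h1, h2, h3⟩ :=
    ((mem_closure_iff_frequently.mp hu).and_eventually
      (eventually_exists_singular h0 h7 hd hs)).exists
  refine absurd (h _ (Equivalent.trans hw (equivalent_rho ?_ w)) h2 h3) (not_le.mpr h1)
  rw [det_shear]
  exact one_ne_zero

end Persistence

/-! ### Normal forms of infinitesimal symmetries -/

/-- The second coefficient of the characteristic polynomial. -/
def minorSum {R : Type*} [CommRing R] (A : Matrix (Fin 3) (Fin 3) R) : R :=
  A 0 0 * A 1 1 - A 0 1 * A 1 0 + (A 0 0 * A 2 2 - A 0 2 * A 2 0) +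
    (A 1 1 * A 2 2 - A 1 2 * A 2 1)

theorem adjugate_eq (A : Matrix (Fin 3) (Fin 3) ℂ) :
    A.adjugate = A * A - A.trace • A + minorSum A • 1 := by
  rw [Matrix.adjugate_fin_three]
  ext i j
  fin_cases i <;> fin_cases j <;>
  · simp [Matrix.mul_apply, Fin.sum_univ_three, Matrix.trace_fin_three, minorSum]
    ring

/-- A pencil of matrices contains one whose trace-free part has a multiple eigenvalue. -/
theorem exists_discriminant_eq_zero (A B : Matrix (Fin 3) (Fin 3) ℂ) : ∃ s t : ℂ,
    (s ≠ 0 ∨ t ≠ 0) ∧ 4 * minorSum (s • A + t • B) ^ 3 + 27 * (s • A + t • B).det ^ 2 = 0 := by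
  let M : Matrix (Fin 3) (Fin 3) (MvPolynomial (Fin 3) ℂ) := fun i j =>
    C (A i j) * X 0 + C (B i j) * X 1
  have hM : ∀ i j, (M i j).IsHomogeneous 1 := fun i j =>
    ((isHomogeneous_X ℂ 0).C_mul _).add ((isHomogeneous_X ℂ 1).C_mul _)
  have h2 : ∀ i j k l, (M i j * M k l).IsHomogeneous 2 := fun i j k l => (hM i j).mul (hM k l)
  have h3 : ∀ i j k l a b, (M i j * M k l * M a b).IsHomogeneous 3 := fun i j k l a b =>
    (h2 i j k l).mul (hM a b)
  have hp : (minorSum M).IsHomogeneous 2 := by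
    unfold minorSum
    exact (((h2 _ _ _ _).sub (h2 _ _ _ _)).add ((h2 _ _ _ _).sub (h2 _ _ _ _))).add
      ((h2 _ _ _ _).sub (h2 _ _ _ _))
  have hq : M.det.IsHomogeneous 3 := by
    rw [Matrix.det_fin_three]
    exact (((((h3 _ _ _ _ _ _).sub (h3 _ _ _ _ _ _)).sub (h3 _ _ _ _ _ _)).add
      (h3 _ _ _ _ _ _)).add (h3 _ _ _ _ _ _)).sub (h3 _ _ _ _ _ _)
  have hP : (C 4 * minorSum M ^ 3 + C 27 * M.det ^ 2).IsHomogeneous (2 * 3) :=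
    ((hp.pow 3).C_mul 4).add ((hq.pow 2).C_mul 27)
  obtain ⟨s, t, hst, h⟩ := exists_eval_eq_zero (by norm_num) hP ![1, 0, 0] ![0, 1, 0]
  have he : ∀ i j, eval (s • ![1, 0, 0] + t • ![0, 1, 0]) (M i j) = (s • A + t • B) i j := by
    intro i j
    simp [M, mul_comm]
  refine ⟨s, t, hst, ?_⟩
  rw [← h, map_add, map_mul, map_mul, map_pow, map_pow, eval_C, eval_C, minorSum, minorSum,
    Matrix.det_fin_three, Matrix.det_fin_three]
  simp only [map_add, map_sub, map_mul, he]

/-- A trace-free matrix of vanishing discriminant becomes, after subtracting a multiple eigenvalue,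
a matrix whose characteristic polynomial has a double root at zero. -/
theorem exists_sub_smul_one {A : Matrix (Fin 3) (Fin 3) ℂ} (htr : A.trace = 0)
    (h : 4 * minorSum A ^ 3 + 27 * A.det ^ 2 = 0) :
    ∃ c : ℂ, minorSum (A - c • 1) = 0 ∧ (A - c • 1).det = 0 := by
  have h1 : ∀ c : ℂ, minorSum (A - c • 1) = minorSum A + 3 * c ^ 2 := by
    intro c
    rw [Matrix.trace_fin_three] at htr
    simp [minorSum]
    linear_combination -2 * c * htr
  have h2 : ∀ c : ℂ, (A - c • 1).det = A.det - c * minorSum A - c ^ 3 := by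
    intro c
    rw [Matrix.trace_fin_three] at htr
    simp [minorSum, Matrix.det_fin_three]
    linear_combination c ^ 2 * htr
  simp only [h1, h2]
  generalize minorSum A = p at h
  generalize A.det = q at h
  rcases eq_or_ne p 0 with rfl | hp
  · refine ⟨0, by ring, ?_⟩
    have : q = 0 := by simpa using h
    rw [this]
    ring
  · have hc : 2 * p * (3 * q / (2 * p)) = 3 * q := by field_simp
    generalize 3 * q / (2 * p) = c at hc
    have hc2 : p + 3 * c ^ 2 = 0 := by
      have h4 : 4 * p ^ 2 * (p + 3 * c ^ 2) = 0 := by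
        linear_combination h + 3 * (2 * p * c + 3 * q) * hc
      exact (mul_eq_zero.mp h4).resolve_left (by simpa using hp)
    exact ⟨c, hc2, by linear_combination -(1 / 3 : ℂ) * hc - (1 / 3 : ℂ) * c * hc2⟩

/-- The matrix with given columns. -/
def ofCols (v : Fin 3 → Fin 3 → ℂ) : Matrix (Fin 3) (Fin 3) ℂ := fun i j => v j i

theorem det_ofCols_ne_zero {v : Fin 3 → Fin 3 → ℂ}
    (h : ∀ a b c : ℂ, a • v 0 + b • v 1 + c • v 2 = 0 → a = 0 ∧ b = 0 ∧ c = 0) :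
    (ofCols v).det ≠ 0 := by
  intro h0
  obtain ⟨x, hx, hx0⟩ := Matrix.exists_mulVec_eq_zero_iff.mpr h0
  obtain ⟨h1, h2, h3⟩ := h (x 0) (x 1) (x 2) (by
    rw [← hx0]
    funext i
    simp [Matrix.mulVec, dotProduct, Fin.sum_univ_three, ofCols, mul_comm])
  apply hx
  funext i
  fin_cases i <;> assumption

theorem mul_ofCols {A B : Matrix (Fin 3) (Fin 3) ℂ} {v : Fin 3 → Fin 3 → ℂ}
    (h : ∀ j, A.mulVec (v j) = B 0 j • v 0 + B 1 j • v 1 + B 2 j • v 2) :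
    ofCols v * B = A * ofCols v := by
  ext i j
  have := congrFun (h j) i
  simp only [Matrix.mulVec, dotProduct, Pi.add_apply, Pi.smul_apply, smul_eq_mul] at this
  rw [Matrix.mul_apply, Matrix.mul_apply, Fin.sum_univ_three]
  simp only [ofCols, this]
  ring

theorem exists_mem_notMem_span {S : Submodule ℂ (Fin 3 → ℂ)} (hS : 2 ≤ Module.finrank ℂ S)
    (z : Fin 3 → ℂ) : ∃ v ∈ S, ∀ a : ℂ, v ≠ a • z := by
  by_contra! h
  have hle : S ≤ Submodule.span ℂ {z} := fun v hv => by
    obtain ⟨a, ha⟩ := h v hv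
    exact Submodule.mem_span_singleton.mpr ⟨a, ha.symm⟩
  have h1 := Submodule.finrank_mono hle
  have h2 := finrank_span_le_card (R := ℂ) ({z} : Set (Fin 3 → ℂ))
  simp at h2
  omega

theorem exists_mulVec_ne_zero {A : Matrix (Fin 3) (Fin 3) ℂ} (hA : A ≠ 0) :
    ∃ v, A.mulVec v ≠ 0 := by
  by_contra! h
  apply hA
  ext i j
  have := congrFun (h (Pi.single j 1)) i
  simpa using this

/-- A non-zero matrix of square zero is conjugate to the matrix unit `single 2 0 1`. -/
theorem exists_conj_of_sq_eq_zero {A : Matrix (Fin 3) (Fin 3) ℂ} (hA : A ≠ 0) (h : A * A = 0) :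
    ∃ g : Matrix (Fin 3) (Fin 3) ℂ, g.det ≠ 0 ∧ g * Matrix.single 2 0 1 = A * g := by
  have hAA : ∀ v, A.mulVec (A.mulVec v) = 0 := fun v => by
    rw [Matrix.mulVec_mulVec, h, Matrix.zero_mulVec]
  obtain ⟨v, hv⟩ := exists_mulVec_ne_zero hA
  have hker : 2 ≤ Module.finrank ℂ (LinearMap.ker A.mulVecLin) := by
    have h1 := LinearMap.finrank_range_add_finrank_ker A.mulVecLin
    have h2 : LinearMap.range A.mulVecLin ≤ LinearMap.ker A.mulVecLin := by
      rintro _ ⟨x, rfl⟩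
      exact hAA x
    have h3 := Submodule.finrank_mono h2
    simp at h1
    omega
  obtain ⟨v', hv', hne⟩ := exists_mem_notMem_span hker (A.mulVec v)
  replace hv' : A.mulVec v' = 0 := hv'
  refine ⟨ofCols ![v, v', A.mulVec v], det_ofCols_ne_zero fun a b c habc => ?_,
    mul_ofCols fun j => ?_⟩
  · simp only [Matrix.cons_val] at habc
    have h1 := congrArg A.mulVec habc
    simp only [Matrix.mulVec_add, Matrix.mulVec_smul, hv', hAA, smul_zero, add_zero,
      Matrix.mulVec_zero, smul_eq_zero, hv, or_false] at h1
    subst h1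
    rw [zero_smul, zero_add] at habc
    have hb : b = 0 := by
      by_contra hb
      apply hne (-c / b)
      have : b • v' = -c • A.mulVec v := by
        rw [neg_smul]
        exact eq_neg_of_add_eq_zero_left habc
      rw [div_eq_inv_mul, mul_smul, ← this, inv_smul_smul₀ hb]
    subst hb
    rw [zero_smul, zero_add, smul_eq_zero] at habc
    exact ⟨rfl, rfl, habc.resolve_right hv⟩
  · fin_cases j <;> simp [hv', hAA]

/-- A regular nilpotent matrix is conjugate to its Jordan block. -/
theorem exists_conj_of_cube_eq_zero {A : Matrix (Fin 3) (Fin 3) ℂ} (hA : A * A ≠ 0)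
    (h : A * (A * A) = 0) : ∃ g : Matrix (Fin 3) (Fin 3) ℂ, g.det ≠ 0 ∧
      g * (Matrix.single 1 0 1 + Matrix.single 2 1 1) = A * g := by
  obtain ⟨v, hv⟩ := exists_mulVec_ne_zero hA
  rw [← Matrix.mulVec_mulVec] at hv
  have hAAA : A.mulVec (A.mulVec (A.mulVec v)) = 0 := by
    rw [Matrix.mulVec_mulVec, Matrix.mulVec_mulVec, mul_assoc, h, Matrix.zero_mulVec]
  refine ⟨ofCols ![v, A.mulVec v, A.mulVec (A.mulVec v)],
    det_ofCols_ne_zero fun a b c habc => ?_, mul_ofCols fun j => ?_⟩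
  · simp only [Matrix.cons_val] at habc
    have h1 := congrArg (fun x => A.mulVec (A.mulVec x)) habc
    simp only [Matrix.mulVec_add, Matrix.mulVec_smul, hAAA, smul_zero, add_zero,
      Matrix.mulVec_zero, smul_eq_zero, hv, or_false] at h1
    subst h1
    have h2 := congrArg A.mulVec habc
    simp only [Matrix.mulVec_add, Matrix.mulVec_smul, hAAA, smul_zero, add_zero, zero_add,
      zero_smul, Matrix.mulVec_zero, smul_eq_zero, hv, or_false] at h2
    subst h2
    simp only [zero_smul, zero_add, smul_eq_zero, hv, or_false] at habc
    exact ⟨rfl, rfl, habc⟩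
  · fin_cases j <;> simp [h, Matrix.single]

/-- A matrix with characteristic polynomial `X² (X - m)`, `m ≠ 0`, which is not diagonalizable. -/
theorem exists_conj_of_jordan {A : Matrix (Fin 3) (Fin 3) ℂ} {m : ℂ} (hm : m ≠ 0)
    (hA : A * A - m • A ≠ 0) (hA2 : A * A ≠ 0) (h : A * (A * A - m • A) = 0) :
    ∃ g : Matrix (Fin 3) (Fin 3) ℂ, g.det ≠ 0 ∧
      g * (Matrix.single 2 0 1 + Matrix.single 1 1 m) = A * g := by
  obtain ⟨x, hx⟩ := exists_mulVec_ne_zero hA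
  obtain ⟨y, hy⟩ := exists_mulVec_ne_zero hA2
  rw [Matrix.sub_mulVec, ← Matrix.mulVec_mulVec, Matrix.smul_mulVec] at hx
  rw [← Matrix.mulVec_mulVec] at hy
  have hA3 : ∀ z, A.mulVec (A.mulVec (A.mulVec z)) = m • A.mulVec (A.mulVec z) := fun z => by
    have := congrArg (Matrix.mulVec · z) h
    simp only [Matrix.zero_mulVec, ← Matrix.mulVec_mulVec, Matrix.sub_mulVec, Matrix.smul_mulVec,
      Matrix.mulVec_sub, Matrix.mulVec_smul] at this
    exact sub_eq_zero.mp this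
  have h0 : A.mulVec (A.mulVec x - m • x) = A.mulVec (A.mulVec x) - m • A.mulVec x := by
    rw [Matrix.mulVec_sub, Matrix.mulVec_smul]
  have h2 : A.mulVec (A.mulVec (A.mulVec x) - m • A.mulVec x) = 0 := by
    rw [Matrix.mulVec_sub, Matrix.mulVec_smul, hA3, sub_self]
  have h1 := hA3 y
  generalize A.mulVec (A.mulVec x) - m • A.mulVec x = v2 at *
  generalize A.mulVec x - m • x = v0 at *
  generalize A.mulVec (A.mulVec y) = v1 at *
  refine ⟨ofCols ![v0, v1, v2], det_ofCols_ne_zero fun a b c habc => ?_, mul_ofCols fun j => ?_⟩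
  · simp only [Matrix.cons_val] at habc
    have e1 := congrArg (fun x => A.mulVec (A.mulVec x)) habc
    simp only [Matrix.mulVec_add, Matrix.mulVec_smul, h0, h1, h2, smul_zero, add_zero, zero_add,
      Matrix.mulVec_zero, smul_eq_zero, hy, hm, or_false] at e1
    subst e1
    have e2 := congrArg A.mulVec habc
    simp only [Matrix.mulVec_add, Matrix.mulVec_smul, h0, h2, smul_zero, add_zero,
      zero_smul, Matrix.mulVec_zero, smul_eq_zero, hx, or_false] at e2
    subst e2
    simp only [zero_smul, zero_add, smul_eq_zero, hx, or_false] at habc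
    exact ⟨rfl, rfl, habc⟩
  · fin_cases j <;> simp [h0, h1, h2, Matrix.single]

/-- A multiple of a projector of rank one. -/
theorem exists_conj_of_projector {A : Matrix (Fin 3) (Fin 3) ℂ} (htr : A.trace ≠ 0)
    (h : A * A - A.trace • A = 0) : ∃ g : Matrix (Fin 3) (Fin 3) ℂ, g.det ≠ 0 ∧
      g * Matrix.single 2 2 A.trace = A * g := by
  generalize hm : A.trace = m at *
  have hAA : ∀ v, A.mulVec (A.mulVec v) = m • A.mulVec v := fun v => by
    rw [Matrix.mulVec_mulVec, sub_eq_zero.mp h, Matrix.smul_mulVec]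
  have hA : A ≠ 0 := by
    rintro rfl
    apply htr
    rw [← hm, Matrix.trace_zero]
  obtain ⟨y, hy⟩ := exists_mulVec_ne_zero hA
  have hker : 2 ≤ Module.finrank ℂ (LinearMap.ker A.mulVecLin) := by
    have h1 := LinearMap.finrank_range_add_finrank_ker A.mulVecLin
    have hproj : LinearMap.IsProj (LinearMap.range A.mulVecLin) (m⁻¹ • A.mulVecLin) := by
      refine ⟨fun x => Submodule.smul_mem _ _ ⟨x, rfl⟩, ?_⟩
      rintro _ ⟨x, rfl⟩
      change m⁻¹ • A.mulVec (A.mulVec x) = A.mulVec x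
      rw [hAA, inv_smul_smul₀ htr]
    have h2 := hproj.trace
    have h3 : LinearMap.trace ℂ (Fin 3 → ℂ) A.mulVecLin = m := by
      rw [← Matrix.toLin'_apply', Matrix.trace_toLin'_eq, hm]
    rw [map_smul, h3, smul_eq_mul, inv_mul_cancel₀ htr] at h2
    have h4 : Module.finrank ℂ (LinearMap.range A.mulVecLin) = 1 := by exact_mod_cast h2.symm
    simp at h1
    omega
  obtain ⟨v0, hv0, hne0⟩ := exists_mem_notMem_span hker 0
  obtain ⟨v1, hv1, hne1⟩ := exists_mem_notMem_span hker v0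
  replace hv0 : A.mulVec v0 = 0 := hv0
  replace hv1 : A.mulVec v1 = 0 := hv1
  have hv00 : v0 ≠ 0 := by simpa using hne0 0
  refine ⟨ofCols ![v0, v1, A.mulVec y], det_ofCols_ne_zero fun a b c habc => ?_,
    mul_ofCols fun j => ?_⟩
  · simp only [Matrix.cons_val] at habc
    have e1 := congrArg A.mulVec habc
    simp only [Matrix.mulVec_add, Matrix.mulVec_smul, hv0, hv1, hAA, smul_zero, zero_add,
      Matrix.mulVec_zero, smul_eq_zero, hy, htr, or_false] at e1
    subst e1
    rw [zero_smul, add_zero] at habc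
    have hb : b = 0 := by
      by_contra hb
      apply hne1 (-a / b)
      have : b • v1 = -a • v0 := by
        rw [neg_smul]
        exact eq_neg_of_add_eq_zero_right habc
      rw [div_eq_inv_mul, mul_smul, ← this, inv_smul_smul₀ hb]
    subst hb
    rw [zero_smul, add_zero, smul_eq_zero] at habc
    exact ⟨habc.resolve_right hv00, rfl, rfl⟩
  · fin_cases j <;> simp [hv0, hv1, hAA, Matrix.single]

/-! ### Foliations with a two-dimensional group of symmetries -/

theorem mem_stab_rho {g A B : Matrix (Fin 3) (Fin 3) ℂ} (hg : g.det ≠ 0) (h : g * B = A * g)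
    {w : Fin 15 → ℂ} (hA : A ∈ stab w) : B ∈ stab (rho g w) := by
  obtain ⟨c, hc⟩ := mem_stab.mp hA
  exact mem_stab.mpr ⟨c, by rw [kappa_lie_rho hg h, hc, rho_smul]⟩

theorem mem_stab_of_mem_stab_smul (c : ℂ) {w : Fin 15 → ℂ}
    {A : Matrix (Fin 3) (Fin 3) ℂ} (h : A ∈ stab w) : A ∈ stab (c • w) := by
  obtain ⟨a, ha⟩ := mem_stab.mp h
  exact mem_stab.mpr ⟨a, by rw [kappa_lie_smul, ha, smul_comm]⟩

theorem one_mem_stab (w : Fin 15 → ℂ) : (1 : Matrix (Fin 3) (Fin 3) ℂ) ∈ stab w := by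
  rw [mem_stab]
  refine ⟨4, ?_⟩
  rw [kappa_lie]
  funext i
  fin_cases i <;> simp <;> ring

theorem Equivalent.finrank_stab_le {w w' : Fin 15 → ℂ} (h : Equivalent w w') :
    Module.finrank ℂ (stab w) ≤ Module.finrank ℂ (stab w') := by
  obtain ⟨g, c, hg, hc, rfl⟩ := h
  have hu := isUnit_iff_ne_zero.mpr hg
  let f : Matrix (Fin 3) (Fin 3) ℂ →ₗ[ℂ] Matrix (Fin 3) (Fin 3) ℂ :=
    LinearMap.mulLeft ℂ g⁻¹ ∘ₗ LinearMap.mulRight ℂ g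
  have hf : ∀ A, g * f A = A * g := fun A => by
    change g * (g⁻¹ * (A * g)) = A * g
    rw [← mul_assoc, Matrix.mul_nonsing_inv _ hu, one_mul]
  refine LinearMap.finrank_le_finrank_of_injective (f := f.restrict (p := stab w)
    (q := stab (c • rho g w))
    fun A hA => mem_stab_of_mem_stab_smul c (mem_stab_rho hg (hf A) hA)) ?_
  intro A B hAB
  have h1 : f A = f B := congrArg Subtype.val hAB
  have h2 : (A : Matrix (Fin 3) (Fin 3) ℂ) * g = B * g := by rw [← hf, ← hf, h1]
  have h3 := congrArg (· * g⁻¹) h2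
  simp only [mul_assoc, Matrix.mul_nonsing_inv _ hu, mul_one] at h3
  exact Subtype.ext h3

theorem Equivalent.finrank_stab_eq {w w' : Fin 15 → ℂ} (h : Equivalent w w') :
    Module.finrank ℂ (stab w) = Module.finrank ℂ (stab w') :=
  le_antisymm h.finrank_stab_le h.symm.finrank_stab_le

theorem exists_mem_stab_notMem_span {w : Fin 15 → ℂ} (hd : Module.finrank ℂ (stab w) = 3)
    (B B' : Matrix (Fin 3) (Fin 3) ℂ) : ∃ A ∈ stab w, ∀ a b : ℂ, A ≠ a • B + b • B' := by
  by_contra! h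
  have hle : stab w ≤ Submodule.span ℂ {B, B'} := fun A hA => by
    obtain ⟨a, b, e⟩ := h A hA
    exact Submodule.mem_span_pair.mpr ⟨a, b, e.symm⟩
  have h1 := Submodule.finrank_mono hle
  have h2 := finrank_span_le_card (R := ℂ) ({B, B'} : Set (Matrix (Fin 3) (Fin 3) ℂ))
  have h3 : ({B, B'} : Set (Matrix (Fin 3) (Fin 3) ℂ)).toFinset.card ≤ 2 := by
    rw [Set.toFinset_insert, Set.toFinset_singleton]
    exact Finset.card_le_two
  omega

/-- The form is equivalent to the model `f1`, or it has a nondegenerate singular point at which the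
discriminant of the linear part vanishes. -/
def IsF1OrDegenerate (w : Fin 15 → ℂ) : Prop :=
  Equivalent f1 w ∨ ∃ u, Equivalent w u ∧ u 0 = 0 ∧ u 7 = 0 ∧ dt u ≠ 0 ∧ disc u = 0

theorem IsF1OrDegenerate.of_equivalent {w w' : Fin 15 → ℂ} (h : Equivalent w w')
    (h' : IsF1OrDegenerate w') : IsF1OrDegenerate w := by
  rcases h' with h' | ⟨u, hu, h'⟩
  · exact Or.inl (h'.trans h.symm)
  · exact Or.inr ⟨u, h.trans hu, h'⟩

theorem not_saturated_of_dvd {w : Fin 15 → ℂ} {p : MvPolynomial (Fin 3) ℂ} (hp : ¬ IsUnit p)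
    (h : ∀ i, p ∣ quad (can w) i) : ¬ Saturated w := by
  intro hs
  refine hp (hs p fun i => ?_)
  fin_cases i
  · exact dvd_sub ((h 1).mul_right _) ((h 2).mul_right _)
  · exact dvd_sub ((h 2).mul_right _) ((h 0).mul_right _)
  · exact dvd_sub ((h 0).mul_right _) ((h 1).mul_right _)

theorem not_isUnit_of_eval_eq_zero {p : MvPolynomial (Fin 3) ℂ} (x : Fin 3 → ℂ)
    (h : eval x p = 0) : ¬ IsUnit p := fun hp => (hp.map (eval x)).ne_zero h

theorem not_isUnit_X (i : Fin 3) : ¬ IsUnit (X i : MvPolynomial (Fin 3) ℂ) :=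
  not_isUnit_of_eval_eq_zero 0 (by simp)

theorem quad_can (w : Fin 15 → ℂ) :
    quad (can w) 0 = C (w 10) * X 1 ^ 2 + C (w 11) * X 1 * X 2 + C (w 12) * X 2 ^ 2 +
      C (w 13) * X 0 * X 1 + C (w 14) * X 0 * X 2 ∧
    quad (can w) 1 = C (w 5) * X 2 ^ 2 + C (w 6) * X 0 * X 2 + C (w 7) * X 0 ^ 2 +
      C (w 8) * X 1 * X 2 + C (w 9) * X 0 * X 1 ∧
    quad (can w) 2 = C (w 0) * X 0 ^ 2 + C (w 1) * X 0 * X 1 + C (w 2) * X 1 ^ 2 +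
      C (w 3) * X 0 * X 2 + C (w 4) * X 1 * X 2 := by
  refine ⟨?_, ?_, ?_⟩ <;>
  · simp only [quad, Fin.sum_univ_three, can_apply, map_zero]
    ring

theorem not_saturated_of_forall_exists {w : Fin 15 → ℂ} {p q0 q1 q2 : MvPolynomial (Fin 3) ℂ}
    (hp : ¬ IsUnit p) (h0 : quad (can w) 0 = p * q0) (h1 : quad (can w) 1 = p * q1)
    (h2 : quad (can w) 2 = p * q2) : ¬ Saturated w := by
  refine not_saturated_of_dvd hp fun i => ?_
  fin_cases i
  · exact ⟨q0, h0⟩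
  · exact ⟨q1, h1⟩
  · exact ⟨q2, h2⟩

/-- The normal form of the forms invariant by a transvection. -/
theorem eq_zero_of_transvection {w : Fin 15 → ℂ} (hw : w ≠ 0)
    (h : Matrix.single 2 0 1 ∈ stab w) : w 3 = 0 ∧ w 13 = w 4 ∧ w 10 = 0 ∧ w 14 = 0 ∧ w 11 = 0 ∧
      w 5 = 0 ∧ w 6 = 0 ∧ w 12 = 0 ∧ w 8 = 0 := by
  obtain ⟨c, hc⟩ := mem_stab.mp h
  rw [kappa_lie] at hc
  have h0 := congrFun hc 0
  have h1 := congrFun hc 1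
  have h2 := congrFun hc 2
  have h3 := congrFun hc 3
  have h4 := congrFun hc 4
  have h5 := congrFun hc 5
  have h6 := congrFun hc 6
  have h7 := congrFun hc 7
  have h8 := congrFun hc 8
  have h9 := congrFun hc 9
  have h10 := congrFun hc 10
  have h11 := congrFun hc 11
  have h12 := congrFun hc 12
  have h13 := congrFun hc 13
  have h14 := congrFun hc 14
  simp [Matrix.single] at h0 h1 h2 h3 h4 h5 h6 h7 h8 h9 h10 h11 h12 h13 h14
  rcases eq_or_ne c 0 with rfl | hc0
  · simp at h0 h1 h2 h3 h4 h6 h7 h8 h9 h13 h14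
    refine ⟨h0, ?_, h2, h3, h4, h6, h7, h8, ?_⟩
    · linear_combination -h1
    · linear_combination h9 + h3
  · exfalso
    simp only [hc0, false_or] at h5 h10 h11 h12
    simp only [h5, h10, h11, h12, mul_zero, neg_zero, zero_eq_mul, hc0, false_or]
      at h2 h4 h6 h8 h13 h14
    simp only [h6, h8, h14, sub_self, mul_zero, neg_zero, zero_eq_mul, hc0, false_or] at h3 h7 h9
    simp only [h3, h4, h13, neg_zero, add_zero, zero_eq_mul, hc0, false_or] at h0 h1
    exact hw (funext_fifteen h0 h1 h2 h3 h4 h5 h6 h7 h8 h9 h10 h11 h12 h13 h14)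

/-- The models with a transvection as symmetry: either there is a degenerate singular point on the
line `X = 0`, or the form is pulled back from `f1`, or all symmetries are spanned by the identity
and the transvection. -/
theorem isF1OrDegenerate_of_transvection {w : Fin 15 → ℂ} (hw : Saturated w)
    (hd : Module.finrank ℂ (stab w) = 3) (h : Matrix.single 2 0 1 ∈ stab w) :
    IsF1OrDegenerate w := by
  obtain ⟨w3, w13, w10, w14, w11, w5, w6, w12, w8⟩ := eq_zero_of_transvection hw.ne_zero h
  rcases ne_or_eq (w 4) 0 with w4 | w4
  · -- the point `[0 : w 4 : - w 2]` is singular, with a double eigenvalue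
    let g : Matrix (Fin 3) (Fin 3) ℂ := !![0, 1, 0; w 4, 0, 0; -w 2, 0, 1]
    have hg : g.det ≠ 0 := by simp [g, Matrix.det_fin_three, w4]
    have e : rho g w 0 = 0 ∧ rho g w 7 = 0 ∧ rho g w 3 = -w 4 ^ 3 ∧ rho g w 9 = -w 4 ^ 3 ∧
        rho g w 6 = 0 := by
      refine ⟨?_, ?_, ?_, ?_, ?_⟩ <;>
      · simp only [rho, act, kappa_apply, Fin.sum_univ_three, can_apply, g,
          Matrix.adjugate_fin_three_of, Matrix.cons_val, Matrix.of_apply, w3, w13, w10, w14, w11,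
          w5, w6, w12, w8]
        ring
    obtain ⟨e0, e7, e3, e9, e6⟩ := e
    refine Or.inr ⟨rho g w, equivalent_rho hg w, e0, e7, ?_, ?_⟩
    · rw [dt, e3, e9, e6]
      simp [w4]
    · rw [disc, e3, e9, e6]
      ring
  rw [w4] at w13
  obtain ⟨q0, q1, q2⟩ := quad_can w
  simp only [w3, w4, w13, w10, w14, w11, w5, w6, w12, w8, map_zero, zero_mul, add_zero,
    zero_add] at q0 q1 q2
  have w2 : w 2 ≠ 0 := by
    intro w2
    refine not_saturated_of_forall_exists (not_isUnit_X 0) (q0 := 0)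
      (q1 := C (w 7) * X 0 + C (w 9) * X 1) (q2 := C (w 0) * X 0 + C (w 1) * X 1) ?_ ?_ ?_ hw
    · rw [q0, mul_zero]
    · rw [q1]
      ring
    · rw [q2, w2, map_zero]
      ring
  rcases eq_or_ne (w 9) 0 with w9 | w9
  · have w7 : w 7 ≠ 0 := by
      intro w7
      refine not_saturated_of_forall_exists (p := quad (can w) 2) (q0 := 0) (q1 := 0) (q2 := 1)
        (not_isUnit_of_eval_eq_zero 0 ?_) ?_ ?_ ?_ hw
      · rw [q2]
        simp
      · rw [q0, mul_zero]
      · rw [q1, w7, w9]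
        simp
      · rw [mul_one]
    let p := w 1 / (2 * w 2)
    let g : Matrix (Fin 3) (Fin 3) ℂ :=
      !![1, 0, 0; p, 1, 0; 0, p ^ 2 - w 0 / w 2, w 7 / w 2]
    have hg : g.det ≠ 0 := by simp [g, Matrix.det_fin_three, w2, w7]
    refine Or.inl ⟨g, w 2, hg, w2, ?_⟩
    refine funext_fifteen ?_ ?_ ?_ ?_ ?_ ?_ ?_ ?_ ?_ ?_ ?_ ?_ ?_ ?_ ?_ <;>
    · simp only [rho, act, kappa_apply, Fin.sum_univ_three, can_apply, g, f1,
        Matrix.adjugate_fin_three_of, Matrix.cons_val, Matrix.of_apply, Pi.smul_apply,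
        smul_eq_mul, w3, w4, w13, w10, w14, w11, w5, w6, w12, w8, w9, p]
      field_simp
      try ring
  · exfalso
    have hres : w 0 * w 9 ^ 2 - w 1 * w 9 * w 7 + w 2 * w 7 ^ 2 ≠ 0 := by
      intro hres
      have hC : (C (w 0 * w 9 ^ 2 - w 1 * w 9 * w 7 + w 2 * w 7 ^ 2) : MvPolynomial (Fin 3) ℂ)
        = 0 := by rw [hres, map_zero]
      simp only [map_add, map_sub, map_mul, map_pow] at hC
      have h99 : (C (w 9) : MvPolynomial (Fin 3) ℂ) * C (w 9)⁻¹ = 1 := by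
        rw [← map_mul, mul_inv_cancel₀ w9, map_one]
      refine not_saturated_of_forall_exists (p := C (w 7) * X 0 + C (w 9) * X 1) (q0 := 0)
        (q1 := X 0) (q2 := C (w 9)⁻¹ ^ 2 *
          (C (w 2) * C (w 9) * X 1 + (C (w 1) * C (w 9) - C (w 2) * C (w 7)) * X 0))
        (not_isUnit_of_eval_eq_zero 0 ?_) ?_ ?_ ?_ hw
      · simp
      · rw [q0, mul_zero]
      · rw [q1]
        ring
      · rw [q2]
        linear_combination C (w 9)⁻¹ ^ 2 * X 0 ^ 2 * hC -
          (C (w 0) * X 0 ^ 2 + C (w 1) * X 0 * X 1 + C (w 2) * X 1 ^ 2) *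
            (C (w 9) * C (w 9)⁻¹ + 1) * h99
    obtain ⟨A, hA, hne⟩ := exists_mem_stab_notMem_span hd 1 (Matrix.single 2 0 1)
    obtain ⟨c, hc⟩ := mem_stab.mp hA
    rw [kappa_lie] at hc
    have h0 := congrFun hc 0
    have h1 := congrFun hc 1
    have h2 := congrFun hc 2
    have h4 := congrFun hc 4
    have h6 := congrFun hc 6
    have h7 := congrFun hc 7
    have h8 := congrFun hc 8
    have h9 := congrFun hc 9
    simp [w3, w4, w13, w10, w14, w11, w5, w6, w12, w8] at h0 h1 h2 h4 h6 h7 h8 h9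
    have a02 : A 0 2 = 0 := h8.resolve_right w9
    have a12 : A 1 2 = 0 := by simpa [a02, w9] using h6
    have a01 : A 0 1 = 0 := by simpa [a02, a12, w9] using h4
    simp only [a01, a02, a12, zero_mul, mul_zero, add_zero, sub_zero, zero_add] at h0 h1 h2 h7 h9
    have hc1 : A 0 0 + 3 * A 1 1 = c :=
      mul_right_cancel₀ w2 (by linear_combination h2)
    have hc2 : 2 * A 0 0 + A 2 2 + A 1 1 = c :=
      mul_right_cancel₀ w9 (by linear_combination h9)
    have hdiff : A 0 0 = A 1 1 := by
      have : (w 0 * w 9 ^ 2 - w 1 * w 9 * w 7 + w 2 * w 7 ^ 2) * (A 0 0 - A 1 1) = 0 := by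
        linear_combination (1 / 2 : ℂ) * w 9 ^ 2 * (h0 - w 0 * hc1) -
          (1 / 2 : ℂ) * w 7 * w 9 * (h1 - w 1 * hc1) -
          (1 / 2 : ℂ) * (w 1 * w 9 - 2 * w 2 * w 7) * (h7 - w 7 * hc2)
      exact sub_eq_zero.mp ((mul_eq_zero.mp this).resolve_left hres)
    have a10 : A 1 0 = 0 := by
      apply (mul_eq_zero.mp _).resolve_right w9
      linear_combination h7 - w 7 * hc2 - w 7 * hdiff
    have a21 : A 2 1 = 0 := by
      apply (mul_eq_zero.mp _).resolve_right w9
      linear_combination -h1 + 2 * w 2 * a10 + w 1 * hdiff + w 1 * hc1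
    refine hne (A 0 0) (A 2 0) ?_
    ext i j
    fin_cases i <;> fin_cases j <;> simp [a01, a02, a12, a10, a21, hdiff, Matrix.single]
    linear_combination hc2 - hc1 - hdiff

theorem isF1OrDegenerate_of_sq_eq_zero {w : Fin 15 → ℂ} (hw : Saturated w)
    (hd : Module.finrank ℂ (stab w) = 3) {A : Matrix (Fin 3) (Fin 3) ℂ} (hA : A ∈ stab w)
    (hA0 : A ≠ 0) (hAA : A * A = 0) : IsF1OrDegenerate w := by
  obtain ⟨g, hg, h⟩ := exists_conj_of_sq_eq_zero hA0 hAA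
  have he := equivalent_rho hg w
  refine .of_equivalent he (isF1OrDegenerate_of_transvection (hw.equivalent he) ?_
    (mem_stab_rho hg h hA))
  rw [← he.finrank_stab_eq, hd]

/-- The normal form of the forms invariant by a regular nilpotent matrix. -/
theorem eq_zero_of_regular_nilpotent {w : Fin 15 → ℂ} (hw : w ≠ 0)
    (h : Matrix.single 1 0 1 + Matrix.single 2 1 1 ∈ stab w) : w 12 = 0 ∧ w 5 = 0 ∧ w 11 = 0 ∧
      w 14 = 0 ∧ w 8 = 0 ∧ w 10 = 0 ∧ w 6 = 0 ∧ w 13 = 0 ∧ w 4 = 0 ∧ w 9 = 0 ∧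
      w 3 = -2 * w 2 ∧ w 1 = w 7 := by
  obtain ⟨c, hc⟩ := mem_stab.mp h
  rw [kappa_lie] at hc
  have h0 := congrFun hc 0
  have h1 := congrFun hc 1
  have h2 := congrFun hc 2
  have h3 := congrFun hc 3
  have h4 := congrFun hc 4
  have h5 := congrFun hc 5
  have h6 := congrFun hc 6
  have h7 := congrFun hc 7
  have h8 := congrFun hc 8
  have h9 := congrFun hc 9
  have h10 := congrFun hc 10
  have h11 := congrFun hc 11
  have h12 := congrFun hc 12
  have h13 := congrFun hc 13
  have h14 := congrFun hc 14
  simp [Matrix.single] at h0 h1 h2 h3 h4 h5 h6 h7 h8 h9 h10 h11 h12 h13 h14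
  rcases eq_or_ne c 0 with rfl | hc0
  · have w12 : w 12 = 0 := by linear_combination -h5
    have w5 : w 5 = 0 := by linear_combination (1 / 4 : ℂ) * (h8 + h14)
    have w11 : w 11 = 0 := by linear_combination 3 * w5 - h8
    have w10 : w 10 = 0 := by linear_combination (1 / 3 : ℂ) * (h13 + h6)
    have w8 : w 8 = 0 := by linear_combination -(1 / 2 : ℂ) * h4 + (1 / 2 : ℂ) * w10
    have w14 : w 14 = 0 := by linear_combination w8 - h6
    have w4 : w 4 = 0 := by linear_combination h2
    have w13 : w 13 = 0 := by linear_combination -(1 / 3 : ℂ) * (h3 + h9) + (1 / 3 : ℂ) * w4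
    have w6 : w 6 = 0 := by linear_combination h9 + 2 * w13
    have w9 : w 9 = 0 := by linear_combination h7
    exact ⟨w12, w5, w11, w14, w8, w10, w6, w13, w4, w9, by linear_combination h1 + w9,
      by linear_combination h0⟩
  · exfalso
    have hz : ∀ {x : ℂ}, c * x = 0 → x = 0 := fun hx => (mul_eq_zero.mp hx).resolve_left hc0
    have w12 : w 12 = 0 := by tauto
    have w5 : w 5 = 0 := hz (by linear_combination -h5 - w12)
    have w11 : w 11 = 0 := hz (by linear_combination -h11 + 2 * w12)
    have w14 : w 14 = 0 := hz (by linear_combination -h14 + w5 + w11)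
    have w8 : w 8 = 0 := hz (by linear_combination -h8 + 3 * w5 - w11)
    have w6 : w 6 = 0 := hz (by linear_combination -h6 + w8 - w14)
    have w10 : w 10 = 0 := hz (by linear_combination -h10 + w11)
    have w13 : w 13 = 0 := hz (by linear_combination -h13 + 3 * w10 + w14 - w8)
    have w4 : w 4 = 0 := hz (by linear_combination -h4 - 2 * w8 + w10)
    have w9 : w 9 = 0 := hz (by linear_combination -h9 + w6 - 2 * w13)
    have w3 : w 3 = 0 := hz (by linear_combination -h3 - w6 + w4 - w13)
    have w7 : w 7 = 0 := hz (by linear_combination -h7 + w9)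
    have w2 : w 2 = 0 := hz (by linear_combination -h2 + w4)
    have w1 : w 1 = 0 := hz (by linear_combination -h1 - w9 + 2 * w2 + w3)
    have w0 : w 0 = 0 := hz (by linear_combination -h0 + w1 - w7)
    exact hw (funext_fifteen w0 w1 w2 w3 w4 w5 w6 w7 w8 w9 w10 w11 w12 w13 w14)

/-- The symmetries of a foliation invariant by a regular nilpotent matrix are spanned by this matrix
and the identity. -/
theorem finrank_stab_ne_of_regular_nilpotent {w : Fin 15 → ℂ} (hw : Saturated w)
    (h : Matrix.single 1 0 1 + Matrix.single 2 1 1 ∈ stab w) :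
    Module.finrank ℂ (stab w) ≠ 3 := by
  intro hd
  obtain ⟨w12, w5, w11, w14, w8, w10, w6, w13, w4, w9, w3, w1⟩ :=
    eq_zero_of_regular_nilpotent hw.ne_zero h
  obtain ⟨q0, q1, q2⟩ := quad_can w
  simp only [w3, w4, w13, w10, w14, w11, w5, w6, w12, w8, w9, map_zero, zero_mul, add_zero,
    zero_add] at q0 q1 q2
  have w7 : w 7 ≠ 0 := by
    intro w7
    refine not_saturated_of_forall_exists (p := quad (can w) 2) (q0 := 0) (q1 := 0) (q2 := 1)
      (not_isUnit_of_eval_eq_zero 0 ?_) ?_ ?_ ?_ hw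
    · rw [q2]
      simp
    · rw [q0, mul_zero]
    · rw [q1, w7]
      simp
    · rw [mul_one]
  have w2 : w 2 ≠ 0 := by
    intro w2
    refine not_saturated_of_forall_exists (not_isUnit_X 0) (q0 := 0)
      (q1 := C (w 7) * X 0) (q2 := C (w 0) * X 0 + C (w 1) * X 1) ?_ ?_ ?_ hw
    · rw [q0, mul_zero]
    · rw [q1]
      ring
    · rw [q2, w2, mul_zero, map_zero]
      ring
  obtain ⟨A, hA, hne⟩ := exists_mem_stab_notMem_span hd 1
    (Matrix.single 1 0 1 + Matrix.single 2 1 1)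
  obtain ⟨c, hc⟩ := mem_stab.mp hA
  rw [kappa_lie] at hc
  have h0 := congrFun hc 0
  have h1 := congrFun hc 1
  have h2 := congrFun hc 2
  have h3 := congrFun hc 3
  have h4 := congrFun hc 4
  have h6 := congrFun hc 6
  have h7 := congrFun hc 7
  have h8 := congrFun hc 8
  simp [w1, w3, w4, w13, w10, w14, w11, w5, w6, w12, w8, w9] at h0 h1 h2 h3 h4 h6 h7 h8
  have a02 : A 0 2 = 0 := by tauto
  have a12 : A 1 2 = 0 := by
    apply (mul_eq_zero.mp _).resolve_right w2
    linear_combination (1 / 2 : ℂ) * h6 - w 7 * a02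
  have a01 : A 0 1 = 0 := by
    apply (mul_eq_zero.mp _).resolve_right w2
    linear_combination -(1 / 2 : ℂ) * h4 + (3 / 2 : ℂ) * w 2 * a12 + (1 / 2 : ℂ) * w 7 * a02
  have hc1 : A 0 0 + 3 * A 1 1 = c :=
    mul_right_cancel₀ w2 (by linear_combination h2 - w 7 * a01)
  have hc2 : 2 * A 0 0 + A 1 1 + A 2 2 = c :=
    mul_right_cancel₀ w2 (by
      linear_combination -(1 / 2 : ℂ) * h3 + (3 / 2 : ℂ) * w 0 * a02 + (1 / 2 : ℂ) * w 7 * a12 +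
        (1 / 2 : ℂ) * w 7 * a01)
  have hc3 : 3 * A 0 0 + A 2 2 = c :=
    mul_right_cancel₀ w7 (by linear_combination h7 + w 0 * a12)
  have d01 : A 0 0 = A 1 1 := by linear_combination hc3 - hc2
  have d02 : A 2 2 = A 1 1 := by linear_combination hc3 - hc1 - 2 * d01
  have a10 : A 1 0 = A 2 1 := by
    apply mul_right_cancel₀ w2
    linear_combination (1 / 2 : ℂ) * h1 - w 0 * a01 - (1 / 2 : ℂ) * w 7 * (hc1 + d01)
  have a20 : A 2 0 = 0 := by
    apply (mul_eq_zero.mp _).resolve_right w2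
    linear_combination -(1 / 2 : ℂ) * h0 + (1 / 2 : ℂ) * w 0 * (hc1 + 2 * d01) +
      (1 / 2 : ℂ) * w 7 * a10
  refine hne (A 0 0) (A 1 0) ?_
  ext i j
  fin_cases i <;> fin_cases j <;> simp [a01, a02, a12, a10, a20, d01, d02, Matrix.single]

/-- If the matrix `single 2 0 1 + single 1 1 m` is a symmetry, so is its nilpotent part. -/
theorem transvection_mem_stab {w : Fin 15 → ℂ} {m : ℂ}
    (h : Matrix.single 2 0 1 + Matrix.single 1 1 m ∈ stab w) : Matrix.single 2 0 1 ∈ stab w := by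
  obtain ⟨c, hc⟩ := mem_stab.mp h
  rw [kappa_lie] at hc
  have h0 := congrFun hc 0
  have h1 := congrFun hc 1
  have h2 := congrFun hc 2
  have h3 := congrFun hc 3
  have h4 := congrFun hc 4
  have h5 := congrFun hc 5
  have h6 := congrFun hc 6
  have h7 := congrFun hc 7
  have h8 := congrFun hc 8
  have h9 := congrFun hc 9
  have h10 := congrFun hc 10
  have h11 := congrFun hc 11
  have h12 := congrFun hc 12
  have h13 := congrFun hc 13
  have h14 := congrFun hc 14
  simp [Matrix.single] at h0 h1 h2 h3 h4 h5 h6 h7 h8 h9 h10 h11 h12 h13 h14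
  rw [mem_stab]
  refine ⟨0, ?_⟩
  rw [kappa_lie, zero_smul]
  -- the symmetry is the sum of two commuting parts: on the eigenspace of `single 1 1 m` with
  -- eigenvalue `k m`, `0 ≤ k ≤ 3`, the nilpotent part acts as the scalar `c - k m`, hence by zero
  have hz : ∀ {k x : ℂ}, c - k * m ≠ 0 → (c - k * m) * x = 0 → x = 0 :=
    fun hk hx => (mul_eq_zero.mp hx).resolve_left hk
  have k0 : w 5 = 0 ∧ w 6 = 0 := by
    rcases eq_or_ne (c - 0 * m) 0 with hk | hk
    · exact ⟨by linear_combination (1 / 2 : ℂ) * h6 + (1 / 2 : ℂ) * w 6 * hk,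
        by linear_combination h7 + w 7 * hk⟩
    · have w5 : w 5 = 0 := h5.resolve_left fun e => hk (by linear_combination e)
      exact ⟨w5, hz hk (by linear_combination -h6 + 2 * w5)⟩
  have k1 : w 12 = 0 ∧ w 14 = 0 ∧ w 3 = 0 ∧ w 8 = w 14 := by
    rcases eq_or_ne (c - 1 * m) 0 with hk | hk
    · exact ⟨by linear_combination h8 + w 8 * hk,
        by linear_combination -(1 / 2 : ℂ) * h3 - (1 / 2 : ℂ) * w 3 * hk,
        by linear_combination h0 + w 0 * hk, by linear_combination h9 + w 9 * hk⟩
    · have w12 : w 12 = 0 := h12.resolve_left fun e => hk (by linear_combination -e)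
      have w14 : w 14 = 0 := hz hk (by linear_combination -h14 + 3 * w12)
      have w8 : w 8 = 0 := hz hk (by linear_combination -h8 + w12)
      exact ⟨w12, w14, hz hk (by linear_combination -h3 - 2 * w14), by rw [w8, w14]⟩
  have k2 : w 11 = 0 ∧ w 4 = w 13 := by
    rcases eq_or_ne (c - 2 * m) 0 with hk | hk
    · exact ⟨by linear_combination -h4 - w 4 * hk, by linear_combination h1 + w 1 * hk⟩
    · have w11 : w 11 = 0 := h11.resolve_left fun e => hk (by linear_combination -e)
      have w4 : w 4 = 0 := hz hk (by linear_combination -h4 - w11)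
      have w13 : w 13 = 0 := hz hk (by linear_combination -h13 + w11)
      exact ⟨w11, by rw [w4, w13]⟩
  have k3 : w 10 = 0 := by
    rcases eq_or_ne (c - 3 * m) 0 with hk | hk
    · linear_combination -h2 - w 2 * hk
    · exact h10.resolve_left fun e => hk (by linear_combination -e)
  obtain ⟨w5, w6⟩ := k0
  obtain ⟨w12, w14, w3, w8⟩ := k1
  obtain ⟨w11, w4⟩ := k2
  funext i
  fin_cases i <;> simp [Matrix.single, w5, w6, w12, w14, w3, w8, w11, w4, k3]

/-- The homology `single 2 2 1` acts on forms with the eigenvalues `0`, `1`, `2`, `3`; outside the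
eigenspace of `1`, all its eigenvectors have a common factor. -/
theorem not_saturated_of_eigenvalue {w : Fin 15 → ℂ} {c : ℂ} (hc1 : c ≠ 1)
    (hc : kappa (lie (Matrix.single 2 2 1) (can w)) = c • w) : ¬ Saturated w := by
  rw [kappa_lie] at hc
  have h0 := congrFun hc 0
  have h1 := congrFun hc 1
  have h2 := congrFun hc 2
  have h3 := congrFun hc 3
  have h4 := congrFun hc 4
  have h5 := congrFun hc 5
  have h6 := congrFun hc 6
  have h7 := congrFun hc 7
  have h8 := congrFun hc 8
  have h9 := congrFun hc 9
  have h10 := congrFun hc 10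
  have h11 := congrFun hc 11
  have h12 := congrFun hc 12
  have h13 := congrFun hc 13
  have h14 := congrFun hc 14
  simp [Matrix.single] at h0 h1 h2 h3 h4 h5 h6 h7 h8 h9 h10 h11 h12 h13 h14
  have hz : ∀ {k x : ℂ}, c ≠ k → k * x = c * x → x = 0 := fun hk hx => by
    apply (mul_eq_zero.mp _).resolve_left (sub_ne_zero.mpr hk)
    linear_combination -hx
  have w3 := hz hc1 (by linear_combination h3 : 1 * w 3 = c * w 3)
  have w4 := hz hc1 (by linear_combination h4 : 1 * w 4 = c * w 4)
  have w7 := hz hc1 (by linear_combination h7 : 1 * w 7 = c * w 7)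
  have w9 := hz hc1 (by linear_combination h9 : 1 * w 9 = c * w 9)
  have w10 := hz hc1 (by linear_combination h10 : 1 * w 10 = c * w 10)
  have w13 := hz hc1 (by linear_combination h13 : 1 * w 13 = c * w 13)
  obtain ⟨q0, q1, q2⟩ := quad_can w
  rcases eq_or_ne c 0 with rfl | hc0
  · simp at h5 h6 h8 h11 h12 h14
    simp only [w3, w4, w7, w9, w10, w13, h5, h6, h8, h11, h12, h14, map_zero, zero_mul, add_zero]
      at q0 q1 q2
    refine not_saturated_of_forall_exists (p := quad (can w) 2) (q0 := 0) (q1 := 0) (q2 := 1)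
      (not_isUnit_of_eval_eq_zero 0 ?_) ?_ ?_ ?_
    · rw [q2]
      simp
    · rw [q0, mul_zero]
    · rw [q1, mul_zero]
    · rw [mul_one]
  · have w0 : w 0 = 0 := by tauto
    have w1 : w 1 = 0 := by tauto
    have w2 : w 2 = 0 := by tauto
    simp only [w0, w1, w2, w3, w4, w7, w9, w10, w13, map_zero, zero_mul, add_zero, zero_add]
      at q0 q1 q2
    refine not_saturated_of_forall_exists (not_isUnit_X 2)
      (q0 := C (w 11) * X 1 + C (w 12) * X 2 + C (w 14) * X 0)
      (q1 := C (w 5) * X 2 + C (w 6) * X 0 + C (w 8) * X 1) (q2 := 0) ?_ ?_ ?_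
    · rw [q0]
      ring
    · rw [q1]
      ring
    · rw [q2, mul_zero]

/-- The normal form of the forms in the eigenspace of `1` of the homology `single 2 2 1`. -/
theorem eq_zero_of_homology {w : Fin 15 → ℂ}
    (hc : kappa (lie (Matrix.single 2 2 1) (can w)) = w) : w 0 = 0 ∧ w 1 = 0 ∧ w 2 = 0 ∧
      w 5 = 0 ∧ w 6 = 0 ∧ w 8 = 0 ∧ w 11 = 0 ∧ w 12 = 0 ∧ w 14 = 0 := by
  rw [kappa_lie] at hc
  have h0 := congrFun hc 0
  have h1 := congrFun hc 1
  have h2 := congrFun hc 2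
  have h5 := congrFun hc 5
  have h6 := congrFun hc 6
  have h8 := congrFun hc 8
  have h11 := congrFun hc 11
  have h12 := congrFun hc 12
  have h14 := congrFun hc 14
  simp [Matrix.single] at h0 h1 h2 h5 h6 h8 h11 h12 h14
  refine ⟨h0.symm, h1.symm, h2.symm, ?_, ?_, ?_, ?_, ?_, ?_⟩
  · linear_combination (1 / 2 : ℂ) * h5
  · linear_combination h6
  · linear_combination h8
  · linear_combination h11
  · linear_combination (1 / 2 : ℂ) * h12
  · linear_combination h14

/-- The symmetry group of a foliation does not contain the maximal torus. -/
theorem not_saturated_of_torus {w : Fin 15 → ℂ} {s : ℂ} (hs : s ≠ 0)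
    (hc : kappa (lie (Matrix.single 2 2 1) (can w)) = w)
    (h : Matrix.diagonal ![s, -s, 0] ∈ stab w) : ¬ Saturated w := by
  obtain ⟨w0, w1, w2, w5, w6, w8, w11, w12, w14⟩ := eq_zero_of_homology hc
  obtain ⟨c, hc⟩ := mem_stab.mp h
  rw [kappa_lie] at hc
  have h3 := congrFun hc 3
  have h4 := congrFun hc 4
  have h7 := congrFun hc 7
  have h9 := congrFun hc 9
  have h10 := congrFun hc 10
  have h13 := congrFun hc 13
  simp at h3 h4 h7 h9 h10 h13
  have hz : ∀ {k x : ℂ}, c ≠ k * s → k * s * x = c * x → x = 0 := fun hk hx => by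
    apply (mul_eq_zero.mp _).resolve_left (sub_ne_zero.mpr hk)
    linear_combination -hx
  have hne : ∀ {k l : ℂ}, k ≠ l → c = k * s → c ≠ l * s := fun hkl hk hl =>
    hkl (mul_right_cancel₀ hs (hk.symm.trans hl))
  obtain ⟨q0, q1, q2⟩ := quad_can w
  simp only [w0, w1, w2, w5, w6, w8, w11, w12, w14, map_zero, zero_mul, add_zero, zero_add]
    at q0 q1 q2
  -- unless `c` is the corresponding multiple of `s`, a coordinate vanishes
  have z3 : c ≠ 1 * s → w 3 = 0 := fun hk => hz hk (by linear_combination h3)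
  have z9 : c ≠ 1 * s → w 9 = 0 := fun hk => hz hk (by linear_combination h9)
  have z4 : c ≠ -1 * s → w 4 = 0 := fun hk => hz hk (by linear_combination h4)
  have z13 : c ≠ -1 * s → w 13 = 0 := fun hk => hz hk (by linear_combination h13)
  have z7 : c ≠ 3 * s → w 7 = 0 := fun hk =>
    h7.resolve_left fun e => hk (by linear_combination -e)
  have z10 : c ≠ -3 * s → w 10 = 0 := fun hk => hz hk (by linear_combination h10)
  by_cases hk : c = 1 * s ∨ c = 3 * s
  · have h4 : w 4 = 0 := z4 (by rcases hk with hk | hk <;> exact hne (by norm_num) hk)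
    have h13 : w 13 = 0 := z13 (by rcases hk with hk | hk <;> exact hne (by norm_num) hk)
    have h10 : w 10 = 0 := z10 (by rcases hk with hk | hk <;> exact hne (by norm_num) hk)
    simp only [h4, h13, h10, map_zero, zero_mul, add_zero] at q0 q1 q2
    refine not_saturated_of_forall_exists (not_isUnit_X 0) (q0 := 0)
      (q1 := C (w 7) * X 0 + C (w 9) * X 1) (q2 := C (w 3) * X 2) ?_ ?_ ?_
    · rw [q0, mul_zero]
    · rw [q1]
      ring
    · rw [q2]
      ring
  · push Not at hk
    have h3 := z3 hk.1
    have h9 := z9 hk.1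
    have h7 := z7 hk.2
    simp only [h3, h9, h7, map_zero, zero_mul, add_zero, zero_add] at q0 q1 q2
    refine not_saturated_of_forall_exists (not_isUnit_X 1)
      (q0 := C (w 10) * X 1 + C (w 13) * X 0) (q1 := 0) (q2 := C (w 4) * X 2) ?_ ?_ ?_
    · rw [q0]
      ring
    · rw [q1, mul_zero]
    · rw [q2]
      ring

/-- The components of a symmetry with respect to the grading defined by another one. -/
theorem components_mem_stab {w : Fin 15 → ℂ}
    (hc : kappa (lie (Matrix.single 2 2 1) (can w)) = w) {A : Matrix (Fin 3) (Fin 3) ℂ}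
    (hA : A ∈ stab w) : !![0, 0, 0; 0, 0, 0; A 2 0, A 2 1, 0] ∈ stab w ∧
      !![0, 0, A 0 2; 0, 0, A 1 2; 0, 0, 0] ∈ stab w ∧
      !![A 0 0, A 0 1, 0; A 1 0, A 1 1, 0; 0, 0, A 2 2] ∈ stab w := by
  obtain ⟨w0, w1, w2, w5, w6, w8, w11, w12, w14⟩ := eq_zero_of_homology hc
  obtain ⟨c, hc⟩ := mem_stab.mp hA
  rw [kappa_lie] at hc
  have h0 := congrFun hc 0
  have h1 := congrFun hc 1
  have h2 := congrFun hc 2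
  have h6 := congrFun hc 6
  have h8 := congrFun hc 8
  have h11 := congrFun hc 11
  have h14 := congrFun hc 14
  simp [w0, w1, w2, w5, w6, w8, w11, w12, w14] at h0 h1 h2 h6 h8 h11 h14
  have e1 : !![0, 0, 0; 0, 0, 0; A 2 0, A 2 1, 0] ∈ stab w := by
    refine mem_stab.mpr ⟨0, ?_⟩
    rw [kappa_lie, zero_smul]
    funext i
    fin_cases i <;> simp [w0, w1, w2, w5, w6, w8, w11, w12, w14] <;> assumption
  have e2 : !![0, 0, A 0 2; 0, 0, A 1 2; 0, 0, 0] ∈ stab w := by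
    refine mem_stab.mpr ⟨0, ?_⟩
    rw [kappa_lie, zero_smul]
    funext i
    fin_cases i <;> simp [w0, w1, w2, w5, w6, w8, w11, w12, w14] <;> assumption
  refine ⟨e1, e2, ?_⟩
  have e : !![A 0 0, A 0 1, 0; A 1 0, A 1 1, 0; 0, 0, A 2 2] =
      A - !![0, 0, 0; 0, 0, 0; A 2 0, A 2 1, 0] - !![0, 0, A 0 2; 0, 0, A 1 2; 0, 0, 0] := by
    ext i j
    fin_cases i <;> fin_cases j <;> simp
  rw [e]
  exact sub_mem (sub_mem hA e1) e2

/-- The symmetry algebra is graded by the homology. A component of non-zero degree squares to zero,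
which is the case of a transvection; the components of degree zero act on a plane, nilpotently or
as a maximal torus. -/
theorem isF1OrDegenerate_of_homology {w : Fin 15 → ℂ} (hw : Saturated w)
    (hd : Module.finrank ℂ (stab w) = 3) (h : Matrix.single 2 2 1 ∈ stab w) :
    IsF1OrDegenerate w := by
  obtain ⟨c, hc⟩ := mem_stab.mp h
  obtain rfl : c = 1 := by
    by_contra hc1
    exact not_saturated_of_eigenvalue hc1 hc hw
  rw [one_smul] at hc
  obtain ⟨A, hA, hne⟩ := exists_mem_stab_notMem_span hd 1 (Matrix.single 2 2 1)
  obtain ⟨h1, h2, h3⟩ := components_mem_stab hc hA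
  by_cases hA1 : A 2 0 = 0 ∧ A 2 1 = 0
  swap
  · refine isF1OrDegenerate_of_sq_eq_zero hw hd h1 (fun h0 => hA1 ?_) ?_
    · exact ⟨by simpa using congrFun (congrFun h0 2) 0, by simpa using congrFun (congrFun h0 2) 1⟩
    · ext i j
      fin_cases i <;> fin_cases j <;> simp [Matrix.mul_apply, Fin.sum_univ_three]
  by_cases hA2 : A 0 2 = 0 ∧ A 1 2 = 0
  swap
  · refine isF1OrDegenerate_of_sq_eq_zero hw hd h2 (fun h0 => hA2 ?_) ?_
    · exact ⟨by simpa using congrFun (congrFun h0 0) 2, by simpa using congrFun (congrFun h0 1) 2⟩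
    · ext i j
      fin_cases i <;> fin_cases j <;> simp [Matrix.mul_apply, Fin.sum_univ_three]
  -- the trace-free part of the remaining block of `A`
  let x := (A 0 0 - A 1 1) / 2
  have hB : !![x, A 0 1, 0; A 1 0, -x, 0; 0, 0, 0] ∈ stab w := by
    have e : !![x, A 0 1, 0; A 1 0, -x, 0; 0, 0, 0] =
        !![A 0 0, A 0 1, 0; A 1 0, A 1 1, 0; 0, 0, A 2 2] -
          ((A 0 0 + A 1 1) / 2) • (1 : Matrix (Fin 3) (Fin 3) ℂ) -
          (A 2 2 - (A 0 0 + A 1 1) / 2) • Matrix.single 2 2 1 := by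
      ext i j
      fin_cases i <;> fin_cases j <;> simp [Matrix.single, x] <;> ring
    rw [e]
    exact sub_mem (sub_mem h3 (Submodule.smul_mem _ _ (one_mem_stab w))) (Submodule.smul_mem _ _ h)
  obtain ⟨s, hs⟩ := IsAlgClosed.exists_pow_nat_eq (x ^ 2 + A 0 1 * A 1 0) (n := 2) (by norm_num)
  rcases eq_or_ne s 0 with hs0 | hs0
  · rw [hs0] at hs
    refine isF1OrDegenerate_of_sq_eq_zero hw hd hB (fun h0 => ?_) ?_
    · have e00 : x = 0 := by simpa using congrFun (congrFun h0 0) 0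
      have e01 : A 0 1 = 0 := by simpa using congrFun (congrFun h0 0) 1
      have e10 : A 1 0 = 0 := by simpa using congrFun (congrFun h0 1) 0
      have e : A 0 0 = A 1 1 := by linear_combination 2 * e00
      refine hne (A 1 1) (A 2 2 - A 1 1) ?_
      ext i j
      fin_cases i <;> fin_cases j <;> simp [Matrix.single, hA1, hA2, e01, e10, e]
    · ext i j
      fin_cases i <;> fin_cases j <;> simp [Matrix.mul_apply, Fin.sum_univ_three] <;>
        first | linear_combination -hs | ring
  · -- the block is diagonalizable, and the symmetries contain a maximal torus
    exfalso
    have hev : ∀ s : ℂ, s ^ 2 = x ^ 2 + A 0 1 * A 1 0 → ∃ v : Fin 3 → ℂ, v ≠ 0 ∧ v 2 = 0 ∧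
        (!![x, A 0 1, 0; A 1 0, -x, 0; 0, 0, 0] : Matrix (Fin 3) (Fin 3) ℂ).mulVec v = s • v := by
      intro s hs
      have hdet : !![x - s, A 0 1; A 1 0, -x - s].det = 0 := by
        rw [Matrix.det_fin_two_of]
        linear_combination hs
      obtain ⟨v, hv, hv0⟩ := Matrix.exists_mulVec_eq_zero_iff.mpr hdet
      have e0 := congrFun hv0 0
      have e1 := congrFun hv0 1
      simp [Matrix.mulVec, dotProduct] at e0 e1
      refine ⟨![v 0, v 1, 0], fun h0 => hv ?_, rfl, ?_⟩
      · funext i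
        fin_cases i
        · exact congrFun h0 0
        · exact congrFun h0 1
      · funext i
        fin_cases i <;> simp [Matrix.mulVec, dotProduct, Fin.sum_univ_three]
        · linear_combination e0
        · linear_combination e1
    obtain ⟨v, hv, hv2, hvs⟩ := hev s hs
    obtain ⟨v', hv', hv2', hvs'⟩ := hev (-s) (by rw [neg_sq, hs])
    generalize hBB : (!![x, A 0 1, 0; A 1 0, -x, 0; 0, 0, 0] : Matrix (Fin 3) (Fin 3) ℂ) = B at *
    have hB2 : B.mulVec ![0, 0, 1] = 0 := by
      rw [← hBB]
      funext i
      fin_cases i <;> simp [Matrix.mulVec, dotProduct, Fin.sum_univ_three]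
    have hg : (ofCols ![v, v', ![0, 0, 1]]).det ≠ 0 := by
      refine det_ofCols_ne_zero fun a b c habc => ?_
      simp only [Matrix.cons_val] at habc
      have e1 := congrArg B.mulVec habc
      simp only [Matrix.mulVec_add, Matrix.mulVec_smul, hvs, hvs', hB2, smul_zero, add_zero,
        Matrix.mulVec_zero] at e1
      have e2 : a • v = b • v' := by
        have : s • (a • v - b • v') = 0 := by
          rw [← e1]
          module
        exact sub_eq_zero.mp ((smul_eq_zero.mp this).resolve_left hs0)
      have e3 := congrArg B.mulVec e2
      simp only [Matrix.mulVec_smul, hvs, hvs'] at e3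
      have ha : a = 0 := by
        have : (2 * s) • (a • v) = 0 := by
          calc (2 * s) • (a • v) = a • s • v + s • (a • v) := by module
            _ = 0 := by
              rw [e3, e2]
              module
        have := (smul_eq_zero.mp this).resolve_left (by simpa using hs0)
        exact (smul_eq_zero.mp this).resolve_right hv
      rw [ha, zero_smul] at e2
      have hb : b = 0 := (smul_eq_zero.mp e2.symm).resolve_right hv'
      rw [ha, hb] at habc
      have := congrFun habc 2
      exact ⟨ha, hb, by simpa using this⟩
    have hg1 : ofCols ![v, v', ![0, 0, 1]] * Matrix.diagonal ![s, -s, 0] =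
        B * ofCols ![v, v', ![0, 0, 1]] := by
      refine mul_ofCols fun j => ?_
      fin_cases j <;> simp [hvs, hvs', hB2]
    have hg2 : ofCols ![v, v', ![0, 0, 1]] * Matrix.single 2 2 1 =
        Matrix.single 2 2 1 * ofCols ![v, v', ![0, 0, 1]] := by
      refine mul_ofCols fun j => ?_
      funext i
      fin_cases i <;> fin_cases j <;>
        simp [Matrix.mulVec, dotProduct, Matrix.single, hv2, hv2']
    refine not_saturated_of_torus hs0 ?_ (mem_stab_rho hg hg1 hB)
      (hw.equivalent (equivalent_rho hg w))
    rw [kappa_lie_rho hg hg2, hc]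

/-- A foliation whose orbit has dimension `6` has a two-dimensional space of trace-free
infinitesimal symmetries. Since the discriminant of the characteristic polynomial vanishes somewhere
on this pencil, some symmetry is, up to a scalar matrix and conjugation, one of four matrices with a
double eigenvalue `0`: a transvection, a regular nilpotent matrix, a homology, or the sum of a
transvection and a commuting homology. -/
theorem isF1OrDegenerate_of_finrank_stab {w : Fin 15 → ℂ} (hw : Saturated w)
    (hd : Module.finrank ℂ (stab w) = 3) : IsF1OrDegenerate w := by
  obtain ⟨B, hB, hBne⟩ := exists_mem_stab_notMem_span hd 1 0
  obtain ⟨B', hB', hBne'⟩ := exists_mem_stab_notMem_span hd 1 B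
  -- the trace-free parts span a pencil without scalar matrices
  let t : Matrix (Fin 3) (Fin 3) ℂ → Matrix (Fin 3) (Fin 3) ℂ := fun M => M - (M.trace / 3) • 1
  have ht : ∀ M, (t M).trace = 0 := fun M => by
    simp only [t, Matrix.trace_sub, Matrix.trace_smul, Matrix.trace_one, smul_eq_mul,
      Fintype.card_fin]
    push_cast
    ring
  have htm : ∀ M ∈ stab w, t M ∈ stab w := fun M hM =>
    sub_mem hM (Submodule.smul_mem _ _ (one_mem_stab w))
  obtain ⟨x, y, hxy, hdisc⟩ := exists_discriminant_eq_zero (t B) (t B')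
  obtain ⟨c, hc1, hc2⟩ := exists_sub_smul_one (by
    rw [Matrix.trace_add, Matrix.trace_smul, Matrix.trace_smul, ht, ht, smul_zero, smul_zero,
      add_zero]) hdisc
  have hA : x • t B + y • t B' - c • 1 ∈ stab w :=
    sub_mem (add_mem (Submodule.smul_mem _ _ (htm _ hB)) (Submodule.smul_mem _ _ (htm _ hB')))
      (Submodule.smul_mem _ _ (one_mem_stab w))
  have hA0 : x • t B + y • t B' - c • 1 ≠ 0 := by
    intro h0
    have e : y • B' = (x * (B.trace / 3) + y * (B'.trace / 3) + c) •
        (1 : Matrix (Fin 3) (Fin 3) ℂ) - x • B := by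
      rw [← sub_eq_zero, ← h0]
      simp only [t]
      module
    rcases eq_or_ne y 0 with rfl | hy
    · have hx : x ≠ 0 := by tauto
      refine hBne ((x⁻¹ * (x * (B.trace / 3) + 0 * (B'.trace / 3) + c))) 0 ?_
      rw [zero_smul, eq_comm, sub_eq_zero] at e
      rw [mul_smul, e, inv_smul_smul₀ hx, smul_zero, add_zero]
    · refine hBne' (y⁻¹ * (x * (B.trace / 3) + y * (B'.trace / 3) + c)) (-(y⁻¹ * x)) ?_
      have := congrArg (y⁻¹ • ·) e
      simp only [inv_smul_smul₀ hy] at this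
      refine this.trans ?_
      module
  generalize x • t B + y • t B' - c • 1 = A at hA hA0 hc1 hc2
  -- the characteristic polynomial of `A` is `X² (X - trace A)`
  have hadj := adjugate_eq A
  rw [hc1, zero_smul, add_zero] at hadj
  have hCH : A * (A * A - A.trace • A) = 0 := by
    rw [← hadj, Matrix.mul_adjugate, hc2, zero_smul]
  rcases eq_or_ne A.trace 0 with htr | htr
  · rw [htr, zero_smul, sub_zero] at hCH
    by_cases hAA : A * A = 0
    · exact isF1OrDegenerate_of_sq_eq_zero hw hd hA hA0 hAA
    · exfalso
      obtain ⟨g, hg, h⟩ := exists_conj_of_cube_eq_zero hAA hCH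
      have he := equivalent_rho hg w
      exact finrank_stab_ne_of_regular_nilpotent (hw.equivalent he) (mem_stab_rho hg h hA)
        (he.finrank_stab_eq ▸ hd)
  · by_cases hAA : A * A - A.trace • A = 0
    · obtain ⟨g, hg, h⟩ := exists_conj_of_projector htr hAA
      have he := equivalent_rho hg w
      refine .of_equivalent he (isF1OrDegenerate_of_homology (hw.equivalent he)
        (he.finrank_stab_eq ▸ hd) ?_)
      have e : (Matrix.single 2 2 1 : Matrix (Fin 3) (Fin 3) ℂ) =
          A.trace⁻¹ • Matrix.single 2 2 A.trace := by
        rw [Matrix.smul_single, smul_eq_mul, inv_mul_cancel₀ htr]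
      rw [e]
      exact Submodule.smul_mem _ _ (mem_stab_rho hg h hA)
    · have hA2 : A * A ≠ 0 := by
        intro h0
        rw [h0, zero_sub, mul_neg, Matrix.mul_smul, h0, smul_zero, neg_zero] at hCH
        rw [h0, zero_sub] at hadj
        have h3 := congrArg Matrix.trace hadj
        have h4 : A.adjugate.trace = minorSum A := by
          rw [Matrix.adjugate_fin_three]
          simp [Matrix.trace_fin_three, minorSum]
          ring
        rw [h4, hc1, Matrix.trace_neg, Matrix.trace_smul, smul_eq_mul, eq_comm, neg_eq_zero,
          mul_self_eq_zero] at h3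
        exact htr h3
      obtain ⟨g, hg, h⟩ := exists_conj_of_jordan htr hAA hA2 hCH
      have he := equivalent_rho hg w
      exact .of_equivalent he (isF1OrDegenerate_of_transvection (hw.equivalent he)
        (he.finrank_stab_eq ▸ hd) (transvection_mem_stab (mem_stab_rho hg h hA)))

/-- Among the degenerations of a form without degenerate singular points, `f1` is the only one with
an orbit of dimension `6`. -/
theorem NoDegenerate.equivalent_f1 {v w : Fin 15 → ℂ} (hv : NoDegenerate v)
    (hw : w ∈ closure {u | Equivalent v u}) (hs : Saturated w)
    (hd : Module.finrank ℂ (stab w) = 3) : Equivalent f1 w := by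
  rcases isF1OrDegenerate_of_finrank_stab hs hd with h | ⟨u, hu, h0, h7, hdt, hdisc⟩
  · exact h
  · exact absurd hdisc (hv.disc_ne_zero (hu.mem_closure hw) h0 h7 hdt)

/-! ### Hypersurfaces in the space of foliations -/

/-- The coordinates `sec` as linear polynomials in the coefficients of a form. -/
def secPoly : Fin 15 → MvPolynomial (Fin 3 × (Fin 3 →₀ ℕ)) ℂ :=
  ![X (1, mon 3 0 0), X (1, mon 2 1 0), X (1, mon 1 2 0), X (1, mon 2 0 1), -X (0, mon 0 2 1),
    X (0, mon 0 0 3), X (0, mon 1 0 2), X (0, mon 2 0 1), X (0, mon 0 1 2), -X (2, mon 2 1 0),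
    X (2, mon 0 3 0), X (2, mon 0 2 1), X (2, mon 0 1 2), X (2, mon 1 2 0), -X (1, mon 1 0 2)]

theorem eval_secPoly (ω : PolyForm) (i : Fin 15) :
    eval (fun x => coeff x.2 (ω x.1)) (secPoly i) = sec ω i := by
  fin_cases i <;> simp [secPoly, sec]

theorem secPoly_isHomogeneous (i : Fin 15) : (secPoly i).IsHomogeneous 1 := by
  fin_cases i <;> first | exact isHomogeneous_X _ _ | exact (isHomogeneous_X _ _).neg

/-- The points of the projective space at which all the homogeneous components of the polynomial `P`
in the fifteen coordinates vanish. -/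
def zeroLocus (P : MvPolynomial (Fin 15) ℂ) : Set FormProj :=
  {F | ∀ n, eval (sec F.rep) (homogeneousComponent n P) = 0}

theorem isZariskiClosed_zeroLocus (P : MvPolynomial (Fin 15) ℂ) :
    IsZariskiClosed (zeroLocus P) := by
  refine ⟨Set.range fun n => aeval secPoly (homogeneousComponent n P), ?_, ?_⟩
  · rintro _ ⟨n, rfl⟩
    exact ⟨_, (homogeneousComponent_isHomogeneous n P).aeval _ secPoly_isHomogeneous⟩
  · ext F
    have h : ∀ p : MvPolynomial (Fin 15) ℂ, eval (fun x => coeff x.2 (F.rep.1 x.1))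
        (aeval secPoly p) = eval (sec F.rep) p := by
      intro p
      have e : (aeval (fun x : Fin 3 × (Fin 3 →₀ ℕ) => coeff x.2 (F.rep.1 x.1)) :
          MvPolynomial _ ℂ →ₐ[ℂ] ℂ).comp (aeval secPoly) = aeval (sec F.rep) := by
        refine algHom_ext fun i => ?_
        rw [AlgHom.comp_apply, aeval_X, aeval_X]
        exact eval_secPoly _ i
      exact DFunLike.congr_fun e p
    simp only [zeroLocus, Set.mem_ofPred, Set.forall_mem_range, h]

theorem eval_smul_eq_sum (P : MvPolynomial (Fin 15) ℂ) (c : ℂ) (w : Fin 15 → ℂ) :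
    eval (c • w) P =
      ∑ n ∈ Finset.range (P.totalDegree + 1), eval w (homogeneousComponent n P) * c ^ n := by
  conv_lhs => rw [← sum_homogeneousComponent P, map_sum]
  refine Finset.sum_congr rfl fun n _ => ?_
  rw [eval_smul_of_isHomogeneous (homogeneousComponent_isHomogeneous n P), mul_comm]

/-- A point outside the zero locus of `P` has a representative at which `P` does not vanish. -/
theorem exists_eval_ne_zero {P : MvPolynomial (Fin 15) ℂ} {F : FormProj} (hF : F ∉ zeroLocus P) :
    ∃ v hv, F = pt v hv ∧ eval v P ≠ 0 := by
  obtain ⟨n, hn⟩ : ∃ n, eval (sec F.rep) (homogeneousComponent n P) ≠ 0 := by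
    by_contra! h
    exact hF h
  have hw : sec F.rep ≠ 0 := by
    intro h
    apply F.rep_nonzero
    rw [← formK_sec F.rep, h, formK_zero]
  have hFw : F = pt (sec F.rep) hw := by
    conv_lhs => rw [← F.mk_rep]
    simp only [pt, formK_sec]
  generalize sec F.rep = w at hn hw hFw
  let r : Polynomial ℂ := ∑ n ∈ Finset.range (P.totalDegree + 1),
    Polynomial.C (eval w (homogeneousComponent n P)) * Polynomial.X ^ n
  have hr : ∀ c, r.eval c = eval (c • w) P := fun c => by
    rw [eval_smul_eq_sum]
    simp [r, Polynomial.eval_finsetSum]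
  have hr0 : Polynomial.X * r ≠ 0 := by
    refine mul_ne_zero Polynomial.X_ne_zero fun h0 => hn ?_
    have h1 := congrArg (Polynomial.coeff · n) h0
    simp only [r, Polynomial.finsetSum_coeff, Polynomial.coeff_C_mul_X_pow,
      Finset.sum_ite_eq, Polynomial.coeff_zero] at h1
    split_ifs at h1 with hmem
    · exact h1
    · rw [homogeneousComponent_eq_zero, map_zero]
      simpa using hmem
  obtain ⟨c, hc⟩ : ∃ c, (Polynomial.X * r).eval c ≠ 0 := by
    by_contra! h
    exact hr0 (Polynomial.funext fun c => by rw [h, Polynomial.eval_zero])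
  rw [Polynomial.eval_mul, Polynomial.eval_X, hr] at hc
  have hc0 := left_ne_zero_of_mul hc
  exact ⟨c • w, smul_ne_zero hc0 hw, by rw [hFw, pt_eq_pt_iff]; exact ⟨c, hc0, rfl⟩,
    right_ne_zero_of_mul hc⟩

theorem pt_notMem_zeroLocus {P : MvPolynomial (Fin 15) ℂ} {v : Fin 15 → ℂ} (hv : v ≠ 0)
    (h : eval v P ≠ 0) : pt v hv ∉ zeroLocus P := by
  intro hmem
  obtain ⟨a, ha, e⟩ := exists_rep_pt v hv
  have hsec : v = a⁻¹ • sec (pt v hv).rep := by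
    rw [e, sec_smul, sec_formK, inv_smul_smul₀ ha]
  apply h
  rw [hsec, eval_smul_eq_sum]
  exact Finset.sum_eq_zero fun n _ => by rw [hmem n, zero_mul]

/-! ### Orbits in the closure of a generic orbit -/

theorem orbit_eq_orbit_iff {w w' : Fin 15 → ℂ} (hw : w ≠ 0) (hw' : w' ≠ 0) :
    MulAction.orbit PGL(3, ℂ) (pt w hw) = MulAction.orbit PGL(3, ℂ) (pt w' hw') ↔
      Equivalent w' w := by
  rw [MulAction.orbit_eq_iff, pt_mem_orbit_iff]

/-- The eight values of `r` in `exists_eta_mem_closure` give different orbits, since `r` is an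
invariant of the orbit of `eta r`. -/
theorem seven_le_encard {n : Fin 7 → ℂ} (h : genericity n ≠ 0) {v : Fin 15 → ℂ} (hv : v ≠ 0)
    (hvn : Equivalent v (familyAt 0 n)) :
    7 ≤ {O : Set FormProj | IsOrbitOfDim 7 O ∧
      O ⊆ closureIn (MulAction.orbit PGL(3, ℂ) (pt v hv))}.encard := by
  obtain ⟨r, hr, hr'⟩ := exists_eta_mem_closure h
  let f : Fin 4 × Bool → Set FormProj := fun p =>
    MulAction.orbit PGL(3, ℂ) (pt (eta (r p)) (eta_ne_zero _))
  have hf : Function.Injective f := by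
    intro p q hpq
    obtain ⟨hp, hp1, -⟩ := hr' p
    obtain ⟨hq, hq1, -⟩ := hr' q
    exact hr (eq_of_equivalent_eta hq hq1 hp hp1 ((orbit_eq_orbit_iff _ _).mp hpq)).symm
  have hsub : Set.range f ⊆ {O : Set FormProj | IsOrbitOfDim 7 O ∧
      O ⊆ closureIn (MulAction.orbit PGL(3, ℂ) (pt v hv))} := by
    rintro _ ⟨p, rfl⟩
    obtain ⟨hp, hp1, hcl⟩ := hr' p
    have hs := saturated_eta hp
    refine ⟨⟨_, (pt_mem_foliations_iff _ (eta_ne_zero _)).mpr hs, rfl, ?_⟩,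
      (orbit_subset_closureIn_iff hv hs).mpr (hvn.mem_closure_of_left hcl)⟩
    have := orbitDim_add_finrank_stab (eta (r p)) (eta_ne_zero _)
    rw [finrank_stab_eta hp hp1] at this
    omega
  refine le_trans ?_ (Set.encard_le_encard hsub)
  rw [← Set.image_univ, hf.injOn.encard_image, Set.encard_univ]
  simp
  norm_num

theorem setOf_isOrbitOfDim_six {n : Fin 7 → ℂ} (h : genericity n ≠ 0) {v : Fin 15 → ℂ} (hv : v ≠ 0)
    (hvn : Equivalent v (familyAt 0 n)) (hnd : NoDegenerate v) :
    {O : Set FormProj | IsOrbitOfDim 6 O ∧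
      O ⊆ closureIn (MulAction.orbit PGL(3, ℂ) (pt v hv))} = {MulAction.orbit PGL(3, ℂ) F1} := by
  ext O
  rw [Set.mem_ofPred, Set.mem_singleton_iff]
  constructor
  · rintro ⟨⟨G, hG, rfl, hdim⟩, hO⟩
    obtain ⟨w, hw, rfl⟩ := exists_pt G
    have hs := (pt_mem_foliations_iff w hw).mp hG
    have hd := orbitDim_add_finrank_stab w hw
    rw [F1_eq, orbit_eq_orbit_iff]
    exact hnd.equivalent_f1 ((orbit_subset_closureIn_iff hv hs).mp hO) hs (by omega)
  · rintro rfl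
    obtain ⟨r, -, hr⟩ := exists_eta_mem_closure h
    obtain ⟨h0, h1, hcl⟩ := hr (0, true)
    have hd := orbitDim_add_finrank_stab f1 f1_ne_zero
    rw [finrank_stab_f1] at hd
    rw [F1_eq]
    exact ⟨⟨_, (pt_mem_foliations_iff _ _).mpr saturated_f1, rfl, by omega⟩,
      (orbit_subset_closureIn_iff hv saturated_f1).mpr
        (mem_closure_trans (hvn.mem_closure_of_left hcl) (f1_mem_closure_eta h0 h1))⟩

end QuadFol

end

/-- For all quadratic foliations `F` outside a proper algebraic subset, the closure of the orbit of
`F` in the space of quadratic foliations contains at least seven orbits of dimension `7`, and the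
orbit of `𝓕₁` is the one and only orbit of dimension `6` that it contains. -/
theorem mainTheorem3 :
    ∃ S : Set QuadFol.FormProj, QuadFol.IsZariskiClosed S ∧ (QuadFol.foliations \ S).Nonempty ∧
      ∀ F ∈ QuadFol.foliations \ S,
        7 ≤ {O : Set QuadFol.FormProj | QuadFol.IsOrbitOfDim 7 O ∧
              O ⊆ QuadFol.closureIn (MulAction.orbit PGL(3, ℂ) F)}.encard ∧
        {O : Set QuadFol.FormProj | QuadFol.IsOrbitOfDim 6 O ∧
              O ⊆ QuadFol.closureIn (MulAction.orbit PGL(3, ℂ) F)}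
          = {MulAction.orbit PGL(3, ℂ) QuadFol.F1} := by
  obtain ⟨P, hP, hPn⟩ := QuadFol.exists_equivalent_familyAt
  obtain ⟨Q, hQ, hQd⟩ := QuadFol.exists_noDegenerate
  have hPQ : P * Q ≠ 0 := mul_ne_zero hP hQ
  refine ⟨QuadFol.zeroLocus (P * Q), QuadFol.isZariskiClosed_zeroLocus _, ?_, fun F hF => ?_⟩
  · obtain ⟨v, hv⟩ : ∃ v, eval v (P * Q) ≠ 0 := by
      by_contra! h
      exact hPQ (MvPolynomial.funext fun v => by rw [h, map_zero])
    have hv' := hv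
    rw [map_mul] at hv'
    obtain ⟨n, hvn, hn⟩ := hPn v (left_ne_zero_of_mul hv')
    have hs : QuadFol.Saturated v := (QuadFol.saturated_familyAt hn).equivalent hvn.symm
    exact ⟨QuadFol.pt v hs.ne_zero, (QuadFol.pt_mem_foliations_iff _ _).mpr hs,
      QuadFol.pt_notMem_zeroLocus _ hv⟩
  · obtain ⟨v, hv, rfl, hPQv⟩ := QuadFol.exists_eval_ne_zero hF.2
    rw [map_mul] at hPQv
    obtain ⟨n, hvn, hn⟩ := hPn v (left_ne_zero_of_mul hPQv)
    exact ⟨QuadFol.seven_le_encard hn hv hvn, QuadFol.setOf_isOrbitOfDim_six hn hv hvn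
      (hQd v (right_ne_zero_of_mul hPQv))⟩
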